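/- Theorem. Let $M$ be a compact smooth manifold of dimension $n$ without boundary, let $T>0$, and let $g(t)$, $t\in[0,T]$, be a smooth solution of the Ricci flow $\partial_t g=-2\operatorname{Ric}$ on $M$ such that $\operatorname{Ric}_{g(t)}\ge 0$ for every $t\in[0,T]$. Let $u:M\times[0,T]\to\mathbb{R}$ be a smooth solution, not identically zero, of the backward conjugate heat equation $$u_t+\Delta_{g(t)}u=R\,u ,$$ where $R$ is the scalar curvature of $g(t)$ (smoothness and $t$-derivatives at $t=0,T$ are one-sided). Define $$I(t)=\int_M u^2(x,t)\,d\mu_{g(t)}(x),$$ where $\mu_{g(t)}$ is the Riemannian measure of $g(t)$. Then, for every $t\in[0,T]$, the integral is finite and $I(t)>0$; the function $\log I$ is twice continuously differentiable on $[0,T]$; and $$(\log I(t))''\ge 0\qquad\text{for all } t\in[0,T].$$ -/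

import Mathlib

open Set MeasureTheory
open scoped Manifold ContDiff

/-! ### Riemannian geometry in local coordinates

In this section `G` is the matrix-valued function `(g_ij)` of the components of a Riemannian
metric in a coordinate chart with values in `ℝⁿ`. -/

/-- The partial derivative `∂_k f` of a function on (an open subset of) `ℝⁿ`. -/
noncomputable def partialDeriv {n : ℕ} (k : Fin n) (f : EuclideanSpace ℝ (Fin n) → ℝ)
    (y : EuclideanSpace ℝ (Fin n)) : ℝ :=
  fderiv ℝ f y (EuclideanSpace.single k 1)

/-- The Christoffel symbols of the Levi-Civita connection,
`Γ^k_ij = (1/2) g^{kl} (∂_i g_jl + ∂_j g_il - ∂_l g_ij)`. -/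
noncomputable def christoffel {n : ℕ}
    (G : EuclideanSpace ℝ (Fin n) → Matrix (Fin n) (Fin n) ℝ) (k i j : Fin n)
    (y : EuclideanSpace ℝ (Fin n)) : ℝ :=
  1 / 2 * ∑ l, (G y)⁻¹ k l *
    (partialDeriv i (fun z => G z j l) y + partialDeriv j (fun z => G z i l) y
      - partialDeriv l (fun z => G z i j) y)

/-- The components of the Ricci curvature,
`R_ij = ∂_k Γ^k_ij - ∂_j Γ^k_ik + Γ^k_kl Γ^l_ij - Γ^k_jl Γ^l_ik`
(with the sign for which round spheres have positive Ricci curvature). -/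
noncomputable def ricciCoord {n : ℕ}
    (G : EuclideanSpace ℝ (Fin n) → Matrix (Fin n) (Fin n) ℝ) (i j : Fin n)
    (y : EuclideanSpace ℝ (Fin n)) : ℝ :=
  ∑ k, (partialDeriv k (christoffel G k i j) y - partialDeriv j (christoffel G k i k) y
    + ∑ l, (christoffel G k k l y * christoffel G l i j y
      - christoffel G k j l y * christoffel G l i k y))

/-- The scalar curvature `R = g^{ij} R_ij`. -/
noncomputable def scalarCoord {n : ℕ}
    (G : EuclideanSpace ℝ (Fin n) → Matrix (Fin n) (Fin n) ℝ)
    (y : EuclideanSpace ℝ (Fin n)) : ℝ :=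
  ∑ i, ∑ j, (G y)⁻¹ i j * ricciCoord G i j y

/-- The Laplace-Beltrami operator `Δ f = g^{ij} (∂_i ∂_j f - Γ^k_ij ∂_k f)`. -/
noncomputable def laplacianCoord {n : ℕ}
    (G : EuclideanSpace ℝ (Fin n) → Matrix (Fin n) (Fin n) ℝ)
    (f : EuclideanSpace ℝ (Fin n) → ℝ) (y : EuclideanSpace ℝ (Fin n)) : ℝ :=
  ∑ i, ∑ j, (G y)⁻¹ i j *
    (partialDeriv i (partialDeriv j f) y - ∑ k, christoffel G k i j y * partialDeriv k f y)

/-! ### Riemannian metrics on a manifold -/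

/-- Smooth Riemannian metrics on a smooth manifold `M` of dimension `n` without boundary. -/
abbrev SmoothMetric (n : ℕ) (M : Type*) [TopologicalSpace M]
    [ChartedSpace (EuclideanSpace ℝ (Fin n)) M] [IsManifold (𝓡 n) ∞ M] : Type _ :=
  Bundle.ContMDiffRiemannianMetric (𝓡 n) ∞ (EuclideanSpace ℝ (Fin n))
    (fun x : M => TangentSpace (𝓡 n) x)

/-- The components `g_ij = g(∂_i, ∂_j)` of a metric in the chart `e`, as functions on the
target of `e`; the coordinate vector field `∂_i` is the image of the `i`-th standard basis vector
under the differential of `e⁻¹`. -/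
noncomputable def metricCoord {n : ℕ} {M : Type*} [TopologicalSpace M]
    [ChartedSpace (EuclideanSpace ℝ (Fin n)) M] [IsManifold (𝓡 n) ∞ M]
    (g : SmoothMetric n M) (e : OpenPartialHomeomorph M (EuclideanSpace ℝ (Fin n)))
    (y : EuclideanSpace ℝ (Fin n)) : Matrix (Fin n) (Fin n) ℝ :=
  Matrix.of fun i j =>
    g.inner (e.symm y)
      (mfderiv (𝓡 n) (𝓡 n) e.symm y (EuclideanSpace.single i (1 : ℝ)))
      (mfderiv (𝓡 n) (𝓡 n) e.symm y (EuclideanSpace.single j (1 : ℝ)))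

/-- The measure `√(det g_ij) dy¹ ⋯ dyⁿ` on the domain of the chart `e`, as a measure on `M`
(vanishing outside the domain of `e`). -/
noncomputable def chartVolume {n : ℕ} {M : Type*} [TopologicalSpace M]
    [ChartedSpace (EuclideanSpace ℝ (Fin n)) M] [IsManifold (𝓡 n) ∞ M]
    [MeasurableSpace M]
    (g : SmoothMetric n M) (e : OpenPartialHomeomorph M (EuclideanSpace ℝ (Fin n))) :
    Measure M :=
  ((volume.restrict e.target).withDensity
    (fun y => ENNReal.ofReal (Real.sqrt (metricCoord g e y).det))).map e.symm

/-- The Riemannian measure `dμ_g`. By the change of variables formula the measures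
`√(det g_ij) dy¹ ⋯ dyⁿ` of any two charts agree on the intersection of their domains; hence, when
countably many charts cover `M`, their supremum (in the lattice of measures on `M`) is the unique
measure that coincides with each of them on the domain of the corresponding chart. -/
noncomputable def riemannianVolume {n : ℕ} {M : Type*} [TopologicalSpace M]
    [ChartedSpace (EuclideanSpace ℝ (Fin n)) M] [IsManifold (𝓡 n) ∞ M]
    [MeasurableSpace M] (g : SmoothMetric n M) : Measure M :=
  ⨆ e ∈ atlas (EuclideanSpace ℝ (Fin n)) M, chartVolume g e

/-- The metric `g` has nonnegative Ricci curvature: `R_ij vⁱ vʲ ≥ 0` in every chart. -/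
def RicciNonneg {n : ℕ} {M : Type*} [TopologicalSpace M]
    [ChartedSpace (EuclideanSpace ℝ (Fin n)) M] [IsManifold (𝓡 n) ∞ M]
    (g : SmoothMetric n M) : Prop :=
  ∀ e ∈ atlas (EuclideanSpace ℝ (Fin n)) M, ∀ y ∈ e.target, ∀ v : Fin n → ℝ,
    0 ≤ ∑ i, ∑ j, ricciCoord (metricCoord g e) i j y * v i * v j

/-! ### Ricci flow and the backward conjugate heat equation -/

/-- `g(t)`, `t ∈ [0,T]`, is a smooth solution of the Ricci flow `∂_t g = -2 Ric` on `M`: in every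
chart the components `g_ij` are smooth in space and time (up to the end points of the time
interval, where the time derivative is one-sided) and satisfy `∂_t g_ij = -2 R_ij`. -/
structure IsRicciFlow {n : ℕ} {M : Type*} [TopologicalSpace M]
    [ChartedSpace (EuclideanSpace ℝ (Fin n)) M] [IsManifold (𝓡 n) ∞ M]
    (T : ℝ) (g : ℝ → SmoothMetric n M) : Prop where
  smooth : ∀ e ∈ atlas (EuclideanSpace ℝ (Fin n)) M, ∀ i j : Fin n,
    ContDiffOn ℝ ∞
      (fun p : EuclideanSpace ℝ (Fin n) × ℝ => metricCoord (g p.2) e p.1 i j)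
      (e.target ×ˢ Icc 0 T)
  evolution : ∀ e ∈ atlas (EuclideanSpace ℝ (Fin n)) M, ∀ y ∈ e.target, ∀ t ∈ Icc 0 T,
    ∀ i j : Fin n,
      HasDerivWithinAt (fun s => metricCoord (g s) e y i j)
        (-2 * ricciCoord (metricCoord (g t) e) i j y) (Icc 0 T) t

/-- `u : M × [0,T] → ℝ` is a smooth solution of the backward conjugate heat equation
`u_t + Δ_{g(t)} u = R u` along the family of metrics `g(t)`. -/
structure IsConjugateHeatSolution {n : ℕ} {M : Type*} [TopologicalSpace M]
    [ChartedSpace (EuclideanSpace ℝ (Fin n)) M] [IsManifold (𝓡 n) ∞ M]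
    (T : ℝ) (g : ℝ → SmoothMetric n M) (u : M → ℝ → ℝ) : Prop where
  smooth : ContMDiffOn ((𝓡 n).prod 𝓘(ℝ, ℝ)) 𝓘(ℝ, ℝ) ∞
    (fun p : M × ℝ => u p.1 p.2) (univ ×ˢ Icc 0 T)
  equation : ∀ e ∈ atlas (EuclideanSpace ℝ (Fin n)) M, ∀ y ∈ e.target, ∀ t ∈ Icc 0 T,
    derivWithin (fun s => u (e.symm y) s) (Icc 0 T) t
        + laplacianCoord (metricCoord (g t) e) (fun z => u (e.symm z) t) y
      = scalarCoord (metricCoord (g t) e) y * u (e.symm y) t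

/-- The unweighted energy `I(t) = ∫_M u²(x,t) dμ_{g(t)}(x)`. -/
noncomputable def energy {n : ℕ} {M : Type*} [TopologicalSpace M]
    [ChartedSpace (EuclideanSpace ℝ (Fin n)) M] [IsManifold (𝓡 n) ∞ M]
    [MeasurableSpace M] (g : ℝ → SmoothMetric n M) (u : M → ℝ → ℝ) (t : ℝ) : ℝ :=
  ∫ x, (u x t) ^ 2 ∂(riemannianVolume (g t))

/-!
# Log-convexity of the energy of the conjugate heat equation along the Ricci flow

Put `A u = -2 Δu + R u`, a symmetric operator on `L²(dμ)`; on solutions `A u = 2 u_t - R u`. Since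
`∂_t dμ = -R dμ`, Green's formula gives `I' = ∫ (2 |∇u|² + R u²) dμ = ⟨u, A u⟩`. Along the Ricci
flow `∂_t |∇u|² = 2 Ric(∇u, ∇u) + 2 ⟨∇u, ∇u_t⟩` and `∂_t R = ΔR + 2 |Ric|²`; differentiating `I'`
once more and integrating by parts, one finds

  `I'' = ‖A u‖² + ∫ (2 |Ric|² u² + 4 Ric(∇u, ∇u)) dμ`,

so `I'' ≥ ‖A u‖²` when `Ric ≥ 0`. The Cauchy–Schwarz inequality then yields `I'² ≤ I I''`, that is,
`(log I)'' = (I I'' - I'²) / I² ≥ 0` wherever `I` is positive.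

The same inequality shows that `I` has no zeros (`pos_of_sq_le_mul`): for every `ε > 0` the function
`log (I + ε)` is convex, and a tangent line at a time where `I` is positive bounds it from below
uniformly in `ε`. That `I` is positive at some time holds because the Riemannian measure charges
open sets (`isOpenPosMeasure_riemannianVolume`).

All local computations are made in the charts of the atlas. The evolution of the scalar curvature
(`IsLocalRicciFlow.hasDerivWithinAt_scalarCoord`) rests on the contracted second Bianchi identity
(`IsLocalMetric.contracted_bianchi`) and on the formula for the trace of the variation of the Ricci
tensor as a divergence (`IsLocalMetric.trace_ricciVariation`). Neither the symmetry nor the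
tensorial character of the Ricci curvature has to be computed from its coordinate expression: along
the flow, `-2 Ric` is the time derivative of the metric, which has both. A finite partition of unity
(`exists_finite_chart_partition`) carries Green's formula (`integral_gradPair_add_mul`) and the
formula for the time derivative of an integral (`hasDerivWithinAt_integral_riemannianVolume`) from
the charts to `M`. The two derivatives of the energy are computed in `hasDerivWithinAt_energy` and
`integral_sq_le_integral_timeDerivative_energyRate`.
-/

/-! ### Directional derivatives of matrix-valued functions -/

section MatrixCalculus

variable {V : Type*} [NormedAddCommGroup V] [NormedSpace ℝ V] {n : ℕ} {S : Set V} {v p : V}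

/-- The entrywise derivative within `S`, in the direction `v`, of a matrix-valued function. -/
noncomputable def matDeriv (S : Set V) (v : V) (A : V → Matrix (Fin n) (Fin n) ℝ) (p : V) :
    Matrix (Fin n) (Fin n) ℝ :=
  Matrix.of fun i j => fderivWithin ℝ (fun q => A q i j) S p v

/-- Entrywise smoothness of a matrix-valued function on a set. -/
def MatSmoothOn (S : Set V) (A : V → Matrix (Fin n) (Fin n) ℝ) : Prop :=
  ∀ i j, ContDiffOn ℝ ∞ (fun q => A q i j) S

theorem ContDiffOn.differentiableWithinAt_infty {W : Type*} [NormedAddCommGroup W]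
    [NormedSpace ℝ W] {f : V → W} (hf : ContDiffOn ℝ ∞ f S) (hp : p ∈ S) :
    DifferentiableWithinAt ℝ f S p :=
  hf.differentiableOn (by simp) p hp

theorem ContDiffOn.fderivWithin_apply_infty (hS : UniqueDiffOn ℝ S) {f : V → ℝ}
    (hf : ContDiffOn ℝ ∞ f S) (v : V) : ContDiffOn ℝ ∞ (fun q => fderivWithin ℝ f S q v) S :=
  (hf.fderivWithin hS (m := ∞) (by simp)).clm_apply contDiffOn_const

theorem fderivWithin_fderivWithin_comm (hS : UniqueDiffOn ℝ S) (hS' : S ⊆ closure (interior S))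
    {f : V → ℝ} (hf : ContDiffOn ℝ ∞ f S) (hp : p ∈ S) (v w : V) :
    fderivWithin ℝ (fun q => fderivWithin ℝ f S q v) S p w =
      fderivWithin ℝ (fun q => fderivWithin ℝ f S q w) S p v := by
  have hd : DifferentiableWithinAt ℝ (fderivWithin ℝ f S) S p :=
    (hf.fderivWithin hS (m := ∞) (by simp)).differentiableWithinAt_infty hp
  have key : ∀ v w : V, fderivWithin ℝ (fun q => fderivWithin ℝ f S q v) S p w
      = fderivWithin ℝ (fderivWithin ℝ f S) S p w v := by
    intro v w
    have := (hd.hasFDerivWithinAt.clm_apply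
      (hasFDerivWithinAt_const v p S)).fderivWithin (hS p hp)
    rw [this]; simp
  rw [key, key]
  exact ((hf p hp).isSymmSndFDerivWithinAt
    (by
      rw [minSmoothness_of_isRCLikeNormedField]
      exact WithTop.coe_le_coe.2 (le_top : (2 : ℕ∞) ≤ ⊤)) hS (hS' hp) hp).eq w v

theorem matDeriv_mul (hS : UniqueDiffWithinAt ℝ S p) {A B : V → Matrix (Fin n) (Fin n) ℝ}
    (hA : ∀ i j, DifferentiableWithinAt ℝ (fun q => A q i j) S p)
    (hB : ∀ i j, DifferentiableWithinAt ℝ (fun q => B q i j) S p) :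
    matDeriv S v (fun q => A q * B q) p = matDeriv S v A p * B p + A p * matDeriv S v B p := by
  ext i j
  have h : HasFDerivWithinAt (fun q => (A q * B q) i j) (∑ k,
      (A p i k • fderivWithin ℝ (fun q => B q k j) S p +
        B p k j • fderivWithin ℝ (fun q => A q i k) S p)) S p := by
    simp only [Matrix.mul_apply]
    exact HasFDerivWithinAt.fun_sum fun k _ =>
      (hA i k).hasFDerivWithinAt.mul (hB k j).hasFDerivWithinAt
  have h' := congrArg (fun L => L v) (h.fderivWithin hS)
  simp only [sum_apply, add_apply, smul_apply, smul_eq_mul] at h'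
  simp only [matDeriv, Matrix.of_apply, h', Matrix.add_apply]
  rw [Matrix.mul_apply, Matrix.mul_apply, ← Finset.sum_add_distrib]
  simp only [Matrix.of_apply]
  exact Finset.sum_congr rfl fun k _ => by ring

theorem matDeriv_congr {A B : V → Matrix (Fin n) (Fin n) ℝ} (h : EqOn A B S) (hp : p ∈ S) :
    matDeriv S v A p = matDeriv S v B p := by
  ext i j
  simp only [matDeriv, Matrix.of_apply]
  rw [fderivWithin_congr (fun q hq => by rw [h hq]) (by rw [h hp])]

theorem matDeriv_const (C : Matrix (Fin n) (Fin n) ℝ) :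
    matDeriv S v (fun _ => C) p = 0 := by
  ext i j; simp [matDeriv]

theorem matDeriv_transpose (A : V → Matrix (Fin n) (Fin n) ℝ) :
    matDeriv S v (fun q => (A q).transpose) p = (matDeriv S v A p).transpose := by
  ext i j; simp [matDeriv]

theorem matDeriv_add (hS : UniqueDiffWithinAt ℝ S p) {A B : V → Matrix (Fin n) (Fin n) ℝ}
    (hA : ∀ i j, DifferentiableWithinAt ℝ (fun q => A q i j) S p)
    (hB : ∀ i j, DifferentiableWithinAt ℝ (fun q => B q i j) S p) :
    matDeriv S v (fun q => A q + B q) p = matDeriv S v A p + matDeriv S v B p := by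
  ext i j
  simp [matDeriv, fderivWithin_fun_add hS (hA i j) (hB i j)]

theorem matDeriv_sub (hS : UniqueDiffWithinAt ℝ S p) {A B : V → Matrix (Fin n) (Fin n) ℝ}
    (hA : ∀ i j, DifferentiableWithinAt ℝ (fun q => A q i j) S p)
    (hB : ∀ i j, DifferentiableWithinAt ℝ (fun q => B q i j) S p) :
    matDeriv S v (fun q => A q - B q) p = matDeriv S v A p - matDeriv S v B p := by
  ext i j
  simp [matDeriv, fderivWithin_fun_sub hS (hA i j) (hB i j)]

theorem MatSmoothOn.differentiableWithinAt {A : V → Matrix (Fin n) (Fin n) ℝ}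
    (hA : MatSmoothOn S A) (hp : p ∈ S) (i j : Fin n) :
    DifferentiableWithinAt ℝ (fun q => A q i j) S p :=
  (hA i j).differentiableWithinAt_infty hp

theorem MatSmoothOn.mul {A B : V → Matrix (Fin n) (Fin n) ℝ}
    (hA : MatSmoothOn S A) (hB : MatSmoothOn S B) : MatSmoothOn S (fun q => A q * B q) := by
  intro i j
  simp only [Matrix.mul_apply]
  exact ContDiffOn.sum fun k _ => (hA i k).mul (hB k j)

theorem MatSmoothOn.add {A B : V → Matrix (Fin n) (Fin n) ℝ}
    (hA : MatSmoothOn S A) (hB : MatSmoothOn S B) : MatSmoothOn S (fun q => A q + B q) :=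
  fun i j => (hA i j).add (hB i j)

theorem MatSmoothOn.sub {A B : V → Matrix (Fin n) (Fin n) ℝ}
    (hA : MatSmoothOn S A) (hB : MatSmoothOn S B) : MatSmoothOn S (fun q => A q - B q) :=
  fun i j => (hA i j).sub (hB i j)

theorem MatSmoothOn.transpose {A : V → Matrix (Fin n) (Fin n) ℝ}
    (hA : MatSmoothOn S A) : MatSmoothOn S (fun q => (A q).transpose) :=
  fun i j => hA j i

theorem MatSmoothOn.matDeriv (hS : UniqueDiffOn ℝ S) {A : V → Matrix (Fin n) (Fin n) ℝ}
    (hA : MatSmoothOn S A) : MatSmoothOn S (matDeriv S v A) :=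
  fun i j => (hA i j).fderivWithin_apply_infty hS v

theorem MatSmoothOn.det {A : V → Matrix (Fin n) (Fin n) ℝ}
    (hA : MatSmoothOn S A) : ContDiffOn ℝ ∞ (fun q => (A q).det) S := by
  simp only [Matrix.det_apply]
  exact ContDiffOn.sum fun σ _ => (contDiffOn_prod fun i _ => hA (σ i) i).const_smul _

theorem MatSmoothOn.inv {A : V → Matrix (Fin n) (Fin n) ℝ}
    (hA : MatSmoothOn S A) (hdet : ∀ q ∈ S, (A q).det ≠ 0) :
    MatSmoothOn S (fun q => (A q)⁻¹) := by
  intro i j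
  simp only [Matrix.inv_def, Ring.inverse_eq_inv', Matrix.smul_apply, smul_eq_mul]
  refine (hA.det.inv hdet).mul ?_
  simp only [Matrix.adjugate_apply]
  refine MatSmoothOn.det (A := fun q => (A q).updateRow j (Pi.single i 1)) fun a b => ?_
  by_cases h : a = j
  · subst h; simp only [Matrix.updateRow_self]; exact contDiffOn_const
  · simp only [Matrix.updateRow_ne h]; exact hA a b

theorem matDeriv_inv (hS : UniqueDiffOn ℝ S) {A : V → Matrix (Fin n) (Fin n) ℝ}
    (hA : MatSmoothOn S A) (hdet : ∀ q ∈ S, (A q).det ≠ 0) (hp : p ∈ S) :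
    matDeriv S v (fun q => (A q)⁻¹) p = -((A p)⁻¹ * matDeriv S v A p * (A p)⁻¹) := by
  have hu : ∀ q ∈ S, IsUnit (A q).det := fun q hq => (hdet q hq).isUnit
  have h1 : matDeriv S v (fun q => (A q)⁻¹ * A q) p = 0 := by
    rw [matDeriv_congr (B := fun _ => 1) (fun q hq => Matrix.nonsing_inv_mul _ (hu q hq)) hp,
      matDeriv_const]
  rw [matDeriv_mul (hS p hp) ((hA.inv hdet).differentiableWithinAt hp)
    (hA.differentiableWithinAt hp)] at h1
  have h2 := congrArg (· * (A p)⁻¹) h1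
  simp only [add_mul, zero_mul, Matrix.mul_assoc, Matrix.mul_nonsing_inv _ (hu p hp),
    mul_one] at h2
  rw [Matrix.mul_assoc]
  exact eq_neg_of_add_eq_zero_left h2

/-- Jacobi's formula. -/
theorem fderivWithin_det (hS : UniqueDiffOn ℝ S) {A : V → Matrix (Fin n) (Fin n) ℝ}
    (hA : MatSmoothOn S A) (hp : p ∈ S) (hdet : (A p).det ≠ 0) :
    fderivWithin ℝ (fun q => (A q).det) S p v =
      (A p).det * ((A p)⁻¹ * matDeriv S v A p).trace := by
  have h : HasFDerivWithinAt (fun q => (A q).det)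
      (∑ σ : Equiv.Perm (Fin n), Equiv.Perm.sign σ •
        ∑ i, (∏ j ∈ Finset.univ.erase i, A p (σ j) j) •
          fderivWithin ℝ (fun q => A q (σ i) i) S p) S p := by
    simp only [Matrix.det_apply]
    exact HasFDerivWithinAt.fun_sum fun σ _ => (HasFDerivWithinAt.finsetProd fun i _ =>
      (hA.differentiableWithinAt hp (σ i) i).hasFDerivWithinAt).const_smul _
  have hadj : (A p).adjugate = (A p).det • (A p)⁻¹ := by
    rw [Matrix.inv_def, smul_smul, Ring.inverse_eq_inv', mul_inv_cancel₀ hdet, one_smul]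
  have h2 : (A p).det * ((A p)⁻¹ * matDeriv S v A p).trace
      = ((A p).adjugate * matDeriv S v A p).trace := by
    rw [hadj, Matrix.smul_mul, Matrix.trace_smul, smul_eq_mul]
  have h3 : ((A p).adjugate * matDeriv S v A p).trace
      = ∑ i, ((A p).updateCol i (fun k => matDeriv S v A p k i)).det := by
    simp only [Matrix.trace, Matrix.diag_apply]
    refine Finset.sum_congr rfl fun i _ => ?_
    rw [← Matrix.cramer_apply, Matrix.cramer_eq_adjugate_mulVec]
    rfl
  rw [h2, h3, h.fderivWithin (hS p hp)]
  simp only [Matrix.det_apply]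
  rw [Finset.sum_comm]
  simp only [sum_apply, smul_apply]
  refine Finset.sum_congr rfl fun σ _ => ?_
  rw [← Finset.smul_sum]
  congr 1
  refine Finset.sum_congr rfl fun i _ => ?_
  rw [← Finset.mul_prod_erase _ _ (Finset.mem_univ i)]
  simp only [Matrix.updateCol_self, smul_eq_mul, matDeriv, Matrix.of_apply]
  rw [mul_comm]
  congr 1
  exact Finset.prod_congr rfl fun j hj => by
    rw [Matrix.updateCol_ne (Finset.ne_of_mem_erase hj)]

end MatrixCalculus

/-! ### Partial derivatives on open subsets of Euclidean space -/

section PartialDerivatives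

variable {n : ℕ} {U : Set (EuclideanSpace ℝ (Fin n))} {f h : EuclideanSpace ℝ (Fin n) → ℝ}
  {y : EuclideanSpace ℝ (Fin n)}

theorem partialDeriv_eq_fderivWithin (hU : IsOpen U) (hy : y ∈ U) (k : Fin n)
    (f : EuclideanSpace ℝ (Fin n) → ℝ) :
    partialDeriv k f y = fderivWithin ℝ f U y (EuclideanSpace.single k 1) := by
  rw [partialDeriv, fderivWithin_of_isOpen hU hy]

theorem partialDeriv_congr (hU : IsOpen U) (hfh : EqOn f h U) (hy : y ∈ U) (k : Fin n) :
    partialDeriv k f y = partialDeriv k h y := by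
  rw [partialDeriv_eq_fderivWithin hU hy, partialDeriv_eq_fderivWithin hU hy,
    fderivWithin_congr hfh (hfh hy)]

theorem ContDiffOn.partialDeriv (hU : IsOpen U) (hf : ContDiffOn ℝ ∞ f U) (k : Fin n) :
    ContDiffOn ℝ ∞ (partialDeriv k f) U :=
  (hf.fderivWithin_apply_infty hU.uniqueDiffOn _).congr
    fun _ hy => partialDeriv_eq_fderivWithin hU hy k f

theorem ContDiffOn.differentiableAt_infty (hU : IsOpen U) (hf : ContDiffOn ℝ ∞ f U)
    (hy : y ∈ U) : DifferentiableAt ℝ f y :=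
  (hf.differentiableWithinAt_infty hy).differentiableAt (hU.mem_nhds hy)

theorem partialDeriv_mul (hf : DifferentiableAt ℝ f y) (hh : DifferentiableAt ℝ h y)
    (k : Fin n) : partialDeriv k (fun z => f z * h z) y =
      partialDeriv k f y * h y + f y * partialDeriv k h y := by
  simp only [partialDeriv, fderiv_fun_mul hf hh, add_apply, smul_apply, smul_eq_mul]
  ring

theorem partialDeriv_sub (hf : DifferentiableAt ℝ f y) (hh : DifferentiableAt ℝ h y)
    (k : Fin n) : partialDeriv k (fun z => f z - h z) y =
      partialDeriv k f y - partialDeriv k h y := by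
  simp only [partialDeriv, fderiv_fun_sub hf hh, sub_apply]

theorem partialDeriv_sum {ι : Type*} (s : Finset ι) {F : ι → EuclideanSpace ℝ (Fin n) → ℝ}
    (hF : ∀ i ∈ s, DifferentiableAt ℝ (F i) y) (k : Fin n) :
    partialDeriv k (fun z => ∑ i ∈ s, F i z) y = ∑ i ∈ s, partialDeriv k (F i) y := by
  simp only [partialDeriv, fderiv_fun_sum hF, sum_apply]

theorem partialDeriv_const_mul (c : ℝ) (hf : DifferentiableAt ℝ f y) (k : Fin n) :
    partialDeriv k (fun z => c * f z) y = c * partialDeriv k f y := by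
  simp only [partialDeriv, fderiv_const_mul hf, smul_apply, smul_eq_mul]

/-- The entrywise partial derivative, on the open set `U`, of a matrix-valued function. -/
noncomputable abbrev partialMat (U : Set (EuclideanSpace ℝ (Fin n))) (k : Fin n)
    (A : EuclideanSpace ℝ (Fin n) → Matrix (Fin n) (Fin n) ℝ) :
    EuclideanSpace ℝ (Fin n) → Matrix (Fin n) (Fin n) ℝ :=
  matDeriv U (EuclideanSpace.single k 1) A

theorem partialMat_apply (hU : IsOpen U) (hy : y ∈ U) (k : Fin n)
    (A : EuclideanSpace ℝ (Fin n) → Matrix (Fin n) (Fin n) ℝ) (i j : Fin n) :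
    partialMat U k A y i j = partialDeriv k (fun z => A z i j) y := by
  rw [partialDeriv_eq_fderivWithin hU hy]; rfl

theorem partialMat_comm (hU : IsOpen U)
    {A : EuclideanSpace ℝ (Fin n) → Matrix (Fin n) (Fin n) ℝ} (hA : MatSmoothOn U A)
    (hy : y ∈ U) (k l : Fin n) :
    partialMat U k (partialMat U l A) y = partialMat U l (partialMat U k A) y := by
  ext i j
  exact fderivWithin_fderivWithin_comm hU.uniqueDiffOn
    (hU.interior_eq.symm ▸ subset_closure) (hA i j) hy _ _

end PartialDerivatives

/-! ### The Levi-Civita connection in local coordinates -/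

section LocalGeometry

variable {n : ℕ} {U : Set (EuclideanSpace ℝ (Fin n))}
  {G : EuclideanSpace ℝ (Fin n) → Matrix (Fin n) (Fin n) ℝ} {y : EuclideanSpace ℝ (Fin n)}

/-- `G` is the component matrix of a smooth Riemannian metric on the open set `U ⊆ ℝⁿ`. Symmetry
is asked everywhere, as it holds for the components `metricCoord` at every point. -/
structure IsLocalMetric (U : Set (EuclideanSpace ℝ (Fin n)))
    (G : EuclideanSpace ℝ (Fin n) → Matrix (Fin n) (Fin n) ℝ) : Prop where
  isOpen : IsOpen U
  smooth : MatSmoothOn U G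
  symm : ∀ y i j, G y i j = G y j i
  posDef : ∀ y ∈ U, (G y).PosDef

/-- The connection matrices `(Γ_i)_{kl} = Γ^k_il`. -/
noncomputable def christoffelMat (G : EuclideanSpace ℝ (Fin n) → Matrix (Fin n) (Fin n) ℝ)
    (i : Fin n) (y : EuclideanSpace ℝ (Fin n)) : Matrix (Fin n) (Fin n) ℝ :=
  Matrix.of fun k l => christoffel G k i l y

/-- The curvature matrices `K_ij = ∂_i Γ_j - ∂_j Γ_i + [Γ_i, Γ_j]`. -/
noncomputable def curvatureMat (U : Set (EuclideanSpace ℝ (Fin n)))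
    (G : EuclideanSpace ℝ (Fin n) → Matrix (Fin n) (Fin n) ℝ) (i j : Fin n)
    (y : EuclideanSpace ℝ (Fin n)) : Matrix (Fin n) (Fin n) ℝ :=
  partialMat U i (christoffelMat G j) y - partialMat U j (christoffelMat G i) y
    + christoffelMat G i y * christoffelMat G j y - christoffelMat G j y * christoffelMat G i y

theorem christoffel_symm (hG : IsLocalMetric U G) (k i j : Fin n) :
    christoffel G k i j = christoffel G k j i := by
  ext y
  simp only [christoffel]
  congr 1
  refine Finset.sum_congr rfl fun l _ => ?_
  rw [show (fun z => G z i j) = fun z => G z j i from funext fun z => hG.symm z i j]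
  ring

namespace IsLocalMetric

theorem transpose_eq (hG : IsLocalMetric U G) (y : EuclideanSpace ℝ (Fin n)) :
    (G y).transpose = G y := by
  ext i j; exact hG.symm y j i

theorem inv_symm (hG : IsLocalMetric U G) (y : EuclideanSpace ℝ (Fin n)) (i j : Fin n) :
    (G y)⁻¹ i j = (G y)⁻¹ j i := by
  have : ((G y)⁻¹).transpose = (G y)⁻¹ := by
    rw [Matrix.transpose_nonsing_inv, hG.transpose_eq]
  exact congrFun (congrFun this j) i

theorem det_pos (hG : IsLocalMetric U G) (hy : y ∈ U) : 0 < (G y).det := (hG.posDef y hy).det_pos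

theorem isUnit_det (hG : IsLocalMetric U G) (hy : y ∈ U) : IsUnit (G y).det :=
  (hG.det_pos hy).ne'.isUnit

theorem smooth_inv (hG : IsLocalMetric U G) : MatSmoothOn U (fun z => (G z)⁻¹) :=
  hG.smooth.inv fun _ hq => (hG.det_pos hq).ne'

theorem smooth_christoffel (hG : IsLocalMetric U G) (k i j : Fin n) :
    ContDiffOn ℝ ∞ (christoffel G k i j) U := by
  unfold christoffel
  refine contDiffOn_const.mul (ContDiffOn.sum fun l _ => (hG.smooth_inv k l).mul ?_)
  exact (((hG.smooth j l).partialDeriv hG.isOpen i).add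
    ((hG.smooth i l).partialDeriv hG.isOpen j)).sub ((hG.smooth i j).partialDeriv hG.isOpen l)

theorem smooth_christoffelMat (hG : IsLocalMetric U G) (i : Fin n) :
    MatSmoothOn U (christoffelMat G i) :=
  fun k l => hG.smooth_christoffel k i l

theorem mul_christoffelMat_apply (hG : IsLocalMetric U G) (hy : y ∈ U) (i m l : Fin n) :
    (G y * christoffelMat G i y) m l = 1 / 2 * (partialDeriv i (fun z => G z l m) y
      + partialDeriv l (fun z => G z i m) y - partialDeriv m (fun z => G z i l) y) := by
  have h : christoffelMat G i y = (G y)⁻¹ * Matrix.of fun m l =>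
      1 / 2 * (partialDeriv i (fun z => G z l m) y
      + partialDeriv l (fun z => G z i m) y - partialDeriv m (fun z => G z i l) y) := by
    ext k l
    simp only [christoffelMat, christoffel, Matrix.of_apply, Matrix.mul_apply, Finset.mul_sum]
    exact Finset.sum_congr rfl fun m _ => by ring
  rw [h, Matrix.mul_nonsing_inv_cancel_left _ _ (hG.isUnit_det hy), Matrix.of_apply]

/-- Compatibility of the Levi-Civita connection with the metric. -/
theorem partialMat_metric (hG : IsLocalMetric U G) (hy : y ∈ U) (i : Fin n) :
    partialMat U i G y = (christoffelMat G i y).transpose * G y + G y * christoffelMat G i y := by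
  have ht : (christoffelMat G i y).transpose * G y = (G y * christoffelMat G i y).transpose := by
    rw [Matrix.transpose_mul, hG.transpose_eq]
  rw [ht]
  ext m l
  rw [partialMat_apply hG.isOpen hy, Matrix.add_apply, Matrix.transpose_apply,
    hG.mul_christoffelMat_apply hy, hG.mul_christoffelMat_apply hy,
    show (fun z => G z l m) = fun z => G z m l from funext fun z => hG.symm z l m]
  ring

theorem partialMat_inv (hG : IsLocalMetric U G) (hy : y ∈ U) (i : Fin n) :
    partialMat U i (fun z => (G z)⁻¹) y =
      -((G y)⁻¹ * (christoffelMat G i y).transpose + christoffelMat G i y * (G y)⁻¹) := by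
  rw [partialMat, matDeriv_inv hG.isOpen.uniqueDiffOn hG.smooth
    (fun q hq => (hG.det_pos hq).ne') hy, ← partialMat, hG.partialMat_metric hy]
  rw [Matrix.mul_add, Matrix.add_mul, Matrix.nonsing_inv_mul_cancel_left _ _ (hG.isUnit_det hy),
    ← Matrix.mul_assoc, Matrix.mul_nonsing_inv_cancel_right _ _ (hG.isUnit_det hy)]

theorem partialDeriv_inv (hG : IsLocalMetric U G) (hy : y ∈ U) (k i j : Fin n) :
    partialDeriv k (fun z => (G z)⁻¹ i j) y =
      -∑ l, ((G y)⁻¹ i l * christoffel G j k l y + (G y)⁻¹ j l * christoffel G i k l y) := by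
  rw [← partialMat_apply hG.isOpen hy, hG.partialMat_inv hy, Matrix.neg_apply, Matrix.add_apply,
    Matrix.mul_apply, Matrix.mul_apply, ← Finset.sum_add_distrib]
  congr 1
  refine Finset.sum_congr rfl fun l _ => ?_
  rw [hG.inv_symm y l j]
  simp only [christoffelMat, Matrix.transpose_apply, Matrix.of_apply]
  ring

theorem partialDeriv_sqrt_det (hG : IsLocalMetric U G) (hy : y ∈ U) (k : Fin n) :
    partialDeriv k (fun z => √(G z).det) y = √(G y).det * ∑ l, christoffel G l k l y := by
  have hd : DifferentiableAt ℝ (fun z => (G z).det) y :=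
    hG.smooth.det.differentiableAt_infty hG.isOpen hy
  have hpos := hG.det_pos hy
  have h1 : partialDeriv k (fun z => (G z).det) y
      = (G y).det * (2 * ∑ l, christoffel G l k l y) := by
    rw [partialDeriv_eq_fderivWithin hG.isOpen hy, fderivWithin_det hG.isOpen.uniqueDiffOn
      hG.smooth hy hpos.ne']
    change _ * Matrix.trace (_ * partialMat U k G y) = _
    rw [hG.partialMat_metric hy, Matrix.mul_add, Matrix.trace_add,
      Matrix.nonsing_inv_mul_cancel_left _ _ (hG.isUnit_det hy), ← Matrix.mul_assoc,
      Matrix.trace_mul_comm]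
    rw [Matrix.mul_nonsing_inv_cancel_left _ _ (hG.isUnit_det hy), Matrix.trace_transpose]
    simp only [Matrix.trace, christoffelMat, Matrix.diag_apply, Matrix.of_apply]
    ring
  have h2 : partialDeriv k (fun z => √(G z).det) y
      = 1 / (2 * √(G y).det) * partialDeriv k (fun z => (G z).det) y := by
    simp only [partialDeriv]
    rw [(hd.hasFDerivAt.sqrt hpos.ne').fderiv]
    rfl
  rw [h2, h1]
  nth_rewrite 2 [← Real.mul_self_sqrt hpos.le]
  have := (Real.sqrt_pos.2 hpos).ne'
  field_simp

theorem smooth_sqrt_det (hG : IsLocalMetric U G) :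
    ContDiffOn ℝ ∞ (fun z => √(G z).det) U :=
  hG.smooth.det.sqrt fun _ hz => (hG.det_pos hz).ne'

end IsLocalMetric

end LocalGeometry

/-! ### The contracted second Bianchi identity -/

section Bianchi

variable {n : ℕ} {U : Set (EuclideanSpace ℝ (Fin n))}
  {G : EuclideanSpace ℝ (Fin n) → Matrix (Fin n) (Fin n) ℝ} {y : EuclideanSpace ℝ (Fin n)}

namespace IsLocalMetric

theorem uniqueDiffOn (hG : IsLocalMetric U G) : UniqueDiffOn ℝ U := hG.isOpen.uniqueDiffOn

theorem smooth_curvatureMat (hG : IsLocalMetric U G) (i j : Fin n) :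
    MatSmoothOn U (curvatureMat U G i j) := by
  have h := hG.smooth_christoffelMat
  have hu := hG.uniqueDiffOn
  exact ((((h j).matDeriv hu).sub ((h i).matDeriv hu)).add ((h i).mul (h j))).sub ((h j).mul (h i))

theorem curvatureMat_swap (i j : Fin n) : curvatureMat U G i j y = -curvatureMat U G j i y := by
  simp only [curvatureMat]; abel

/-- The curvature matrices are skew-adjoint with respect to the metric: this expresses the
commutation of the second partial derivatives of the metric. -/
theorem curvatureMat_skew (hG : IsLocalMetric U G) (hy : y ∈ U) (i j : Fin n) :
    (curvatureMat U G i j y).transpose * G y + G y * curvatureMat U G i j y = 0 := by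
  have hu := hG.uniqueDiffOn
  have hΓ := fun i => (hG.smooth_christoffelMat i).differentiableWithinAt hy
  have hΓt := fun i => (hG.smooth_christoffelMat i).transpose.differentiableWithinAt hy
  have key : ∀ i j, partialMat U i (partialMat U j G) y =
      (partialMat U i (christoffelMat G j) y).transpose * G y
      + (christoffelMat G j y).transpose * partialMat U i G y
      + (partialMat U i G y * christoffelMat G j y
        + G y * partialMat U i (christoffelMat G j) y) := fun i j => by
    rw [partialMat, matDeriv_congr (fun z hz => hG.partialMat_metric hz j) hy,
      matDeriv_add (hu y hy)
      (((hG.smooth_christoffelMat j).transpose.mul hG.smooth).differentiableWithinAt hy)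
      ((hG.smooth.mul (hG.smooth_christoffelMat j)).differentiableWithinAt hy),
      matDeriv_mul (hu y hy) (hΓt j) (hG.smooth.differentiableWithinAt hy),
      matDeriv_mul (hu y hy) (hG.smooth.differentiableWithinAt hy) (hΓ j),
      matDeriv_transpose]
  have h := partialMat_comm hG.isOpen hG.smooth hy i j
  rw [key, key, hG.partialMat_metric hy, hG.partialMat_metric hy] at h
  rw [← sub_eq_zero] at h
  rw [← h, curvatureMat]
  simp only [Matrix.transpose_sub, Matrix.transpose_add, Matrix.transpose_mul]
  noncomm_ring

/-- The second Bianchi identity. -/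
theorem bianchi (hG : IsLocalMetric U G) (hy : y ∈ U) (m i j : Fin n) :
    (partialMat U m (curvatureMat U G i j) y + christoffelMat G m y * curvatureMat U G i j y
        - curvatureMat U G i j y * christoffelMat G m y)
    + (partialMat U i (curvatureMat U G j m) y + christoffelMat G i y * curvatureMat U G j m y
        - curvatureMat U G j m y * christoffelMat G i y)
    + (partialMat U j (curvatureMat U G m i) y + christoffelMat G j y * curvatureMat U G m i y
        - curvatureMat U G m i y * christoffelMat G j y) = 0 := by
  have hu := hG.uniqueDiffOn
  have h := hG.smooth_christoffelMat
  have hd := fun i => (h i).differentiableWithinAt hy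
  have hD := fun i j =>
    ((h j).matDeriv hu (v := EuclideanSpace.single i 1)).differentiableWithinAt hy
  have key : ∀ m i j, partialMat U m (curvatureMat U G i j) y =
      partialMat U m (partialMat U i (christoffelMat G j)) y
      - partialMat U m (partialMat U j (christoffelMat G i)) y
      + (partialMat U m (christoffelMat G i) y * christoffelMat G j y
        + christoffelMat G i y * partialMat U m (christoffelMat G j) y)
      - (partialMat U m (christoffelMat G j) y * christoffelMat G i y
        + christoffelMat G j y * partialMat U m (christoffelMat G i) y) := fun m i j => by
    have e : curvatureMat U G i j = fun z => partialMat U i (christoffelMat G j) z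
      - partialMat U j (christoffelMat G i) z
      + christoffelMat G i z * christoffelMat G j z
      - christoffelMat G j z * christoffelMat G i z := rfl
    rw [e, partialMat, matDeriv_sub (hu y hy)
      (((((h j).matDeriv hu).sub ((h i).matDeriv hu)).add
        ((h i).mul (h j))).differentiableWithinAt hy)
      (((h j).mul (h i)).differentiableWithinAt hy),
      matDeriv_add (hu y hy)
        ((((h j).matDeriv hu).sub ((h i).matDeriv hu)).differentiableWithinAt hy)
        (((h i).mul (h j)).differentiableWithinAt hy),
      matDeriv_sub (hu y hy) (hD i j) (hD j i), matDeriv_mul (hu y hy) (hd i) (hd j),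
      matDeriv_mul (hu y hy) (hd j) (hd i)]
  rw [key, key, key, partialMat_comm hG.isOpen (h j) hy m i, partialMat_comm hG.isOpen (h i) hy m j,
    partialMat_comm hG.isOpen (h m) hy i j]
  simp only [curvatureMat]
  noncomm_ring

/-- The second Bianchi identity for the curvature with its last index raised, in which form the
curvature is a skew-symmetric matrix. -/
theorem bianchi_raised (hG : IsLocalMetric U G) (hy : y ∈ U) (m i j : Fin n) :
    let S := fun i j z => curvatureMat U G i j z * (G z)⁻¹
    let D := fun m i j => partialMat U m (S i j) y + christoffelMat G m y * S i j y
      + S i j y * (christoffelMat G m y).transpose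
    D m i j + D i j m + D j m i = 0 := by
  intro S D
  have hu := hG.uniqueDiffOn
  have key : ∀ m i j, D m i j = (partialMat U m (curvatureMat U G i j) y
      + christoffelMat G m y * curvatureMat U G i j y
      - curvatureMat U G i j y * christoffelMat G m y) * (G y)⁻¹ := fun m i j => by
    have hinv := hG.partialMat_inv hy m
    rw [partialMat] at hinv
    simp only [D, S]
    rw [partialMat, matDeriv_mul (hu y hy) ((hG.smooth_curvatureMat i j).differentiableWithinAt hy)
      (hG.smooth_inv.differentiableWithinAt hy), hinv]
    noncomm_ring
  rw [key, key, key, ← add_mul, ← add_mul, hG.bianchi hy, zero_mul]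

theorem curvatureMat_raised_skew (hG : IsLocalMetric U G) (hy : y ∈ U) (i j : Fin n) :
    (curvatureMat U G i j y * (G y)⁻¹).transpose = -(curvatureMat U G i j y * (G y)⁻¹) := by
  have h := congrArg (fun X => (G y)⁻¹ * X * (G y)⁻¹) (hG.curvatureMat_skew hy i j)
  simp only [Matrix.mul_add, Matrix.add_mul, Matrix.mul_zero, Matrix.zero_mul,
    Matrix.nonsing_inv_mul_cancel_left _ _ (hG.isUnit_det hy)] at h
  rw [Matrix.mul_assoc, Matrix.mul_nonsing_inv_cancel_right _ _ (hG.isUnit_det hy)] at h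
  rw [Matrix.transpose_mul, Matrix.transpose_nonsing_inv, hG.transpose_eq]
  exact eq_neg_of_add_eq_zero_left h

end IsLocalMetric

theorem sum_sum_eq_zero_of_skew {ι : Type*} [Fintype ι] {f : ι → ι → ℝ}
    (hf : ∀ i j, f i j = -f j i) : ∑ i, ∑ j, f i j = 0 := by
  have h : ∑ i, ∑ j, f i j = -∑ i, ∑ j, f i j := by
    conv_lhs => rw [Finset.sum_comm]
    simp only [← Finset.sum_neg_distrib]
    exact Finset.sum_congr rfl fun i _ => Finset.sum_congr rfl fun j _ => hf j i
  linarith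

/-- Contraction of the second Bianchi identity, as an identity between arrays: `S i j` stands for
the curvature with its last index raised, `D m i j` for its derivative in the direction `m`. -/
theorem contract_bianchi (S : Fin n → Fin n → Matrix (Fin n) (Fin n) ℝ)
    (D : Fin n → Fin n → Fin n → Matrix (Fin n) (Fin n) ℝ) (Γ : Fin n → Matrix (Fin n) (Fin n) ℝ)
    (hS : ∀ i j a b, S i j a b = -S j i a b) (hS' : ∀ i j a b, S i j a b = -S i j b a)
    (hD : ∀ m i j a b, D m i j a b = -D m j i a b) (hD' : ∀ m i j a b, D m i j a b = -D m i j b a)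
    (hΓ : ∀ i k l, Γ i k l = Γ l k i)
    (hB : ∀ m i j, (D m i j + Γ m * S i j + S i j * (Γ m).transpose)
      + (D i j m + Γ i * S j m + S j m * (Γ i).transpose)
      + (D j m i + Γ j * S m i + S m i * (Γ j).transpose) = 0) (m : Fin n) :
    ∑ i, ∑ j, D m i j i j = 2 * ∑ i, ((∑ k, D i k m k i)
      + ∑ l, Γ i i l * (∑ k, S k m k l) - ∑ l, Γ i l m * (∑ k, S k l k i)) := by
  have h : ∑ i, ∑ j, ((D m i j + Γ m * S i j + S i j * (Γ m).transpose)
      + (D i j m + Γ i * S j m + S j m * (Γ i).transpose)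
      + (D j m i + Γ j * S m i + S m i * (Γ j).transpose)) i j = 0 :=
    Finset.sum_eq_zero fun i _ => Finset.sum_eq_zero fun j _ => by rw [hB]; rfl
  simp only [Matrix.add_apply, Matrix.mul_apply, Matrix.transpose_apply,
    Finset.sum_add_distrib] at h
  -- the two connection terms of the first covariant derivative
  have a2 : ∑ i, ∑ j, ∑ l, Γ m i l * S i j l j = ∑ i, ∑ l, Γ i l m * ∑ k, S k l k i := by
    rw [Finset.sum_comm (f := fun i l => Γ i l m * ∑ k, S k l k i)]
    refine Finset.sum_congr rfl fun i _ => ?_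
    rw [Finset.sum_comm]
    refine Finset.sum_congr rfl fun l _ => ?_
    rw [Finset.mul_sum]
    exact Finset.sum_congr rfl fun j _ => by rw [hΓ m i l, hS i j l j, hS' j i l j]; ring
  have a3 : ∑ i, ∑ j, ∑ l, S i j i l * Γ m j l = ∑ i, ∑ l, Γ i l m * ∑ k, S k l k i := by
    rw [Finset.sum_comm (f := fun i l => Γ i l m * ∑ k, S k l k i), Finset.sum_comm]
    refine Finset.sum_congr rfl fun j _ => ?_
    rw [Finset.sum_comm]
    refine Finset.sum_congr rfl fun l _ => ?_
    rw [Finset.mul_sum]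
    exact Finset.sum_congr rfl fun i _ => by rw [hΓ m j l]; ring
  -- the two divergence terms
  have b1 : ∑ i, ∑ j, D i j m i j = -∑ i, ∑ k, D i k m k i := by
    simp only [← Finset.sum_neg_distrib]
    exact Finset.sum_congr rfl fun i _ => Finset.sum_congr rfl fun j _ => hD' _ _ _ _ _
  have c1 : ∑ i, ∑ j, D j m i i j = -∑ i, ∑ k, D i k m k i := by
    rw [Finset.sum_comm]
    simp only [← Finset.sum_neg_distrib]
    exact Finset.sum_congr rfl fun i _ => Finset.sum_congr rfl fun j _ => hD _ _ _ _ _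
  have b2 : ∑ i, ∑ j, ∑ l, Γ i i l * S j m l j = -∑ i, ∑ l, Γ i i l * ∑ k, S k m k l := by
    simp only [← Finset.sum_neg_distrib, Finset.mul_sum]
    refine Finset.sum_congr rfl fun i _ => ?_
    rw [Finset.sum_comm]
    refine Finset.sum_congr rfl fun l _ => ?_
    exact Finset.sum_congr rfl fun j _ => by rw [hS' j m l j]; ring
  have c3 : ∑ i, ∑ j, ∑ l, S m i i l * Γ j j l = -∑ i, ∑ l, Γ i i l * ∑ k, S k m k l := by
    simp only [← Finset.sum_neg_distrib, Finset.mul_sum]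
    rw [Finset.sum_comm]
    refine Finset.sum_congr rfl fun j _ => ?_
    rw [Finset.sum_comm]
    refine Finset.sum_congr rfl fun l _ => ?_
    exact Finset.sum_congr rfl fun i _ => by rw [hS m i i l]; ring
  -- the contractions of a symmetric with a skew-symmetric array vanish
  have b3 : ∑ i, ∑ j, ∑ l, S j m i l * Γ i j l = 0 := by
    rw [Finset.sum_comm]
    exact Finset.sum_eq_zero fun j _ => sum_sum_eq_zero_of_skew fun i l => by
      rw [hΓ i j l, hS' j m i l]; ring
  have c2 : ∑ i, ∑ j, ∑ l, Γ j i l * S m i l j = 0 :=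
    Finset.sum_eq_zero fun i _ => sum_sum_eq_zero_of_skew fun j l => by
      rw [hΓ j i l, hS' m i l j]; ring
  rw [a2, a3, b1, b2, b3, c1, c2, c3] at h
  simp only [Finset.sum_add_distrib, Finset.sum_sub_distrib]
  linarith

/-- The Ricci curvature with its first index raised, `R_m^i = g^{ia} R_am`. -/
noncomputable def ricciMixed (G : EuclideanSpace ℝ (Fin n) → Matrix (Fin n) (Fin n) ℝ)
    (m i : Fin n) (y : EuclideanSpace ℝ (Fin n)) : ℝ :=
  ∑ a, ricciCoord G a m y * (G y)⁻¹ a i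

theorem scalarCoord_eq_sum_ricciMixed (y : EuclideanSpace ℝ (Fin n)) :
    scalarCoord G y = ∑ j, ricciMixed G j j y := by
  simp only [scalarCoord, ricciMixed]
  rw [Finset.sum_comm]
  exact Finset.sum_congr rfl fun j _ => Finset.sum_congr rfl fun i _ => mul_comm _ _

namespace IsLocalMetric

theorem ricciCoord_eq_sum_curvatureMat (hG : IsLocalMetric U G) (hy : y ∈ U) (a m : Fin n) :
    ricciCoord G a m y = ∑ k, curvatureMat U G k m y k a := by
  refine Finset.sum_congr rfl fun k _ => ?_
  simp only [curvatureMat, Matrix.sub_apply, Matrix.add_apply, partialMat_apply hG.isOpen hy,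
    Matrix.mul_apply, christoffelMat, Matrix.of_apply, Finset.sum_sub_distrib]
  change _ = partialDeriv k (christoffel G k m a) y - partialDeriv m (christoffel G k k a) y + _ - _
  simp only [christoffel_symm hG _ m a, christoffel_symm hG _ k a]
  ring

theorem ricciMixed_eq (hG : IsLocalMetric U G) (hy : y ∈ U) (m i : Fin n) :
    ricciMixed G m i y = ∑ k, (curvatureMat U G k m y * (G y)⁻¹) k i := by
  simp only [ricciMixed, hG.ricciCoord_eq_sum_curvatureMat hy, Finset.sum_mul, Matrix.mul_apply]
  rw [Finset.sum_comm]

theorem smooth_ricciCoord (hG : IsLocalMetric U G) (i j : Fin n) :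
    ContDiffOn ℝ ∞ (ricciCoord G i j) U :=
  (ContDiffOn.sum (s := Finset.univ) fun k _ => (hG.smooth_curvatureMat k j) k i).congr
    fun _ hy => hG.ricciCoord_eq_sum_curvatureMat hy i j

/-- The contracted second Bianchi identity `∇_m R = 2 ∇_i R_m^i`. -/
theorem contracted_bianchi (hG : IsLocalMetric U G) (hy : y ∈ U) (m : Fin n) :
    partialDeriv m (scalarCoord G) y = 2 * ∑ i, (partialDeriv i (ricciMixed G m i) y
      + ∑ l, christoffel G i i l y * ricciMixed G m l y
      - ∑ l, christoffel G l i m y * ricciMixed G l i y) := by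
  let S : Fin n → Fin n → EuclideanSpace ℝ (Fin n) → Matrix (Fin n) (Fin n) ℝ :=
    fun i j z => curvatureMat U G i j z * (G z)⁻¹
  have hSs : ∀ i j, MatSmoothOn U (S i j) := fun i j =>
    (hG.smooth_curvatureMat i j).mul hG.smooth_inv
  have hSd : ∀ i j a b, DifferentiableAt ℝ (fun z => S i j z a b) y := fun i j a b =>
    (hSs i j a b).differentiableAt_infty hG.isOpen hy
  have hS : ∀ i j z a b, S i j z a b = -S j i z a b := fun i j z a b => by
    simp only [S]; rw [curvatureMat_swap, neg_mul, Matrix.neg_apply]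
  have hS' : ∀ i j, ∀ z ∈ U, ∀ a b, S i j z a b = -S i j z b a := fun i j z hz a b =>
    congrFun (congrFun (hG.curvatureMat_raised_skew hz i j) b) a
  have hneg : ∀ (m : Fin n) (f h : EuclideanSpace ℝ (Fin n) → ℝ), (∀ z ∈ U, f z = -h z) →
      partialDeriv m f y = -partialDeriv m h y := fun m f h hfh => by
    rw [partialDeriv_congr hG.isOpen hfh hy]
    simp only [partialDeriv]
    rw [fderiv_fun_neg, neg_apply]
  have hB := contract_bianchi (fun i j => S i j y) (fun m i j => partialMat U m (S i j) y)
    (fun i => christoffelMat G i y) (fun i j a b => hS i j y a b)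
    (fun i j a b => hS' i j y hy a b)
    (fun m i j a b => by
      rw [partialMat_apply hG.isOpen hy, partialMat_apply hG.isOpen hy]
      exact hneg m _ _ fun z _ => hS i j z a b)
    (fun m i j a b => by
      rw [partialMat_apply hG.isOpen hy, partialMat_apply hG.isOpen hy]
      exact hneg m _ _ fun z hz => hS' i j z hz a b)
    (fun i k l => congrFun (christoffel_symm hG k i l) y)
    (fun m i j => hG.bianchi_raised hy m i j) m
  have hρ : ∀ m i, ∀ z ∈ U, ricciMixed G m i z = ∑ k, S k m z k i := fun m i z hz =>
    hG.ricciMixed_eq hz m i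
  have hR : ∀ z ∈ U, scalarCoord G z = ∑ i, ∑ j, S i j z i j := fun z hz => by
    rw [scalarCoord_eq_sum_ricciMixed, Finset.sum_comm]
    exact Finset.sum_congr rfl fun j _ => hρ j j z hz
  rw [partialDeriv_congr hG.isOpen hR hy,
    partialDeriv_sum _ fun i _ => DifferentiableAt.fun_sum fun j _ => hSd i j i j]
  simp only [partialMat_apply hG.isOpen hy] at hB
  have h1 : ∀ i, partialDeriv m (fun z => ∑ j, S i j z i j) y
      = ∑ j, partialDeriv m (fun z => S i j z i j) y := fun i =>
    partialDeriv_sum _ (fun j _ => hSd i j i j) m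
  have h2 : ∀ i, partialDeriv i (ricciMixed G m i) y
      = ∑ k, partialDeriv i (fun z => S k m z k i) y := fun i => by
    rw [partialDeriv_congr hG.isOpen (hρ m i) hy, partialDeriv_sum _ fun k _ => hSd k m k i]
  simp only [h1, h2, hρ _ _ y hy]
  exact hB

end IsLocalMetric

end Bianchi

/-! ### The trace of the variation of the Ricci curvature -/

section Variation

variable {n : ℕ} {U : Set (EuclideanSpace ℝ (Fin n))}
  {G : EuclideanSpace ℝ (Fin n) → Matrix (Fin n) (Fin n) ℝ} {y : EuclideanSpace ℝ (Fin n)}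

theorem sum_rotate₃ {ι : Type*} [Fintype ι] (f : ι → ι → ι → ℝ) :
    ∑ a, ∑ b, ∑ c, f a b c = ∑ b, ∑ c, ∑ a, f a b c := by
  rw [Finset.sum_comm]
  exact Finset.sum_congr rfl fun b _ => Finset.sum_comm

theorem sum_rotate₄ {ι : Type*} [Fintype ι] (f : ι → ι → ι → ι → ℝ) :
    ∑ a, ∑ b, ∑ c, ∑ d, f a b c d = ∑ b, ∑ c, ∑ d, ∑ a, f a b c d := by
  rw [Finset.sum_comm]
  exact Finset.sum_congr rfl fun b _ => sum_rotate₃ fun a c d => f a b c d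

namespace IsLocalMetric

/-- The Laplacian in divergence form, `Δ f = ∇_k (g^{ki} ∂_i f)`. -/
theorem laplacianCoord_eq_div (hG : IsLocalMetric U G) {f : EuclideanSpace ℝ (Fin n) → ℝ}
    (hf : ContDiffOn ℝ ∞ f U) (hy : y ∈ U) :
    laplacianCoord G f y = ∑ k, (partialDeriv k (fun z => ∑ i, (G z)⁻¹ k i * partialDeriv i f z) y
      + (∑ l, christoffel G l k l y) * ∑ i, (G y)⁻¹ k i * partialDeriv i f y) := by
  have hP : ∀ i j, DifferentiableAt ℝ (fun z => (G z)⁻¹ i j) y := fun i j =>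
    (hG.smooth_inv i j).differentiableAt_infty hG.isOpen hy
  have hf' := fun i => (hf.partialDeriv hG.isOpen i).differentiableAt_infty hG.isOpen hy
  have h1 : ∀ k, partialDeriv k (fun z => ∑ i, (G z)⁻¹ k i * partialDeriv i f z) y
      = ∑ i, (partialDeriv k (fun z => (G z)⁻¹ k i) y * partialDeriv i f y
        + (G y)⁻¹ k i * partialDeriv k (partialDeriv i f) y) := fun k => by
    rw [partialDeriv_sum _ fun i _ => (hP k i).fun_mul (hf' i)]
    exact Finset.sum_congr rfl fun i _ => partialDeriv_mul (hP k i) (hf' i) k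
  simp only [h1, hG.partialDeriv_inv hy, laplacianCoord, mul_sub, neg_mul,
    Finset.sum_add_distrib, Finset.sum_sub_distrib, Finset.sum_neg_distrib, Finset.sum_mul,
    Finset.mul_sum, add_mul]
  have e1 : ∑ k, ∑ i, ∑ l, (G y)⁻¹ k l * christoffel G i k l y * partialDeriv i f y
      = ∑ i, ∑ j, ∑ k, (G y)⁻¹ i j * (christoffel G k i j y * partialDeriv k f y) := by
    refine Finset.sum_congr rfl fun k _ => ?_
    rw [Finset.sum_comm]
    exact Finset.sum_congr rfl fun _ _ => Finset.sum_congr rfl fun _ _ => mul_assoc _ _ _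
  have e2 : ∑ k, ∑ i, ∑ l, (G y)⁻¹ i l * christoffel G k k l y * partialDeriv i f y
      = ∑ k, ∑ i, ∑ l, christoffel G l k l y * ((G y)⁻¹ k i * partialDeriv i f y) := by
    rw [sum_rotate₃, sum_rotate₃]
    refine Finset.sum_congr rfl fun l _ => ?_
    rw [Finset.sum_comm]
    refine Finset.sum_congr rfl fun i _ => Finset.sum_congr rfl fun k _ => ?_
    rw [christoffel_symm hG k k l, hG.inv_symm y i l]; ring
  rw [e1, e2]
  ring

/-- The variation of the Ricci curvature under a variation `C` of the Christoffel symbols. -/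
noncomputable def ricciVariation (G : EuclideanSpace ℝ (Fin n) → Matrix (Fin n) (Fin n) ℝ)
    (C : Fin n → Fin n → Fin n → EuclideanSpace ℝ (Fin n) → ℝ) (i j : Fin n)
    (y : EuclideanSpace ℝ (Fin n)) : ℝ :=
  ∑ k, (partialDeriv k (C k i j) y - partialDeriv j (C k i k) y
    + ∑ l, (C k k l y * christoffel G l i j y + christoffel G k k l y * C l i j y
      - (C k j l y * christoffel G l i k y + christoffel G k j l y * C l i k y)))

/-- The trace of the variation of the Ricci curvature is the divergence of the vector field
`g^{ij} C^k_ij - g^{ki} C^j_ij`. -/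
theorem trace_ricciVariation (hG : IsLocalMetric U G)
    {C : Fin n → Fin n → Fin n → EuclideanSpace ℝ (Fin n) → ℝ}
    (hC : ∀ k i j, ContDiffOn ℝ ∞ (C k i j) U) (hCs : ∀ k i j, ∀ z ∈ U, C k i j z = C k j i z)
    (hy : y ∈ U) :
    let W : Fin n → EuclideanSpace ℝ (Fin n) → ℝ := fun k z =>
      ∑ i, ∑ j, (G z)⁻¹ i j * C k i j z - ∑ i, ∑ j, (G z)⁻¹ k i * C j i j z
    ∑ i, ∑ j, (G y)⁻¹ i j * ricciVariation G C i j y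
      = ∑ k, (partialDeriv k (W k) y + (∑ l, christoffel G l k l y) * W k y) := by
  intro W
  have hP : ∀ i j, DifferentiableAt ℝ (fun z => (G z)⁻¹ i j) y := fun i j =>
    (hG.smooth_inv i j).differentiableAt_infty hG.isOpen hy
  have hC' := fun k i j => (hC k i j).differentiableAt_infty hG.isOpen hy
  have hW : ∀ k, partialDeriv k (W k) y
      = ∑ i, ∑ j, (partialDeriv k (fun z => (G z)⁻¹ i j) y * C k i j y
        + (G y)⁻¹ i j * partialDeriv k (C k i j) y)
      - ∑ i, ∑ j, (partialDeriv k (fun z => (G z)⁻¹ k i) y * C j i j y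
        + (G y)⁻¹ k i * partialDeriv k (C j i j) y) := fun k => by
    simp only [W]
    rw [partialDeriv_sub
      (DifferentiableAt.fun_sum fun i _ => DifferentiableAt.fun_sum fun j _ =>
        (hP i j).fun_mul (hC' k i j))
      (DifferentiableAt.fun_sum fun i _ => DifferentiableAt.fun_sum fun j _ =>
        (hP k i).fun_mul (hC' j i j)),
      partialDeriv_sum _
        (fun i _ => DifferentiableAt.fun_sum fun j _ => (hP i j).fun_mul (hC' k i j)),
      partialDeriv_sum _
        (fun i _ => DifferentiableAt.fun_sum fun j _ => (hP k i).fun_mul (hC' j i j))]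
    congr 1
    · refine Finset.sum_congr rfl fun i _ => ?_
      rw [partialDeriv_sum _ (fun j _ => (hP i j).fun_mul (hC' k i j))]
      exact Finset.sum_congr rfl fun j _ => partialDeriv_mul (hP i j) (hC' k i j) k
    · refine Finset.sum_congr rfl fun i _ => ?_
      rw [partialDeriv_sum _ (fun j _ => (hP k i).fun_mul (hC' j i j))]
      exact Finset.sum_congr rfl fun j _ => partialDeriv_mul (hP k i) (hC' j i j) k
  simp only [hW, hG.partialDeriv_inv hy, ricciVariation, W]
  simp only [mul_add, mul_sub, neg_mul,
    Finset.sum_add_distrib, Finset.sum_sub_distrib, Finset.sum_neg_distrib, Finset.sum_mul,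
    Finset.mul_sum, add_mul]
  set P := (G y)⁻¹ with hPdef
  have hPs : ∀ i j, P i j = P j i := fun i j => hG.inv_symm y i j
  have hΓ : ∀ k i j, christoffel G k i j y = christoffel G k j i y := fun k i j =>
    congrFun (christoffel_symm hG k i j) y
  have hCy : ∀ k i j, C k i j y = C k j i y := fun k i j => hCs k i j y hy
  have a1 : ∑ k, ∑ i, ∑ j, P i j * partialDeriv k (C k i j) y
      = ∑ i, ∑ j, ∑ k, P i j * partialDeriv k (C k i j) y := sum_rotate₃ _
  have a2 : ∑ k, ∑ i, ∑ j, P k i * partialDeriv k (C j i j) y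
      = ∑ i, ∑ j, ∑ k, P i j * partialDeriv j (C k i k) y := by
    rw [Finset.sum_comm]
    exact Finset.sum_congr rfl fun i _ => Finset.sum_congr rfl fun k _ =>
      Finset.sum_congr rfl fun j _ => by rw [hPs k i]
  have b1 : ∑ k, ∑ i, ∑ j, ∑ l, P i l * christoffel G j k l y * C k i j y
      = ∑ i, ∑ j, ∑ k, ∑ l, P i j * (christoffel G k j l y * C l i k y) := by
    rw [sum_rotate₄]
    refine Finset.sum_congr rfl fun i _ => ?_
    rw [Finset.sum_comm]
    refine Finset.sum_congr rfl fun l _ => Finset.sum_congr rfl fun j _ =>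
      Finset.sum_congr rfl fun k _ => ?_
    rw [hΓ j k l]; ring
  have b2 : ∑ k, ∑ i, ∑ j, ∑ l, P j l * christoffel G i k l y * C k i j y
      = ∑ i, ∑ j, ∑ k, ∑ l, P i j * (C k j l y * christoffel G l i k y) := by
    have : ∑ k, ∑ i, ∑ j, ∑ l, P j l * christoffel G i k l y * C k i j y
      = ∑ l, ∑ j, ∑ k, ∑ i, P j l * christoffel G i k l y * C k i j y := by
      rw [← sum_rotate₄ (fun l k i j => P j l * christoffel G i k l y * C k i j y)]
      refine Finset.sum_congr rfl fun l _ => ?_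
      rw [← sum_rotate₃ (fun j k i => P j l * christoffel G i k l y * C k i j y)]
    rw [this]
    refine Finset.sum_congr rfl fun l _ => Finset.sum_congr rfl fun j _ =>
      Finset.sum_congr rfl fun k _ => Finset.sum_congr rfl fun i _ => ?_
    rw [hPs l j, hΓ i k l, hCy k j i]; ring
  have c1 : ∑ k, ∑ i, ∑ j, ∑ l, P k l * christoffel G i k l y * C j i j y
      = ∑ i, ∑ j, ∑ k, ∑ l, P i j * (C k k l y * christoffel G l i j y) := by
    refine Finset.sum_congr rfl fun k _ => ?_
    rw [← sum_rotate₃ (fun l i j => P k l * christoffel G i k l y * C j i j y)]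
    refine Finset.sum_congr rfl fun l _ => ?_
    rw [Finset.sum_comm]
    refine Finset.sum_congr rfl fun j _ => Finset.sum_congr rfl fun i _ => ?_
    rw [hCy j j i]; ring
  have c2 : ∑ k, ∑ i, ∑ j, ∑ l, P i l * christoffel G k k l y * C j i j y
      = ∑ k, ∑ i, ∑ j, ∑ l, christoffel G l k l y * (P k i * C j i j y) := by
    have : ∑ k, ∑ i, ∑ j, ∑ l, P i l * christoffel G k k l y * C j i j y
        = ∑ l, ∑ i, ∑ j, ∑ k, P i l * christoffel G k k l y * C j i j y := by
      rw [← sum_rotate₄ (fun l k i j => P i l * christoffel G k k l y * C j i j y)]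
      exact Finset.sum_congr rfl fun l _ => sum_rotate₃ _
    rw [this]
    refine Finset.sum_congr rfl fun l _ => Finset.sum_congr rfl fun i _ =>
      Finset.sum_congr rfl fun j _ => Finset.sum_congr rfl fun k _ => ?_
    rw [hPs i l, hΓ k k l]; ring
  have d1 : ∑ k, ∑ i, ∑ j, ∑ l, christoffel G l k l y * (P i j * C k i j y)
      = ∑ i, ∑ j, ∑ k, ∑ l, P i j * (christoffel G k k l y * C l i j y) := by
    rw [sum_rotate₄]
    refine Finset.sum_congr rfl fun i _ => Finset.sum_congr rfl fun j _ =>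
      Finset.sum_congr rfl fun l _ => Finset.sum_congr rfl fun k _ => ?_
    rw [hΓ l k l]; ring
  rw [a1, a2, b1, b2, c1, c2, d1]
  ring

end IsLocalMetric

end Variation

/-! ### The trace of the Ricci variation along the Ricci flow -/

section RicciVariation

variable {n : ℕ} {U : Set (EuclideanSpace ℝ (Fin n))}
  {G : EuclideanSpace ℝ (Fin n) → Matrix (Fin n) (Fin n) ℝ} {y : EuclideanSpace ℝ (Fin n)}

namespace IsLocalMetric

theorem smooth_scalarCoord (hG : IsLocalMetric U G) : ContDiffOn ℝ ∞ (scalarCoord G) U :=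
  ContDiffOn.sum fun i _ => ContDiffOn.sum fun j _ =>
    (hG.smooth_inv i j).mul (hG.smooth_ricciCoord i j)

theorem partialDeriv_scalarCoord (hG : IsLocalMetric U G)
    (hsymm : ∀ z ∈ U, ∀ i j, ricciCoord G i j z = ricciCoord G j i z) (hy : y ∈ U) (l : Fin n) :
    partialDeriv l (scalarCoord G) y =
      ∑ i, ∑ j, (G y)⁻¹ i j * partialDeriv l (ricciCoord G i j) y
      - 2 * ∑ i, ∑ j, ∑ m, (G y)⁻¹ i m * christoffel G j l m y * ricciCoord G i j y := by
  have hP : ∀ i j, DifferentiableAt ℝ (fun z => (G z)⁻¹ i j) y := fun i j =>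
    (hG.smooth_inv i j).differentiableAt_infty hG.isOpen hy
  have hQ := fun i j => (hG.smooth_ricciCoord i j).differentiableAt_infty hG.isOpen hy
  have h1 : partialDeriv l (scalarCoord G) y = ∑ i, ∑ j,
      (partialDeriv l (fun z => (G z)⁻¹ i j) y * ricciCoord G i j y
        + (G y)⁻¹ i j * partialDeriv l (ricciCoord G i j) y) := by
    unfold scalarCoord
    rw [partialDeriv_sum _
      (fun i _ => DifferentiableAt.fun_sum fun j _ => (hP i j).fun_mul (hQ i j))]
    refine Finset.sum_congr rfl fun i _ => ?_
    rw [partialDeriv_sum _ (fun j _ => (hP i j).fun_mul (hQ i j))]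
    exact Finset.sum_congr rfl fun j _ => partialDeriv_mul (hP i j) (hQ i j) l
  rw [h1]
  simp only [hG.partialDeriv_inv hy, neg_mul, Finset.sum_mul, add_mul, Finset.sum_add_distrib,
    Finset.sum_neg_distrib]
  have h2 : ∑ i, ∑ j, ∑ m, (G y)⁻¹ j m * christoffel G i l m y * ricciCoord G i j y
      = ∑ i, ∑ j, ∑ m, (G y)⁻¹ i m * christoffel G j l m y * ricciCoord G i j y := by
    rw [Finset.sum_comm]
    refine Finset.sum_congr rfl fun i _ => Finset.sum_congr rfl fun j _ =>
      Finset.sum_congr rfl fun m _ => ?_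
    rw [hsymm y hy j i]
  rw [h2]
  ring

/-- The contracted Bianchi identity in the form `2 g^{ij} ∇_i R_jl = g^{ij} ∇_l R_ij`, written out
in coordinates after cancelling the connection terms that occur on both sides. -/
theorem sum_inv_mul_partialDeriv_ricciCoord (hG : IsLocalMetric U G)
    (hsymm : ∀ z ∈ U, ∀ i j, ricciCoord G i j z = ricciCoord G j i z) (hy : y ∈ U) (l : Fin n) :
    ∑ i, ∑ j, (G y)⁻¹ i j * partialDeriv l (ricciCoord G i j) y =
      2 * ∑ i, ∑ j, (G y)⁻¹ i j * partialDeriv i (ricciCoord G j l) y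
      - 2 * ∑ i, ∑ j, ∑ m, (G y)⁻¹ i j * ricciCoord G l m y * christoffel G m i j y := by
  have hP : ∀ i j, DifferentiableAt ℝ (fun z => (G z)⁻¹ i j) y := fun i j =>
    (hG.smooth_inv i j).differentiableAt_infty hG.isOpen hy
  have hQ := fun i j => (hG.smooth_ricciCoord i j).differentiableAt_infty hG.isOpen hy
  have hB := hG.contracted_bianchi hy l
  rw [hG.partialDeriv_scalarCoord hsymm hy] at hB
  have h1 : ∀ i, partialDeriv i (ricciMixed G l i) y = ∑ a,
      (partialDeriv i (ricciCoord G a l) y * (G y)⁻¹ a i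
        + ricciCoord G a l y * partialDeriv i (fun z => (G z)⁻¹ a i) y) := fun i => by
    unfold ricciMixed
    rw [partialDeriv_sum _ (fun a _ => (hQ a l).fun_mul (hP a i))]
    exact Finset.sum_congr rfl fun a _ => partialDeriv_mul (hQ a l) (hP a i) i
  simp only [h1, hG.partialDeriv_inv hy, ricciMixed, Finset.sum_add_distrib, mul_neg,
    Finset.sum_neg_distrib, Finset.sum_sub_distrib, mul_add] at hB
  have hΓ : ∀ k i j, christoffel G k i j y = christoffel G k j i y := fun k i j =>
    congrFun (christoffel_symm hG k i j) y
  have e1 : ∑ i, ∑ a, partialDeriv i (ricciCoord G a l) y * (G y)⁻¹ a i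
      = ∑ i, ∑ j, (G y)⁻¹ i j * partialDeriv i (ricciCoord G j l) y :=
    Finset.sum_congr rfl fun i _ => Finset.sum_congr rfl fun a _ => by
      rw [hG.inv_symm y a i, mul_comm]
  have e2 : ∑ i, ∑ a, ∑ m, ricciCoord G a l y * ((G y)⁻¹ a m * christoffel G i i m y)
      = ∑ i, ∑ m, ∑ a, christoffel G i i m y * (ricciCoord G a l y * (G y)⁻¹ a m) := by
    refine Finset.sum_congr rfl fun i _ => ?_
    rw [Finset.sum_comm]
    exact Finset.sum_congr rfl fun m _ => Finset.sum_congr rfl fun a _ => by ring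
  have e3 : ∑ i, ∑ a, ∑ m, ricciCoord G a l y * ((G y)⁻¹ i m * christoffel G a i m y)
      = ∑ i, ∑ j, ∑ m, (G y)⁻¹ i j * ricciCoord G l m y * christoffel G m i j y := by
    refine Finset.sum_congr rfl fun i _ => ?_
    rw [Finset.sum_comm]
    refine Finset.sum_congr rfl fun m _ => Finset.sum_congr rfl fun a _ => ?_
    rw [hsymm y hy a l]; ring
  have e4 : ∑ i, ∑ m, ∑ a, christoffel G m i l y * (ricciCoord G a m y * (G y)⁻¹ a i)
      = ∑ i, ∑ j, ∑ m, (G y)⁻¹ i m * christoffel G j l m y * ricciCoord G i j y := by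
    rw [← sum_rotate₃ (fun a i m => christoffel G m i l y * (ricciCoord G a m y * (G y)⁻¹ a i))]
    refine Finset.sum_congr rfl fun a _ => ?_
    rw [Finset.sum_comm]
    refine Finset.sum_congr rfl fun m _ => Finset.sum_congr rfl fun i _ => ?_
    rw [hΓ m i l]; ring
  simp only [← Finset.mul_sum] at e2 e3 e4
  rw [e1, e2, e3, e4] at hB
  linarith

/-- Under the variation of the Christoffel symbols generated by the Ricci flow, the trace of the
variation of the Ricci curvature is the Laplacian of the scalar curvature. By the contracted
Bianchi identity `g^{ij} C^k_ij = 0`, while `C^j_ij = -∂_i R`. -/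
theorem trace_ricciVariation_ricciFlow (hG : IsLocalMetric U G)
    (hsymm : ∀ z ∈ U, ∀ i j, ricciCoord G i j z = ricciCoord G j i z)
    {C : Fin n → Fin n → Fin n → EuclideanSpace ℝ (Fin n) → ℝ}
    (hC : ∀ k i j, ContDiffOn ℝ ∞ (C k i j) U) (hCs : ∀ k i j, ∀ z ∈ U, C k i j z = C k j i z)
    (hflow : ∀ z ∈ U, ∀ k i j, C k i j z = ∑ l, (G z)⁻¹ k l *
      (-(partialDeriv i (ricciCoord G j l) z + partialDeriv j (ricciCoord G i l) z
          - partialDeriv l (ricciCoord G i j) z)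
        + 2 * ∑ m, ricciCoord G l m z * christoffel G m i j z))
    (hy : y ∈ U) :
    ∑ i, ∑ j, (G y)⁻¹ i j * ricciVariation G C i j y = laplacianCoord G (scalarCoord G) y := by
  have h1 : ∀ z ∈ U, ∀ k, ∑ i, ∑ j, (G z)⁻¹ i j * C k i j z = 0 := fun z hz k => by
    have : ∑ i, ∑ j, (G z)⁻¹ i j * C k i j z = ∑ l, (G z)⁻¹ k l *
        (∑ i, ∑ j, (G z)⁻¹ i j * partialDeriv l (ricciCoord G i j) z
        - ∑ i, ∑ j, (G z)⁻¹ i j * partialDeriv i (ricciCoord G j l) z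
        - ∑ i, ∑ j, (G z)⁻¹ i j * partialDeriv j (ricciCoord G i l) z
        + 2 * ∑ i, ∑ j, ∑ m, (G z)⁻¹ i j * ricciCoord G l m z * christoffel G m i j z) := by
      simp only [hflow z hz, Finset.mul_sum]
      rw [← sum_rotate₃]
      refine Finset.sum_congr rfl fun l _ => ?_
      simp only [← Finset.mul_sum, ← Finset.sum_sub_distrib]
      simp only [Finset.mul_sum, ← Finset.sum_add_distrib]
      refine Finset.sum_congr rfl fun i _ => Finset.sum_congr rfl fun j _ => ?_
      simp only [mul_assoc, ← Finset.mul_sum]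
      ring
    rw [this]
    refine Finset.sum_eq_zero fun l _ => ?_
    have hswap : ∑ i, ∑ j, (G z)⁻¹ i j * partialDeriv j (ricciCoord G i l) z
        = ∑ i, ∑ j, (G z)⁻¹ i j * partialDeriv i (ricciCoord G j l) z := by
      rw [Finset.sum_comm]
      exact Finset.sum_congr rfl fun i _ => Finset.sum_congr rfl fun j _ => by
        rw [hG.inv_symm z j i]
    rw [hswap, hG.sum_inv_mul_partialDeriv_ricciCoord hsymm hz]
    ring
  have h2 : ∀ z ∈ U, ∀ i, ∑ j, C j i j z = -partialDeriv i (scalarCoord G) z := fun z hz i => by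
    have : ∑ j, C j i j z = -∑ j, ∑ l, (G z)⁻¹ j l * partialDeriv i (ricciCoord G j l) z
        + 2 * ∑ j, ∑ l, ∑ m, (G z)⁻¹ j l * ricciCoord G l m z * christoffel G m i j z
        + ∑ j, ∑ l, (G z)⁻¹ j l * (partialDeriv l (ricciCoord G i j) z
          - partialDeriv j (ricciCoord G i l) z) := by
      simp only [hflow z hz, Finset.mul_sum, ← Finset.sum_add_distrib, ← Finset.sum_neg_distrib]
      refine Finset.sum_congr rfl fun j _ => Finset.sum_congr rfl fun l _ => ?_
      simp only [mul_assoc, ← Finset.mul_sum]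
      ring
    rw [this, sum_sum_eq_zero_of_skew (f := fun j l => (G z)⁻¹ j l *
      (partialDeriv l (ricciCoord G i j) z - partialDeriv j (ricciCoord G i l) z))
      (fun j l => by rw [hG.inv_symm z j l]; ring), hG.partialDeriv_scalarCoord hsymm hz]
    have e : ∑ j, ∑ l, ∑ m, (G z)⁻¹ j l * ricciCoord G l m z * christoffel G m i j z
        = ∑ j, ∑ l, ∑ m, (G z)⁻¹ j m * christoffel G l i m z * ricciCoord G j l z := by
      rw [sum_rotate₃]
      refine Finset.sum_congr rfl fun l _ => Finset.sum_congr rfl fun m _ =>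
        Finset.sum_congr rfl fun j _ => ?_
      rw [hG.inv_symm z j l]; ring
    rw [e]; ring
  rw [hG.trace_ricciVariation hC hCs hy, hG.laplacianCoord_eq_div hG.smooth_scalarCoord hy]
  have h3 : ∀ k, ∀ z ∈ U, ∑ i, ∑ j, (G z)⁻¹ i j * C k i j z - ∑ i, ∑ j, (G z)⁻¹ k i * C j i j z
      = ∑ i, (G z)⁻¹ k i * partialDeriv i (scalarCoord G) z := fun k z hz => by
    rw [h1 z hz]
    simp only [← Finset.mul_sum, h2 z hz]
    simp
  refine Finset.sum_congr rfl fun k _ => ?_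
  rw [partialDeriv_congr hG.isOpen (h3 k) hy]
  congr 2
  exact h3 k y hy

end IsLocalMetric

end RicciVariation

/-! ### Functions of space and time -/

section SpaceTime

variable {n : ℕ} {U : Set (EuclideanSpace ℝ (Fin n))} {T : ℝ}
  {F : EuclideanSpace ℝ (Fin n) × ℝ → ℝ} {y : EuclideanSpace ℝ (Fin n)} {t : ℝ}

/-- The partial derivative in the `k`-th space direction of a function of space and time. -/
noncomputable def spaceDeriv (k : Fin n) (F : EuclideanSpace ℝ (Fin n) × ℝ → ℝ)
    (p : EuclideanSpace ℝ (Fin n) × ℝ) : ℝ :=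
  partialDeriv k (fun z => F (z, p.2)) p.1

/-- The time derivative of a function of space and time, one-sided at the ends of `[0, T]`. -/
noncomputable def timeDeriv (T : ℝ) (F : EuclideanSpace ℝ (Fin n) × ℝ → ℝ)
    (p : EuclideanSpace ℝ (Fin n) × ℝ) : ℝ :=
  derivWithin (fun s => F (p.1, s)) (Icc 0 T) p.2

theorem uniqueDiffOn_prod_Icc (hU : IsOpen U) (hT : 0 < T) :
    UniqueDiffOn ℝ (U ×ˢ Icc 0 T) :=
  hU.uniqueDiffOn.prod (uniqueDiffOn_Icc hT)

theorem prod_Icc_subset_closure_interior (hU : IsOpen U) (hT : 0 < T) :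
    U ×ˢ Icc 0 T ⊆ closure (interior (U ×ˢ Icc 0 T)) := by
  rw [interior_prod_eq, hU.interior_eq, interior_Icc, closure_prod_eq, closure_Ioo hT.ne]
  exact prod_mono subset_closure subset_rfl

theorem ContDiffOn.slice (hF : ContDiffOn ℝ ∞ F (U ×ˢ Icc 0 T)) (ht : t ∈ Icc 0 T) :
    ContDiffOn ℝ ∞ (fun z => F (z, t)) U :=
  hF.comp (contDiffOn_id.prodMk contDiffOn_const) fun _ hz => ⟨hz, ht⟩

theorem spaceDeriv_eq_fderivWithin (hU : IsOpen U) (hF : ContDiffOn ℝ ∞ F (U ×ˢ Icc 0 T))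
    (hy : y ∈ U) (ht : t ∈ Icc 0 T) (k : Fin n) :
    spaceDeriv k F (y, t) =
      fderivWithin ℝ F (U ×ˢ Icc 0 T) (y, t) (EuclideanSpace.single k 1, 0) := by
  have h1 : HasFDerivWithinAt F (fderivWithin ℝ F (U ×ˢ Icc 0 T) (y, t)) (U ×ˢ Icc 0 T) (y, t) :=
    (hF.differentiableWithinAt_infty ⟨hy, ht⟩).hasFDerivWithinAt
  have h2 : HasFDerivWithinAt (fun z : EuclideanSpace ℝ (Fin n) => (z, t))
      ((ContinuousLinearMap.id ℝ _).prod 0) U y :=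
    (hasFDerivWithinAt_id y U).prodMk (hasFDerivWithinAt_const t y U)
  have hm : MapsTo (fun z => (z, t)) U (U ×ˢ Icc 0 T) := fun z hz => ⟨hz, ht⟩
  have h3 := (h1.comp y h2 hm).hasFDerivAt (hU.mem_nhds hy)
  change fderiv ℝ (F ∘ fun z => (z, t)) y _ = _
  rw [h3.fderiv]
  simp

theorem hasDerivWithinAt_of_contDiffOn_prod (hF : ContDiffOn ℝ ∞ F (U ×ˢ Icc 0 T))
    (hy : y ∈ U) (ht : t ∈ Icc 0 T) :
    HasDerivWithinAt (fun s => F (y, s)) (fderivWithin ℝ F (U ×ˢ Icc 0 T) (y, t) (0, 1))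
      (Icc 0 T) t := by
  have h1 : HasFDerivWithinAt F (fderivWithin ℝ F (U ×ˢ Icc 0 T) (y, t)) (U ×ˢ Icc 0 T) (y, t) :=
    (hF.differentiableWithinAt_infty ⟨hy, ht⟩).hasFDerivWithinAt
  have h2 : HasDerivWithinAt (fun s : ℝ => (y, s)) ((0 : EuclideanSpace ℝ (Fin n)), (1 : ℝ))
      (Icc 0 T) t :=
    (hasDerivWithinAt_const t (Icc 0 T) y).prodMk (hasDerivWithinAt_id t _)
  exact h1.comp_hasDerivWithinAt t h2 fun s hs => ⟨hy, hs⟩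

theorem timeDeriv_eq_fderivWithin (hT : 0 < T) (hF : ContDiffOn ℝ ∞ F (U ×ˢ Icc 0 T))
    (hy : y ∈ U) (ht : t ∈ Icc 0 T) :
    timeDeriv T F (y, t) = fderivWithin ℝ F (U ×ˢ Icc 0 T) (y, t) (0, 1) :=
  (hasDerivWithinAt_of_contDiffOn_prod hF hy ht).derivWithin (uniqueDiffOn_Icc hT t ht)

theorem hasDerivWithinAt_timeDeriv (hT : 0 < T) (hF : ContDiffOn ℝ ∞ F (U ×ˢ Icc 0 T))
    (hy : y ∈ U) (ht : t ∈ Icc 0 T) :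
    HasDerivWithinAt (fun s => F (y, s)) (timeDeriv T F (y, t)) (Icc 0 T) t := by
  rw [timeDeriv_eq_fderivWithin hT hF hy ht]
  exact hasDerivWithinAt_of_contDiffOn_prod hF hy ht

theorem ContDiffOn.spaceDeriv (hU : IsOpen U) (hT : 0 < T)
    (hF : ContDiffOn ℝ ∞ F (U ×ˢ Icc 0 T)) (k : Fin n) :
    ContDiffOn ℝ ∞ (spaceDeriv k F) (U ×ˢ Icc 0 T) :=
  (hF.fderivWithin_apply_infty (uniqueDiffOn_prod_Icc hU hT) _).congr
    fun p hp => spaceDeriv_eq_fderivWithin hU hF (y := p.1) (t := p.2) hp.1 hp.2 k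

theorem ContDiffOn.timeDeriv (hU : IsOpen U) (hT : 0 < T)
    (hF : ContDiffOn ℝ ∞ F (U ×ˢ Icc 0 T)) :
    ContDiffOn ℝ ∞ (timeDeriv T F) (U ×ˢ Icc 0 T) :=
  (hF.fderivWithin_apply_infty (uniqueDiffOn_prod_Icc hU hT) _).congr
    fun p hp => timeDeriv_eq_fderivWithin hT hF (y := p.1) (t := p.2) hp.1 hp.2

theorem timeDeriv_spaceDeriv (hU : IsOpen U) (hT : 0 < T)
    (hF : ContDiffOn ℝ ∞ F (U ×ˢ Icc 0 T)) (hy : y ∈ U) (ht : t ∈ Icc 0 T) (k : Fin n) :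
    timeDeriv T (spaceDeriv k F) (y, t) = spaceDeriv k (timeDeriv T F) (y, t) := by
  rw [timeDeriv_eq_fderivWithin hT (hF.spaceDeriv hU hT k) hy ht,
    spaceDeriv_eq_fderivWithin hU (hF.timeDeriv hU hT) hy ht,
    fderivWithin_congr (f₁ := spaceDeriv k F) (fun p hp => spaceDeriv_eq_fderivWithin hU hF
      (y := p.1) (t := p.2) hp.1 hp.2 k) (spaceDeriv_eq_fderivWithin hU hF hy ht k),
    fderivWithin_congr (f₁ := timeDeriv T F) (fun p hp => timeDeriv_eq_fderivWithin hT hF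
      (y := p.1) (t := p.2) hp.1 hp.2) (timeDeriv_eq_fderivWithin hT hF hy ht)]
  exact fderivWithin_fderivWithin_comm (uniqueDiffOn_prod_Icc hU hT)
    (prod_Icc_subset_closure_interior hU hT) hF ⟨hy, ht⟩ _ _

/-- Space and time derivatives commute. -/
theorem hasDerivWithinAt_partialDeriv (hU : IsOpen U) (hT : 0 < T)
    (hF : ContDiffOn ℝ ∞ F (U ×ˢ Icc 0 T)) (hy : y ∈ U) (ht : t ∈ Icc 0 T) (k : Fin n) :
    HasDerivWithinAt (fun s => partialDeriv k (fun z => F (z, s)) y)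
      (partialDeriv k (fun z => timeDeriv T F (z, t)) y) (Icc 0 T) t := by
  have h := hasDerivWithinAt_timeDeriv hT (hF.spaceDeriv hU hT k) hy ht
  rwa [timeDeriv_spaceDeriv hU hT hF hy ht] at h

end SpaceTime

/-! ### The Ricci flow in local coordinates -/

section LocalFlow

variable {n : ℕ} {U : Set (EuclideanSpace ℝ (Fin n))} {T : ℝ}
  {g : ℝ → EuclideanSpace ℝ (Fin n) → Matrix (Fin n) (Fin n) ℝ}
  {y : EuclideanSpace ℝ (Fin n)} {t : ℝ}

/-- The matrices `g(t)` are the components of a smooth solution of the Ricci flow on `U`. -/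
structure IsLocalRicciFlow (U : Set (EuclideanSpace ℝ (Fin n))) (T : ℝ)
    (g : ℝ → EuclideanSpace ℝ (Fin n) → Matrix (Fin n) (Fin n) ℝ) : Prop where
  isOpen : IsOpen U
  time_pos : 0 < T
  smooth : MatSmoothOn (U ×ˢ Icc 0 T) (fun p => g p.2 p.1)
  symm : ∀ t y i j, g t y i j = g t y j i
  posDef : ∀ t ∈ Icc 0 T, ∀ y ∈ U, (g t y).PosDef
  evolution : ∀ y ∈ U, ∀ t ∈ Icc 0 T, ∀ i j,
    HasDerivWithinAt (fun s => g s y i j) (-2 * ricciCoord (g t) i j y) (Icc 0 T) t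

/-- The squared norm of the Ricci tensor, `|Ric|² = g^{ia} R_ab g^{bj} R_ij`. -/
noncomputable def ricciNormSq (G : EuclideanSpace ℝ (Fin n) → Matrix (Fin n) (Fin n) ℝ)
    (y : EuclideanSpace ℝ (Fin n)) : ℝ :=
  ∑ i, ∑ j, (∑ a, ∑ b, (G y)⁻¹ i a * ricciCoord G a b y * (G y)⁻¹ b j) * ricciCoord G i j y

namespace IsLocalRicciFlow

theorem isLocalMetric (hg : IsLocalRicciFlow U T g) (ht : t ∈ Icc 0 T) :
    IsLocalMetric U (g t) where
  isOpen := hg.isOpen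
  smooth := fun i j => (hg.smooth i j).slice ht
  symm := hg.symm t
  posDef := hg.posDef t ht

/-- The Ricci curvature is symmetric because it is, up to a factor, the time derivative of the
metric. -/
theorem ricciCoord_symm (hg : IsLocalRicciFlow U T g) (ht : t ∈ Icc 0 T) (hy : y ∈ U)
    (i j : Fin n) : ricciCoord (g t) i j y = ricciCoord (g t) j i y := by
  have h1 := hg.evolution y hy t ht i j
  have h2 := hg.evolution y hy t ht j i
  rw [show (fun s => g s y j i) = fun s => g s y i j from funext fun s => hg.symm s y j i] at h2
  have := (uniqueDiffOn_Icc hg.time_pos t ht).eq_deriv _ h1 h2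
  linarith

theorem smooth_inv (hg : IsLocalRicciFlow U T g) :
    MatSmoothOn (U ×ˢ Icc 0 T) (fun p => (g p.2 p.1)⁻¹) :=
  hg.smooth.inv fun p hp => (hg.posDef p.2 hp.2 p.1 hp.1).det_pos.ne'

theorem smooth_christoffel (hg : IsLocalRicciFlow U T g) (k i j : Fin n) :
    ContDiffOn ℝ ∞ (fun p : _ × ℝ => christoffel (g p.2) k i j p.1) (U ×ˢ Icc 0 T) := by
  unfold christoffel
  refine contDiffOn_const.mul (ContDiffOn.sum fun l _ => (hg.smooth_inv k l).mul ?_)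
  exact (((hg.smooth j l).spaceDeriv hg.isOpen hg.time_pos i).add
    ((hg.smooth i l).spaceDeriv hg.isOpen hg.time_pos j)).sub
    ((hg.smooth i j).spaceDeriv hg.isOpen hg.time_pos l)

theorem smooth_ricciCoord (hg : IsLocalRicciFlow U T g) (i j : Fin n) :
    ContDiffOn ℝ ∞ (fun p : _ × ℝ => ricciCoord (g p.2) i j p.1) (U ×ˢ Icc 0 T) := by
  unfold ricciCoord
  refine ContDiffOn.sum fun k _ => ContDiffOn.add (ContDiffOn.sub ?_ ?_)
    (ContDiffOn.sum fun l _ => ContDiffOn.sub ?_ ?_)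
  · exact (hg.smooth_christoffel k i j).spaceDeriv hg.isOpen hg.time_pos k
  · exact (hg.smooth_christoffel k i k).spaceDeriv hg.isOpen hg.time_pos j
  · exact (hg.smooth_christoffel k k l).mul (hg.smooth_christoffel l i j)
  · exact (hg.smooth_christoffel k j l).mul (hg.smooth_christoffel l i k)

theorem smooth_scalarCoord (hg : IsLocalRicciFlow U T g) :
    ContDiffOn ℝ ∞ (fun p : _ × ℝ => scalarCoord (g p.2) p.1) (U ×ˢ Icc 0 T) :=
  ContDiffOn.sum fun i _ => ContDiffOn.sum fun j _ =>
    (hg.smooth_inv i j).mul (hg.smooth_ricciCoord i j)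

/-- The evolution `∂_t g^{ij} = 2 R^{ij}` of the inverse metric. -/
theorem hasDerivWithinAt_inv (hg : IsLocalRicciFlow U T g) (hy : y ∈ U) (ht : t ∈ Icc 0 T)
    (i j : Fin n) : HasDerivWithinAt (fun s => (g s y)⁻¹ i j)
      (2 * ∑ a, ∑ b, (g t y)⁻¹ i a * ricciCoord (g t) a b y * (g t y)⁻¹ b j) (Icc 0 T) t := by
  have hs : MatSmoothOn (Icc 0 T) (fun s => g s y) := fun i j =>
    (hg.smooth i j).comp (contDiffOn_const.prodMk contDiffOn_id) fun s hs => ⟨hy, hs⟩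
  have hdet : ∀ s ∈ Icc 0 T, (g s y).det ≠ 0 := fun s hs => (hg.posDef s hs y hy).det_pos.ne'
  have hu := uniqueDiffOn_Icc hg.time_pos
  have h1 := congrFun (congrFun (matDeriv_inv hu hs hdet ht (v := 1)) i) j
  have h2 : matDeriv (Icc 0 T) 1 (fun s => g s y) t
      = (-2 : ℝ) • Matrix.of fun a b => ricciCoord (g t) a b y := by
    ext a b
    exact (hg.evolution y hy t ht a b).derivWithin (hu t ht)
  have h3 := ((hs.inv hdet).differentiableWithinAt ht i j).hasDerivWithinAt
  have h4 : derivWithin (fun s => (g s y)⁻¹ i j) (Icc 0 T) t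
      = 2 * ∑ a, ∑ b, (g t y)⁻¹ i a * ricciCoord (g t) a b y * (g t y)⁻¹ b j := by
    refine h1.trans ?_
    rw [h2]
    simp only [Matrix.mul_smul, Matrix.smul_mul, Matrix.neg_apply, Matrix.smul_apply,
      Matrix.mul_apply, Matrix.of_apply, smul_eq_mul, Finset.sum_mul]
    rw [Finset.sum_comm]
    ring
  rw [← h4]
  exact h3

/-- The evolution `∂_t √(det g) = -R √(det g)` of the volume density. -/
theorem hasDerivWithinAt_sqrt_det (hg : IsLocalRicciFlow U T g) (hy : y ∈ U)
    (ht : t ∈ Icc 0 T) : HasDerivWithinAt (fun s => √(g s y).det)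
      (-(scalarCoord (g t) y * √(g t y).det)) (Icc 0 T) t := by
  have hs : MatSmoothOn (Icc 0 T) (fun s => g s y) := fun i j =>
    (hg.smooth i j).comp (contDiffOn_const.prodMk contDiffOn_id) fun s hs => ⟨hy, hs⟩
  have hpos : 0 < (g t y).det := (hg.posDef t ht y hy).det_pos
  have hu := uniqueDiffOn_Icc hg.time_pos
  have h2 : matDeriv (Icc 0 T) 1 (fun s => g s y) t
      = (-2 : ℝ) • Matrix.of fun a b => ricciCoord (g t) a b y := by
    ext a b
    exact (hg.evolution y hy t ht a b).derivWithin (hu t ht)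
  have h1 : derivWithin (fun s => (g s y).det) (Icc 0 T) t
      = -2 * ((g t y).det * scalarCoord (g t) y) := by
    refine (fderivWithin_det hu hs ht hpos.ne' (v := 1)).trans ?_
    rw [h2]
    have : scalarCoord (g t) y
        = ((g t y)⁻¹ * Matrix.of fun a b => ricciCoord (g t) a b y).trace := by
      simp only [scalarCoord, Matrix.trace, Matrix.diag_apply, Matrix.mul_apply, Matrix.of_apply]
      exact Finset.sum_congr rfl fun i _ => Finset.sum_congr rfl fun j _ => by
        rw [hg.ricciCoord_symm ht hy]
    rw [this, Matrix.mul_smul, Matrix.trace_smul, smul_eq_mul]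
    ring
  have h3 := ((hs.det.differentiableWithinAt_infty ht).hasDerivWithinAt).sqrt hpos.ne'
  rw [h1] at h3
  convert h3 using 1
  have h4 := Real.mul_self_sqrt hpos.le
  have h5 := Real.sqrt_pos.2 hpos
  rw [eq_div_iff (by positivity)]
  linear_combination (-2 * scalarCoord (g t) y) * h4

/-- The variation of the Christoffel symbols under the Ricci flow. -/
theorem hasDerivWithinAt_christoffel (hg : IsLocalRicciFlow U T g) (hy : y ∈ U)
    (ht : t ∈ Icc 0 T) (k i j : Fin n) :
    HasDerivWithinAt (fun s => christoffel (g s) k i j y)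
      (∑ l, (g t y)⁻¹ k l *
      (-(partialDeriv i (ricciCoord (g t) j l) y + partialDeriv j (ricciCoord (g t) i l) y
          - partialDeriv l (ricciCoord (g t) i j) y)
        + 2 * ∑ m, ricciCoord (g t) l m y * christoffel (g t) m i j y)) (Icc 0 T) t := by
  have hd : ∀ a b c, HasDerivWithinAt (fun s => partialDeriv a (fun z => g s z b c) y)
      (-2 * partialDeriv a (ricciCoord (g t) b c) y) (Icc 0 T) t := fun a b c => by
    have h := hasDerivWithinAt_partialDeriv hg.isOpen hg.time_pos (hg.smooth b c) hy ht a
    have e : EqOn (fun z => timeDeriv T (fun p => g p.2 p.1 b c) (z, t))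
        (fun z => -2 * ricciCoord (g t) b c z) U := fun z hz =>
      (hg.evolution z hz t ht b c).derivWithin (uniqueDiffOn_Icc hg.time_pos t ht)
    rwa [partialDeriv_congr hg.isOpen e hy, partialDeriv_const_mul _
      (((hg.isLocalMetric ht).smooth_ricciCoord b c).differentiableAt_infty hg.isOpen hy)] at h
  have h := (HasDerivWithinAt.fun_sum (u := Finset.univ) fun l _ =>
    (hg.hasDerivWithinAt_inv hy ht k l).fun_mul
      (((hd i j l).fun_add (hd j i l)).fun_sub (hd l i j))).const_mul (1 / 2)
  refine h.congr_deriv ?_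
  have e : ∑ l, (g t y)⁻¹ k l * (2 * ∑ m, ricciCoord (g t) l m y * christoffel (g t) m i j y)
      = 1 / 2 * ∑ l, (2 * ∑ a, ∑ b, (g t y)⁻¹ k a * ricciCoord (g t) a b y * (g t y)⁻¹ b l) *
        (partialDeriv i (fun z => g t z j l) y + partialDeriv j (fun z => g t z i l) y
          - partialDeriv l (fun z => g t z i j) y) := by
    simp only [christoffel, Finset.mul_sum, Finset.sum_mul]
    rw [← sum_rotate₃]
    refine Finset.sum_congr rfl fun l _ => Finset.sum_congr rfl fun a _ =>
      Finset.sum_congr rfl fun b _ => ?_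
    ring
  refine Eq.trans ?_ (Finset.sum_congr rfl fun l _ => (mul_add _ _ _).symm)
  rw [Finset.sum_add_distrib, Finset.sum_add_distrib, mul_add, e, add_comm]
  congr 1
  rw [Finset.mul_sum]
  exact Finset.sum_congr rfl fun l _ => by ring

/-- The variation of the Ricci curvature under the Ricci flow. -/
theorem hasDerivWithinAt_ricciCoord (hg : IsLocalRicciFlow U T g) (hy : y ∈ U)
    (ht : t ∈ Icc 0 T) (i j : Fin n) :
    HasDerivWithinAt (fun s => ricciCoord (g s) i j y)
      (IsLocalMetric.ricciVariation (g t) (fun k i j z =>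
        timeDeriv T (fun p => christoffel (g p.2) k i j p.1) (z, t)) i j y) (Icc 0 T) t := by
  have hΓ := fun k i j => hasDerivWithinAt_timeDeriv hg.time_pos (hg.smooth_christoffel k i j) hy ht
  have hd := fun a k i j =>
    hasDerivWithinAt_partialDeriv hg.isOpen hg.time_pos (hg.smooth_christoffel k i j) hy ht a
  exact HasDerivWithinAt.fun_sum fun k _ => ((hd k k i j).fun_sub (hd j k i k)).fun_add
    (HasDerivWithinAt.fun_sum fun l _ => ((hΓ k k l).fun_mul (hΓ l i j)).fun_sub
      ((hΓ k j l).fun_mul (hΓ l i k)))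

/-- The evolution equation `∂_t R = Δ R + 2 |Ric|²` of the scalar curvature. -/
theorem hasDerivWithinAt_scalarCoord (hg : IsLocalRicciFlow U T g) (hy : y ∈ U)
    (ht : t ∈ Icc 0 T) :
    HasDerivWithinAt (fun s => scalarCoord (g s) y)
      (laplacianCoord (g t) (scalarCoord (g t)) y + 2 * ricciNormSq (g t) y) (Icc 0 T) t := by
  have hm := hg.isLocalMetric ht
  have hu := uniqueDiffOn_Icc hg.time_pos t ht
  rw [← hm.trace_ricciVariation_ricciFlow (fun z hz => hg.ricciCoord_symm ht hz)
    (C := fun k i j z => timeDeriv T (fun p => christoffel (g p.2) k i j p.1) (z, t))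
    (fun k i j => ((hg.smooth_christoffel k i j).timeDeriv hg.isOpen hg.time_pos).slice ht)
    (fun k i j z hz => by
      congr 1; funext p
      simp only [christoffel]
      congr 1
      refine Finset.sum_congr rfl fun l _ => ?_
      rw [show (fun z => g p.2 z i j) = fun z => g p.2 z j i from
        funext fun z => hg.symm p.2 z i j]
      ring)
    (fun z hz k i j => (hg.hasDerivWithinAt_christoffel hz ht k i j).derivWithin hu) hy]
  refine (HasDerivWithinAt.fun_sum (u := Finset.univ) fun i _ =>
    HasDerivWithinAt.fun_sum (u := Finset.univ) fun j _ =>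
    (hg.hasDerivWithinAt_inv hy ht i j).fun_mul
      (hg.hasDerivWithinAt_ricciCoord hy ht i j)).congr_deriv ?_
  simp only [Finset.sum_add_distrib, ricciNormSq, mul_assoc, ← Finset.mul_sum]
  ring

end IsLocalRicciFlow

end LocalFlow

/-! ### Gradients, and the sign of Ricci terms -/

section Gradient

variable {n : ℕ} {U : Set (EuclideanSpace ℝ (Fin n))} {T : ℝ}
  {g : ℝ → EuclideanSpace ℝ (Fin n) → Matrix (Fin n) (Fin n) ℝ}
  {G : EuclideanSpace ℝ (Fin n) → Matrix (Fin n) (Fin n) ℝ}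
  {y : EuclideanSpace ℝ (Fin n)} {t : ℝ}

/-- The pairing of gradients `⟨∇f, ∇h⟩ = g^{ij} ∂_i f ∂_j h`. -/
noncomputable def gradPairCoord (G : EuclideanSpace ℝ (Fin n) → Matrix (Fin n) (Fin n) ℝ)
    (f h : EuclideanSpace ℝ (Fin n) → ℝ) (y : EuclideanSpace ℝ (Fin n)) : ℝ :=
  ∑ i, ∑ j, (G y)⁻¹ i j * (partialDeriv i f y * partialDeriv j h y)

/-- The Ricci curvature of a gradient,
`Ric(∇f, ∇f) = g^{ia} R_ab g^{bj} ∂_i f ∂_j f`. -/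
noncomputable def ricciGradCoord (G : EuclideanSpace ℝ (Fin n) → Matrix (Fin n) (Fin n) ℝ)
    (f : EuclideanSpace ℝ (Fin n) → ℝ) (y : EuclideanSpace ℝ (Fin n)) : ℝ :=
  ∑ i, ∑ j, (∑ a, ∑ b, (G y)⁻¹ i a * ricciCoord G a b y * (G y)⁻¹ b j) *
    (partialDeriv i f y * partialDeriv j f y)

/-- The matrix of the Ricci curvature. -/
noncomputable def ricciMat (G : EuclideanSpace ℝ (Fin n) → Matrix (Fin n) (Fin n) ℝ)
    (y : EuclideanSpace ℝ (Fin n)) : Matrix (Fin n) (Fin n) ℝ :=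
  Matrix.of fun i j => ricciCoord G i j y

/-- The row of partial derivatives of a function. -/
noncomputable def partialVec (f : EuclideanSpace ℝ (Fin n) → ℝ) (y : EuclideanSpace ℝ (Fin n)) :
    Fin n → ℝ :=
  fun i => partialDeriv i f y

theorem sum_sum_mul_eq_trace (A B : Matrix (Fin n) (Fin n) ℝ) :
    ∑ i, ∑ j, A i j * B i j = (A * B.transpose).trace := by
  simp [Matrix.trace, Matrix.mul_apply]

theorem sum_sum_mul_eq_dotProduct (A : Matrix (Fin n) (Fin n) ℝ) (v w : Fin n → ℝ) :
    ∑ i, ∑ j, A i j * (v i * w j) = v ⬝ᵥ A.mulVec w := by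
  simp only [dotProduct, Matrix.mulVec, Finset.mul_sum]
  exact Finset.sum_congr rfl fun i _ => Finset.sum_congr rfl fun j _ => by ring

theorem scalarCoord_eq_trace (G : EuclideanSpace ℝ (Fin n) → Matrix (Fin n) (Fin n) ℝ)
    (y : EuclideanSpace ℝ (Fin n)) :
    scalarCoord G y = ((G y)⁻¹ * (ricciMat G y).transpose).trace :=
  sum_sum_mul_eq_trace _ (ricciMat G y)

theorem sum_mul_ricciCoord_mul (G : EuclideanSpace ℝ (Fin n) → Matrix (Fin n) (Fin n) ℝ)
    (y : EuclideanSpace ℝ (Fin n)) (i j : Fin n) :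
    ∑ a, ∑ b, (G y)⁻¹ i a * ricciCoord G a b y * (G y)⁻¹ b j
      = ((G y)⁻¹ * ricciMat G y * (G y)⁻¹) i j := by
  simp only [Matrix.mul_apply, ricciMat, Matrix.of_apply, Finset.sum_mul]
  exact Finset.sum_comm

theorem ricciNormSq_eq_trace (G : EuclideanSpace ℝ (Fin n) → Matrix (Fin n) (Fin n) ℝ)
    (y : EuclideanSpace ℝ (Fin n)) :
    ricciNormSq G y
      = (((G y)⁻¹ * ricciMat G y * (G y)⁻¹) * (ricciMat G y).transpose).trace := by
  simp only [ricciNormSq, sum_mul_ricciCoord_mul]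
  exact sum_sum_mul_eq_trace _ (ricciMat G y)

theorem gradPairCoord_eq_dotProduct (G : EuclideanSpace ℝ (Fin n) → Matrix (Fin n) (Fin n) ℝ)
    (f h : EuclideanSpace ℝ (Fin n) → ℝ) (y : EuclideanSpace ℝ (Fin n)) :
    gradPairCoord G f h y = partialVec f y ⬝ᵥ ((G y)⁻¹).mulVec (partialVec h y) :=
  sum_sum_mul_eq_dotProduct _ _ _

theorem ricciGradCoord_eq_dotProduct (G : EuclideanSpace ℝ (Fin n) → Matrix (Fin n) (Fin n) ℝ)
    (f : EuclideanSpace ℝ (Fin n) → ℝ) (y : EuclideanSpace ℝ (Fin n)) :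
    ricciGradCoord G f y =
      partialVec f y ⬝ᵥ ((G y)⁻¹ * ricciMat G y * (G y)⁻¹).mulVec (partialVec f y) := by
  simp only [ricciGradCoord, sum_mul_ricciCoord_mul]
  exact sum_sum_mul_eq_dotProduct _ _ _

theorem trace_mul_nonneg_of_posSemidef {A B : Matrix (Fin n) (Fin n) ℝ} (hA : A.PosSemidef)
    (hB : B.PosSemidef) : 0 ≤ (A * B).trace := by
  obtain ⟨m, v, rfl⟩ := Matrix.posSemidef_iff_eq_sum_vecMulVec.1 hA
  rw [Finset.sum_mul, Matrix.trace_sum]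
  refine Finset.sum_nonneg fun i _ => ?_
  rw [Matrix.vecMulVec_mul, Matrix.trace_vecMulVec, dotProduct_comm, ← Matrix.dotProduct_mulVec]
  exact hB.dotProduct_mulVec_nonneg (v i)

namespace IsLocalMetric

theorem posSemidef_inv (hG : IsLocalMetric U G) (hy : y ∈ U) : ((G y)⁻¹).PosSemidef :=
  (hG.posDef y hy).inv.posSemidef

theorem gradPairCoord_comm (hG : IsLocalMetric U G) (f h : EuclideanSpace ℝ (Fin n) → ℝ)
    (y : EuclideanSpace ℝ (Fin n)) : gradPairCoord G f h y = gradPairCoord G h f y := by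
  unfold gradPairCoord
  rw [Finset.sum_comm]
  exact Finset.sum_congr rfl fun i _ => Finset.sum_congr rfl fun j _ => by
    rw [hG.inv_symm y j i, mul_comm (partialDeriv j f y)]

end IsLocalMetric

theorem posSemidef_ricciMat (hs : ∀ i j, ricciCoord G i j y = ricciCoord G j i y)
    (hRic : ∀ v : Fin n → ℝ, 0 ≤ ∑ i, ∑ j, ricciCoord G i j y * v i * v j) :
    (ricciMat G y).PosSemidef := by
  refine Matrix.PosSemidef.of_dotProduct_mulVec_nonneg ?_ fun v => ?_
  · ext i j
    simp [ricciMat, hs i j]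
  · rw [show star v = v from rfl, ← sum_sum_mul_eq_dotProduct]
    refine (hRic v).trans_eq ?_
    exact Finset.sum_congr rfl fun i _ => Finset.sum_congr rfl fun j _ => mul_assoc _ _ _

theorem posSemidef_inv_mul_ricciMat_mul_inv (hG : IsLocalMetric U G) (hy : y ∈ U)
    (h : (ricciMat G y).PosSemidef) : ((G y)⁻¹ * ricciMat G y * (G y)⁻¹).PosSemidef := by
  have := h.conjTranspose_mul_mul_same ((G y)⁻¹)
  rwa [(hG.posSemidef_inv hy).isHermitian.eq] at this

theorem ricciNormSq_nonneg (hG : IsLocalMetric U G) (hy : y ∈ U)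
    (h : (ricciMat G y).PosSemidef) : 0 ≤ ricciNormSq G y := by
  rw [ricciNormSq_eq_trace]
  exact trace_mul_nonneg_of_posSemidef (posSemidef_inv_mul_ricciMat_mul_inv hG hy h) h.transpose

theorem ricciGradCoord_nonneg (hG : IsLocalMetric U G) (hy : y ∈ U)
    (h : (ricciMat G y).PosSemidef) (f : EuclideanSpace ℝ (Fin n) → ℝ) :
    0 ≤ ricciGradCoord G f y := by
  rw [ricciGradCoord_eq_dotProduct]
  exact (posSemidef_inv_mul_ricciMat_mul_inv hG hy h).dotProduct_mulVec_nonneg _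

/-- The evolution of `|∇F|²` along the Ricci flow. -/
theorem IsLocalRicciFlow.hasDerivWithinAt_gradPairCoord (hg : IsLocalRicciFlow U T g)
    {F : EuclideanSpace ℝ (Fin n) × ℝ → ℝ} (hF : ContDiffOn ℝ ∞ F (U ×ˢ Icc 0 T))
    (hy : y ∈ U) (ht : t ∈ Icc 0 T) :
    HasDerivWithinAt (fun s => gradPairCoord (g s) (fun z => F (z, s)) (fun z => F (z, s)) y)
      (2 * ricciGradCoord (g t) (fun z => F (z, t)) y
        + 2 * gradPairCoord (g t) (fun z => F (z, t)) (fun z => timeDeriv T F (z, t)) y)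
      (Icc 0 T) t := by
  have hd := fun k => hasDerivWithinAt_partialDeriv hg.isOpen hg.time_pos hF hy ht k
  refine (HasDerivWithinAt.fun_sum (u := Finset.univ) fun i _ =>
    HasDerivWithinAt.fun_sum (u := Finset.univ) fun j _ =>
    (hg.hasDerivWithinAt_inv hy ht i j).fun_mul ((hd i).fun_mul (hd j))).congr_deriv ?_
  have h := (hg.isLocalMetric ht).gradPairCoord_comm (fun z => timeDeriv T F (z, t))
    (fun z => F (z, t)) y
  rw [two_mul (gradPairCoord _ _ _ _)]
  nth_rewrite 1 [← h]
  simp only [Finset.sum_add_distrib, ricciGradCoord, gradPairCoord, mul_assoc, mul_add,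
    ← Finset.mul_sum]

/-! ### Tensorial change of coordinates at a point -/

section Transformation

variable {G' : EuclideanSpace ℝ (Fin n) → Matrix (Fin n) (Fin n) ℝ}
  {y' : EuclideanSpace ℝ (Fin n)} {J : Matrix (Fin n) (Fin n) ℝ}

theorem inv_transform (h : G' y' = J.transpose * G y * J) :
    (G' y')⁻¹ = J⁻¹ * (G y)⁻¹ * (J.transpose)⁻¹ := by
  rw [h, Matrix.mul_inv_rev, Matrix.mul_inv_rev, Matrix.mul_assoc]

theorem scalarCoord_transform (hJ : IsUnit J.det) (h : G' y' = J.transpose * G y * J)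
    (hR : ricciMat G' y' = J.transpose * ricciMat G y * J) :
    scalarCoord G' y' = scalarCoord G y := by
  have hJ' : IsUnit J.transpose.det := by rwa [Matrix.det_transpose]
  rw [scalarCoord_eq_trace, scalarCoord_eq_trace, inv_transform h, hR]
  simp only [Matrix.transpose_mul, Matrix.transpose_transpose, Matrix.mul_assoc]
  rw [Matrix.nonsing_inv_mul_cancel_left _ _ hJ', Matrix.trace_mul_comm]
  simp only [Matrix.mul_assoc]
  rw [Matrix.mul_nonsing_inv _ hJ, Matrix.mul_one]

theorem ricciNormSq_transform (hJ : IsUnit J.det) (h : G' y' = J.transpose * G y * J)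
    (hR : ricciMat G' y' = J.transpose * ricciMat G y * J) :
    ricciNormSq G' y' = ricciNormSq G y := by
  have hJ' : IsUnit J.transpose.det := by rwa [Matrix.det_transpose]
  rw [ricciNormSq_eq_trace, ricciNormSq_eq_trace, inv_transform h, hR]
  simp only [Matrix.transpose_mul, Matrix.transpose_transpose, Matrix.mul_assoc]
  rw [Matrix.nonsing_inv_mul_cancel_left _ _ hJ', Matrix.mul_nonsing_inv_cancel_left _ _ hJ,
    Matrix.nonsing_inv_mul_cancel_left _ _ hJ', Matrix.trace_mul_comm]
  simp only [Matrix.mul_assoc]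
  rw [Matrix.mul_nonsing_inv _ hJ, Matrix.mul_one]

theorem gradPairCoord_transform (hJ : IsUnit J.det) (h : G' y' = J.transpose * G y * J)
    {f f' k k' : EuclideanSpace ℝ (Fin n) → ℝ}
    (hf : partialVec f' y' = J.transpose.mulVec (partialVec f y))
    (hk : partialVec k' y' = J.transpose.mulVec (partialVec k y)) :
    gradPairCoord G' f' k' y' = gradPairCoord G f k y := by
  have hJ' : IsUnit J.transpose.det := by rwa [Matrix.det_transpose]
  rw [gradPairCoord_eq_dotProduct, gradPairCoord_eq_dotProduct, inv_transform h, hf, hk,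
    Matrix.mulVec_mulVec, Matrix.nonsing_inv_mul_cancel_right _ _ hJ', Matrix.mulVec_transpose,
    ← Matrix.dotProduct_mulVec, Matrix.mulVec_mulVec, Matrix.mul_nonsing_inv_cancel_left _ _ hJ]

end Transformation

end Gradient

/-! ### Metrics in the charts of a manifold -/

section Transition

variable {n : ℕ} {M : Type*} [TopologicalSpace M]
  {e e' : OpenPartialHomeomorph M (EuclideanSpace ℝ (Fin n))} {x : M}

theorem sum_smul_single (v : Fin n → ℝ) :
    ∑ i, v i • EuclideanSpace.single i (1 : ℝ) = WithLp.toLp 2 v := by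
  ext j
  simp [Finset.sum_apply, Pi.single_apply]

theorem isOpen_transition_domain (e e' : OpenPartialHomeomorph M (EuclideanSpace ℝ (Fin n))) :
    IsOpen (e'.target ∩ e'.symm ⁻¹' e.source) :=
  e'.symm.isOpen_inter_preimage e.open_source

theorem mem_transition_domain (hx : x ∈ e.source) (hx' : x ∈ e'.source) :
    e' x ∈ e'.target ∩ e'.symm ⁻¹' e.source :=
  ⟨e'.map_source hx', by rwa [mem_preimage, e'.left_inv hx']⟩

/-- The Jacobian matrix, at the point `y'` of the chart `e'`, of the transition map from the chart
`e'` to the chart `e`. -/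
noncomputable def chartJacobian (e e' : OpenPartialHomeomorph M (EuclideanSpace ℝ (Fin n)))
    (y' : EuclideanSpace ℝ (Fin n)) : Matrix (Fin n) (Fin n) ℝ :=
  Matrix.of fun a i => fderiv ℝ (e ∘ e'.symm) y' (EuclideanSpace.single i 1) a

theorem fderiv_transition_single (e e' : OpenPartialHomeomorph M (EuclideanSpace ℝ (Fin n)))
    (y' : EuclideanSpace ℝ (Fin n)) (i : Fin n) :
    fderiv ℝ (e ∘ e'.symm) y' (EuclideanSpace.single i 1)
      = ∑ a, chartJacobian e e' y' a i • EuclideanSpace.single a (1 : ℝ) := by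
  rw [sum_smul_single]
  ext a
  rfl

end Transition

section Charts

variable {n : ℕ} {M : Type*} [TopologicalSpace M]
  [ChartedSpace (EuclideanSpace ℝ (Fin n)) M] [IsManifold (𝓡 n) ∞ M]
  {e e' : OpenPartialHomeomorph M (EuclideanSpace ℝ (Fin n))} {x : M}
  {y : EuclideanSpace ℝ (Fin n)} {T t : ℝ}

theorem contMDiffOn_infty_of_mem_atlas (he : e ∈ atlas (EuclideanSpace ℝ (Fin n)) M) :
    ContMDiffOn (𝓡 n) (𝓡 n) ∞ e e.source :=
  contMDiffOn_of_mem_maximalAtlas (IsManifold.subset_maximalAtlas he)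

theorem contMDiffOn_infty_symm_of_mem_atlas (he : e ∈ atlas (EuclideanSpace ℝ (Fin n)) M) :
    ContMDiffOn (𝓡 n) (𝓡 n) ∞ e.symm e.target :=
  contMDiffOn_symm_of_mem_maximalAtlas (IsManifold.subset_maximalAtlas he)

theorem mdifferentiable_chart_of_mem_atlas (he : e ∈ atlas (EuclideanSpace ℝ (Fin n)) M) :
    e.MDifferentiable (𝓡 n) (𝓡 n) :=
  ⟨(contMDiffOn_infty_of_mem_atlas he).mdifferentiableOn (by simp),
    (contMDiffOn_infty_symm_of_mem_atlas he).mdifferentiableOn (by simp)⟩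

/-- The inner product on the tangent space at `x`, as a function on the model space. -/
noncomputable def innerAt (g : SmoothMetric n M) (x : M) :
    EuclideanSpace ℝ (Fin n) →L[ℝ] EuclideanSpace ℝ (Fin n) →L[ℝ] ℝ := g.inner x

/-- The differential of the inverse of a chart, as an endomorphism of the model space. -/
noncomputable def chartSymmDeriv (e : OpenPartialHomeomorph M (EuclideanSpace ℝ (Fin n)))
    (y : EuclideanSpace ℝ (Fin n)) :
    EuclideanSpace ℝ (Fin n) →L[ℝ] EuclideanSpace ℝ (Fin n) :=
  mfderiv (𝓡 n) (𝓡 n) e.symm y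

theorem metricCoord_apply (g : SmoothMetric n M)
    (e : OpenPartialHomeomorph M (EuclideanSpace ℝ (Fin n))) (y : EuclideanSpace ℝ (Fin n))
    (i j : Fin n) : metricCoord g e y i j = innerAt g (e.symm y)
      (chartSymmDeriv e y (EuclideanSpace.single i 1))
      (chartSymmDeriv e y (EuclideanSpace.single j 1)) := rfl

theorem metricCoord_symm (g : SmoothMetric n M)
    (e : OpenPartialHomeomorph M (EuclideanSpace ℝ (Fin n))) (y : EuclideanSpace ℝ (Fin n))
    (i j : Fin n) : metricCoord g e y i j = metricCoord g e y j i :=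
  g.symm _ _ _

theorem metricCoord_posDef (g : SmoothMetric n M)
    (he : e ∈ atlas (EuclideanSpace ℝ (Fin n)) M) (hy : y ∈ e.target) :
    (metricCoord g e y).PosDef := by
  refine Matrix.PosDef.of_dotProduct_mulVec_pos ?_ fun v hv => ?_
  · ext i j
    simp [metricCoord_symm g e y i j]
  · have hinj : Function.Injective (chartSymmDeriv e y) :=
      (mdifferentiable_chart_of_mem_atlas he).symm.mfderiv_injective hy
    have h : star v ⬝ᵥ (metricCoord g e y).mulVec v = innerAt g (e.symm y)
        (chartSymmDeriv e y (WithLp.toLp 2 v)) (chartSymmDeriv e y (WithLp.toLp 2 v)) := by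
      rw [show star v = v from rfl, ← sum_sum_mul_eq_dotProduct, ← sum_smul_single]
      simp only [metricCoord_apply, map_sum, map_smul, sum_apply, smul_apply, smul_eq_mul,
        Finset.mul_sum]
      rw [Finset.sum_comm]
      exact Finset.sum_congr rfl fun i _ => Finset.sum_congr rfl fun j _ => by ring
    rw [h]
    refine g.pos _ _ fun h0 => hv ?_
    have h1 : (WithLp.toLp 2 v : EuclideanSpace ℝ (Fin n)) = 0 :=
      hinj (Eq.trans h0 (map_zero (chartSymmDeriv e y)).symm)
    simpa using h1

theorem IsRicciFlow.isLocalRicciFlow {g : ℝ → SmoothMetric n M} (hg : IsRicciFlow T g)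
    (hT : 0 < T) (he : e ∈ atlas (EuclideanSpace ℝ (Fin n)) M) :
    IsLocalRicciFlow e.target T (fun t => metricCoord (g t) e) where
  isOpen := e.open_target
  time_pos := hT
  smooth := hg.smooth e he
  symm := fun t y i j => metricCoord_symm (g t) e y i j
  posDef := fun t _ _ hy => metricCoord_posDef (g t) he hy
  evolution := hg.evolution e he

theorem contDiffOn_transition (he : e ∈ atlas (EuclideanSpace ℝ (Fin n)) M)
    (he' : e' ∈ atlas (EuclideanSpace ℝ (Fin n)) M) :
    ContDiffOn ℝ ∞ (e ∘ e'.symm) (e'.target ∩ e'.symm ⁻¹' e.source) :=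
  contMDiffOn_iff_contDiffOn.1 ((contMDiffOn_infty_of_mem_atlas he).comp
    ((contMDiffOn_infty_symm_of_mem_atlas he').mono inter_subset_left) fun _ hz => hz.2)

theorem differentiableAt_transition (he : e ∈ atlas (EuclideanSpace ℝ (Fin n)) M)
    (he' : e' ∈ atlas (EuclideanSpace ℝ (Fin n)) M) (hx : x ∈ e.source) (hx' : x ∈ e'.source) :
    DifferentiableAt ℝ (e ∘ e'.symm) (e' x) :=
  (((contDiffOn_transition he he').differentiableOn (by simp)) _
    (mem_transition_domain hx hx')).differentiableAt
    ((isOpen_transition_domain e e').mem_nhds (mem_transition_domain hx hx'))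

theorem chartSymmDeriv_transition (he : e ∈ atlas (EuclideanSpace ℝ (Fin n)) M)
    (he' : e' ∈ atlas (EuclideanSpace ℝ (Fin n)) M) (hx : x ∈ e.source) (hx' : x ∈ e'.source) :
    chartSymmDeriv e' (e' x) =
      (chartSymmDeriv e (e x)).comp (fderiv ℝ (e ∘ e'.symm) (e' x)) := by
  have hex : (e ∘ e'.symm) (e' x) = e x := by simp [e'.left_inv hx']
  have h1 : HasMFDerivAt (𝓡 n) (𝓡 n) (e ∘ e'.symm) (e' x) (fderiv ℝ (e ∘ e'.symm) (e' x)) :=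
    (differentiableAt_transition he he' hx hx').hasFDerivAt.hasMFDerivAt
  have h2 : HasMFDerivAt (𝓡 n) (𝓡 n) e.symm (e x) (mfderiv (𝓡 n) (𝓡 n) e.symm (e x)) :=
    ((mdifferentiable_chart_of_mem_atlas he).mdifferentiableAt_symm
      (e.map_source hx)).hasMFDerivAt
  rw [← hex] at h2
  have h3 := h2.comp (e' x) h1
  have h4 : e'.symm =ᶠ[nhds (e' x)] e.symm ∘ (e ∘ e'.symm) := by
    filter_upwards [(isOpen_transition_domain e e').mem_nhds (mem_transition_domain hx hx')]
      with z hz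
    exact (e.left_inv hz.2).symm
  have h5 := (h3.congr_of_eventuallyEq h4).mfderiv
  rw [hex] at h5
  exact h5

theorem metricCoord_transition (g : SmoothMetric n M)
    (he : e ∈ atlas (EuclideanSpace ℝ (Fin n)) M)
    (he' : e' ∈ atlas (EuclideanSpace ℝ (Fin n)) M) (hx : x ∈ e.source) (hx' : x ∈ e'.source) :
    metricCoord g e' (e' x) = (chartJacobian e e' (e' x)).transpose * metricCoord g e (e x)
      * chartJacobian e e' (e' x) := by
  ext i j
  rw [metricCoord_apply, chartSymmDeriv_transition he he' hx hx', e'.left_inv hx']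
  simp only [ContinuousLinearMap.comp_apply, fderiv_transition_single, map_sum, map_smul,
    sum_apply, smul_apply, smul_eq_mul, Matrix.mul_apply, Matrix.transpose_apply,
    metricCoord_apply, e.left_inv hx, Finset.mul_sum, Finset.sum_mul]
  exact Finset.sum_congr rfl fun a _ => Finset.sum_congr rfl fun b _ => by ring

theorem isUnit_det_chartJacobian (g : SmoothMetric n M)
    (he : e ∈ atlas (EuclideanSpace ℝ (Fin n)) M)
    (he' : e' ∈ atlas (EuclideanSpace ℝ (Fin n)) M) (hx : x ∈ e.source) (hx' : x ∈ e'.source) :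
    IsUnit (chartJacobian e e' (e' x)).det := by
  have h := (metricCoord_posDef g he' (e'.map_source hx')).det_pos
  rw [metricCoord_transition g he he' hx hx', Matrix.det_mul] at h
  exact (right_ne_zero_of_mul h.ne').isUnit

/-- Along the Ricci flow the Ricci curvature is a tensor, being a time derivative of the metric. -/
theorem ricciMat_transition {g : ℝ → SmoothMetric n M} (hg : IsRicciFlow T g) (hT : 0 < T)
    (ht : t ∈ Icc 0 T) (he : e ∈ atlas (EuclideanSpace ℝ (Fin n)) M)
    (he' : e' ∈ atlas (EuclideanSpace ℝ (Fin n)) M) (hx : x ∈ e.source) (hx' : x ∈ e'.source) :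
    ricciMat (metricCoord (g t) e') (e' x) = (chartJacobian e e' (e' x)).transpose *
      ricciMat (metricCoord (g t) e) (e x) * chartJacobian e e' (e' x) := by
  ext i j
  have h1 := hg.evolution e' he' _ (e'.map_source hx') t ht i j
  set J := chartJacobian e e' (e' x)
  have h2 : HasDerivWithinAt (fun s => ∑ b, (∑ a, J a i * metricCoord (g s) e (e x) a b) * J b j)
      (∑ b, (∑ a, J a i * (-2 * ricciCoord (metricCoord (g t) e) a b (e x))) * J b j)
      (Icc 0 T) t :=
    HasDerivWithinAt.fun_sum fun b _ => (HasDerivWithinAt.fun_sum fun a _ =>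
      (hg.evolution e he _ (e.map_source hx) t ht a b).const_mul _).mul_const _
  have h3 : (fun s => metricCoord (g s) e' (e' x) i j)
      = fun s => ∑ b, (∑ a, J a i * metricCoord (g s) e (e x) a b) * J b j := by
    funext s
    rw [metricCoord_transition (g s) he he' hx hx']
    simp only [Matrix.mul_apply, Matrix.transpose_apply, J]
  rw [h3] at h1
  have h4 := (uniqueDiffOn_Icc hT t ht).eq_deriv _ h1 h2
  have h5 : ∑ b, (∑ a, J a i * (-2 * ricciCoord (metricCoord (g t) e) a b (e x))) * J b j
      = -2 * ∑ b, (∑ a, J a i * ricciCoord (metricCoord (g t) e) a b (e x)) * J b j := by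
    simp only [Finset.mul_sum, Finset.sum_mul]
    exact Finset.sum_congr rfl fun b _ => Finset.sum_congr rfl fun a _ => by ring
  rw [h5] at h4
  simp only [Matrix.mul_apply, Matrix.transpose_apply, ricciMat, Matrix.of_apply]
  linarith

theorem partialVec_transition (he : e ∈ atlas (EuclideanSpace ℝ (Fin n)) M)
    (he' : e' ∈ atlas (EuclideanSpace ℝ (Fin n)) M) (hx : x ∈ e.source) (hx' : x ∈ e'.source)
    {f : M → ℝ} (hf : DifferentiableAt ℝ (f ∘ e.symm) (e x)) :
    partialVec (f ∘ e'.symm) (e' x) =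
      (chartJacobian e e' (e' x)).transpose.mulVec (partialVec (f ∘ e.symm) (e x)) := by
  have hex : (e ∘ e'.symm) (e' x) = e x := by simp [e'.left_inv hx']
  rw [← hex] at hf
  have h1 := hf.hasFDerivAt.comp (e' x) (differentiableAt_transition he he' hx hx').hasFDerivAt
  have h4 : f ∘ e'.symm =ᶠ[nhds (e' x)] (f ∘ e.symm) ∘ (e ∘ e'.symm) := by
    filter_upwards [(isOpen_transition_domain e e').mem_nhds (mem_transition_domain hx hx')]
      with z hz
    simp [e.left_inv hz.2]
  have h5 := (h1.congr_of_eventuallyEq h4).fderiv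
  rw [hex] at h5
  funext i
  simp only [partialVec, partialDeriv, h5, ContinuousLinearMap.comp_apply,
    fderiv_transition_single, map_sum, map_smul, smul_eq_mul, Matrix.mulVec, dotProduct,
    Matrix.transpose_apply]

end Charts

/-! ### The Riemannian measure -/

section Volume

theorem ContinuousOn.measurableSet_preimage_inter {X Y : Type*} [TopologicalSpace X]
    [MeasurableSpace X] [OpensMeasurableSpace X] [TopologicalSpace Y] [MeasurableSpace Y]
    [BorelSpace Y] {f : X → Y} {s : Set X} (hf : ContinuousOn f s) (hs : MeasurableSet s)
    {A : Set Y} (hA : MeasurableSet A) : MeasurableSet (f ⁻¹' A ∩ s) := by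
  have h1 : MeasurableSet ((fun z : s => f z) ⁻¹' A) :=
    (continuousOn_iff_continuous_domRestrict.1 hf).measurable hA
  have h2 := hs.subtype_image h1
  convert h2 using 1
  ext z
  simp only [mem_inter_iff, mem_preimage, mem_image, Subtype.exists, exists_and_left,
    exists_prop, exists_eq_right_right]

theorem aemeasurable_chart_symm {n : ℕ} {M : Type*} [TopologicalSpace M]
    [MeasurableSpace M] [BorelSpace M] (e : OpenPartialHomeomorph M (EuclideanSpace ℝ (Fin n)))
    (ρ : EuclideanSpace ℝ (Fin n) → ENNReal) :
    AEMeasurable e.symm ((volume.restrict e.target).withDensity ρ) :=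
  (e.continuousOn_symm.aemeasurable e.open_target.measurableSet).mono_ac
    (withDensity_absolutelyContinuous _ _)

theorem det_fderiv_transition {n : ℕ} {M : Type*} [TopologicalSpace M]
    (e e' : OpenPartialHomeomorph M (EuclideanSpace ℝ (Fin n)))
    (y' : EuclideanSpace ℝ (Fin n)) :
    (fderiv ℝ (e ∘ e'.symm) y').det = (chartJacobian e e' y').det := by
  rw [ContinuousLinearMap.det, ← LinearMap.det_toMatrix (EuclideanSpace.basisFun (Fin n) ℝ).toBasis]
  rfl

variable {n : ℕ} {M : Type*} [TopologicalSpace M]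
  [ChartedSpace (EuclideanSpace ℝ (Fin n)) M] [IsManifold (𝓡 n) ∞ M]
  [MeasurableSpace M] [BorelSpace M] {g : SmoothMetric n M}
  {e e' : OpenPartialHomeomorph M (EuclideanSpace ℝ (Fin n))}

theorem chartVolume_apply (g : SmoothMetric n M)
    (e : OpenPartialHomeomorph M (EuclideanSpace ℝ (Fin n))) {A : Set M} (hA : MeasurableSet A) :
    chartVolume g e A = ∫⁻ y in e.symm ⁻¹' A ∩ e.target,
      ENNReal.ofReal (√(metricCoord g e y).det) := by
  rw [chartVolume, Measure.map_apply_of_aemeasurable (aemeasurable_chart_symm e _) hA,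
    withDensity_apply', Measure.restrict_restrict' e.open_target.measurableSet]

theorem chartVolume_inter_source (g : SmoothMetric n M)
    (e : OpenPartialHomeomorph M (EuclideanSpace ℝ (Fin n))) {A : Set M} (hA : MeasurableSet A) :
    chartVolume g e (A ∩ e.source) = chartVolume g e A := by
  rw [chartVolume_apply g e (hA.inter e.open_source.measurableSet), chartVolume_apply g e hA]
  congr 2
  ext y
  simp only [mem_inter_iff, mem_preimage]
  exact ⟨fun h => ⟨h.1.1, h.2⟩, fun h => ⟨⟨h.1, e.map_target h.2⟩, h.2⟩⟩

/-- The Riemannian measures of two charts agree on the intersection of their domains. -/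
theorem chartVolume_eq_of_subset (g : SmoothMetric n M)
    (he : e ∈ atlas (EuclideanSpace ℝ (Fin n)) M)
    (he' : e' ∈ atlas (EuclideanSpace ℝ (Fin n)) M) {A : Set M} (hA : MeasurableSet A)
    (h : A ⊆ e.source) (h' : A ⊆ e'.source) : chartVolume g e A = chartVolume g e' A := by
  rw [chartVolume_apply g e hA, chartVolume_apply g e' hA]
  set N := e'.symm ⁻¹' A ∩ e'.target with hN
  have hNm : MeasurableSet N :=
    e'.continuousOn_symm.measurableSet_preimage_inter e'.open_target.measurableSet hA
  have hsub : ∀ z ∈ N, e' (e'.symm z) = z ∧ e'.symm z ∈ e.source ∧ e'.symm z ∈ e'.source :=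
    fun z hz => ⟨e'.right_inv hz.2, h hz.1, h' hz.1⟩
  have himg : e.symm ⁻¹' A ∩ e.target = (e ∘ e'.symm) '' N := by
    ext y
    constructor
    · rintro ⟨h1, h2⟩
      refine ⟨e' (e.symm y), ⟨?_, e'.map_source (h' h1)⟩, ?_⟩
      · rwa [mem_preimage, e'.left_inv (h' h1)]
      · simp only [Function.comp_apply]
        rw [e'.left_inv (h' h1), e.right_inv h2]
    · rintro ⟨z, hz, rfl⟩
      refine ⟨?_, e.map_source (h hz.1)⟩
      simp only [mem_preimage, Function.comp_apply]
      rw [e.left_inv (h hz.1)]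
      exact hz.1
  have hinj : InjOn (e ∘ e'.symm) N := by
    intro z hz w hw hzw
    have h1 := e.injOn (h hz.1) (h hw.1) hzw
    rw [← (hsub z hz).1, h1, (hsub w hw).1]
  have hd : ∀ z ∈ N, HasFDerivWithinAt (e ∘ e'.symm) (fderiv ℝ (e ∘ e'.symm) z) N z := by
    intro z hz
    have := differentiableAt_transition he he' (hsub z hz).2.1 (hsub z hz).2.2
    rw [(hsub z hz).1] at this
    exact this.hasFDerivAt.hasFDerivWithinAt
  rw [himg, lintegral_image_eq_lintegral_abs_det_fderiv_mul volume hNm hd hinj]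
  refine setLIntegral_congr_fun hNm fun z hz => ?_
  simp only [det_fderiv_transition]
  rw [← ENNReal.ofReal_mul (abs_nonneg _)]
  congr 1
  have h1 := metricCoord_transition g he he' (hsub z hz).2.1 (hsub z hz).2.2
  rw [(hsub z hz).1] at h1
  rw [h1, Matrix.det_mul, Matrix.det_mul, Matrix.det_transpose, Function.comp_apply,
    mul_comm _ (Matrix.det (metricCoord g e _)), mul_assoc, ← sq, Real.sqrt_mul',
    Real.sqrt_sq_eq_abs,
    mul_comm]
  exact sq_nonneg _

variable [CompactSpace M]

/-- On the domain of each chart, the Riemannian measure is the measure of that chart. The supremum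
defining the Riemannian measure is bounded by the sum of the chart measures on the pieces of a
countable partition subordinate to the charts. -/
theorem riemannianVolume_apply_of_subset (g : SmoothMetric n M)
    (he : e ∈ atlas (EuclideanSpace ℝ (Fin n)) M) {A : Set M} (hA : MeasurableSet A)
    (h : A ⊆ e.source) : riemannianVolume g A = chartVolume g e A := by
  refine le_antisymm ?_ ?_
  · obtain ⟨s, hs, hcov⟩ := countable_cover_nhds_of_sigmaCompact
      fun x : M => (chartAt (EuclideanSpace ℝ (Fin n)) x).open_source.mem_nhds
        (mem_chart_source _ x)
    have : Nonempty M ∨ IsEmpty M := (isEmpty_or_nonempty M).symm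
    rcases this with hne | hem
    swap
    · rw [Set.eq_empty_of_isEmpty A]; simp
    have hsne : s.Nonempty := by
      obtain ⟨x⟩ := hne
      have : x ∈ ⋃ x ∈ s, (chartAt (EuclideanSpace ℝ (Fin n)) x).source := hcov ▸ mem_univ x
      simp only [mem_iUnion] at this
      exact ⟨this.choose, this.choose_spec.choose⟩
    obtain ⟨c, hc⟩ := hs.exists_eq_range hsne
    let ε : ℕ → OpenPartialHomeomorph M (EuclideanSpace ℝ (Fin n)) := fun k => chartAt _ (c k)
    have hε : ∀ k, ε k ∈ atlas (EuclideanSpace ℝ (Fin n)) M := fun k => chart_mem_atlas _ _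
    let D : ℕ → Set M := disjointed fun k => (ε k).source
    have hDm : ∀ k, MeasurableSet (D k) :=
      MeasurableSet.disjointed fun k => (ε k).open_source.measurableSet
    have hDs : ∀ k, D k ⊆ (ε k).source := fun k => disjointed_subset _ k
    have hDd : Pairwise (Function.onFun Disjoint D) := disjoint_disjointed _
    have hDu : ⋃ k, D k = univ := by
      rw [iUnion_disjointed, ← hcov, hc, biUnion_range]
    let ν : Measure M := Measure.sum fun k => (chartVolume g (ε k)).restrict (D k)
    have hνA : ∀ B, MeasurableSet B → ν B = ∑' k, chartVolume g (ε k) (B ∩ D k) := fun B hB => by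
      rw [Measure.sum_apply _ hB]
      exact tsum_congr fun k => Measure.restrict_apply hB
    have hsplit : ∀ (μ : Measure M) B, MeasurableSet B → μ B = ∑' k, μ (B ∩ D k) := fun μ B hB => by
      rw [← measure_iUnion (fun i j hij => (hDd hij).mono inter_subset_right inter_subset_right)
        fun k => hB.inter (hDm k), ← inter_iUnion, hDu, inter_univ]
    have hle : riemannianVolume g ≤ ν := by
      refine iSup₂_le fun e₁ he₁ => Measure.le_iff.2 fun B hB => ?_
      rw [hνA B hB, hsplit _ B hB]
      refine ENNReal.tsum_le_tsum fun k => ?_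
      have hBk := hB.inter (hDm k)
      rw [← chartVolume_inter_source g e₁ hBk, chartVolume_eq_of_subset g he₁ (hε k)
        (hBk.inter e₁.open_source.measurableSet) inter_subset_right
        (inter_subset_left.trans (inter_subset_right.trans (hDs k)))]
      exact measure_mono inter_subset_left
    refine (hle A).trans_eq ?_
    rw [hνA A hA, hsplit _ A hA]
    exact tsum_congr fun k => chartVolume_eq_of_subset g (hε k) he (hA.inter (hDm k))
      (inter_subset_right.trans (hDs k)) (inter_subset_left.trans h)
  · exact le_iSup₂ (f := fun e _ => chartVolume g e) e he A

theorem riemannianVolume_restrict_source (g : SmoothMetric n M)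
    (he : e ∈ atlas (EuclideanSpace ℝ (Fin n)) M) :
    (riemannianVolume g).restrict e.source = chartVolume g e := by
  ext A hA
  rw [Measure.restrict_apply hA, riemannianVolume_apply_of_subset g he
    (hA.inter e.open_source.measurableSet) inter_subset_right, chartVolume_inter_source g e hA]

/-- Integration over a manifold of a function supported in the domain of a chart. -/
theorem integral_riemannianVolume_eq (g : SmoothMetric n M)
    (he : e ∈ atlas (EuclideanSpace ℝ (Fin n)) M) (hG : IsLocalMetric e.target (metricCoord g e))
    {h : M → ℝ} (hc : Continuous h) (hs : ∀ x ∉ e.source, h x = 0) :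
    ∫ x, h x ∂(riemannianVolume g) =
      ∫ y in e.target, h (e.symm y) * √(metricCoord g e y).det := by
  have hm : AEMeasurable (fun y => ENNReal.ofReal (√(metricCoord g e y).det))
      (volume.restrict e.target) :=
    (hG.smooth_sqrt_det.continuousOn.aemeasurable e.open_target.measurableSet).ennreal_ofReal
  rw [← setIntegral_eq_integral_of_forall_compl_eq_zero hs,
    riemannianVolume_restrict_source g he, chartVolume,
    integral_map (aemeasurable_chart_symm e _) hc.aestronglyMeasurable,
    integral_withDensity_eq_integral_toReal_smul₀ hm (by simp)]
  refine integral_congr_ae (Filter.Eventually.of_forall fun y => ?_)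
  simp only [smul_eq_mul]
  rw [ENNReal.toReal_ofReal (Real.sqrt_nonneg _), mul_comm]

theorem isFiniteMeasure_riemannianVolume (g : SmoothMetric n M)
    (hG : ∀ e ∈ atlas (EuclideanSpace ℝ (Fin n)) M, IsLocalMetric e.target (metricCoord g e)) :
    IsFiniteMeasure (riemannianVolume g) := by
  have : IsLocallyFiniteMeasure (riemannianVolume g) := by
    refine ⟨fun x => ?_⟩
    set e := chartAt (EuclideanSpace ℝ (Fin n)) x
    have he : e ∈ atlas (EuclideanSpace ℝ (Fin n)) M := chart_mem_atlas _ _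
    have hx : x ∈ e.source := mem_chart_source _ x
    obtain ⟨K, hKc, hxK, hK⟩ := exists_compact_subset e.open_target (e.map_source hx)
    refine ⟨e.source ∩ e ⁻¹' interior K,
      (e.isOpen_inter_preimage isOpen_interior).mem_nhds ⟨hx, hxK⟩, ?_⟩
    have hm : MeasurableSet (e.source ∩ e ⁻¹' interior K) :=
      (e.isOpen_inter_preimage isOpen_interior).measurableSet
    rw [riemannianVolume_apply_of_subset g he hm inter_subset_left, chartVolume_apply g e hm]
    have hsub : e.symm ⁻¹' (e.source ∩ e ⁻¹' interior K) ∩ e.target ⊆ K := by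
      rintro y ⟨hy1, hy2⟩
      have := hy1.2
      rw [mem_preimage, e.right_inv hy2] at this
      exact interior_subset this
    refine (lintegral_mono_set hsub).trans_lt ?_
    have hint : IntegrableOn (fun y => √(metricCoord g e y).det) K :=
      ((hG e he).smooth_sqrt_det.continuousOn.mono hK).integrableOn_compact hKc
    rw [← ofReal_integral_eq_lintegral_ofReal hint (ae_of_all _ fun y => Real.sqrt_nonneg _)]
    exact ENNReal.ofReal_lt_top
  infer_instance

theorem isOpenPosMeasure_riemannianVolume (g : SmoothMetric n M)
    (hG : ∀ e ∈ atlas (EuclideanSpace ℝ (Fin n)) M, IsLocalMetric e.target (metricCoord g e)) :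
    (riemannianVolume g).IsOpenPosMeasure := by
  refine ⟨fun O hO ⟨x, hxO⟩ => ?_⟩
  set e := chartAt (EuclideanSpace ℝ (Fin n)) x
  have he : e ∈ atlas (EuclideanSpace ℝ (Fin n)) M := chart_mem_atlas _ _
  have hx : x ∈ e.source := mem_chart_source _ x
  have hopen : IsOpen (e.symm ⁻¹' (O ∩ e.source) ∩ e.target) := by
    rw [inter_comm]
    exact e.symm.isOpen_inter_preimage (hO.inter e.open_source)
  have hne : (e.symm ⁻¹' (O ∩ e.source) ∩ e.target).Nonempty :=
    ⟨e x, by rw [mem_inter_iff, mem_preimage, e.left_inv hx]; exact ⟨⟨hxO, hx⟩, e.map_source hx⟩⟩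
  have hm : MeasurableSet (O ∩ e.source) := (hO.inter e.open_source).measurableSet
  refine fun h0 => (hopen.measure_pos volume hne).ne' ?_
  have h1 : chartVolume g e (O ∩ e.source) = 0 :=
    (riemannianVolume_apply_of_subset g he hm inter_subset_right).symm.trans
      (measure_mono_null inter_subset_left h0)
  rw [chartVolume_apply g e hm] at h1
  have hmeas : AEMeasurable (fun y => ENNReal.ofReal (√(metricCoord g e y).det))
      (volume.restrict (e.symm ⁻¹' (O ∩ e.source) ∩ e.target)) :=
    (((hG e he).smooth_sqrt_det.continuousOn.mono inter_subset_right).aemeasurable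
      hopen.measurableSet).ennreal_ofReal
  have h2 := (ae_restrict_iff' hopen.measurableSet).1 ((lintegral_eq_zero_iff' hmeas).1 h1)
  rw [measure_eq_zero_iff_ae_notMem]
  filter_upwards [h2] with y hy hyN
  have h3 := Real.sqrt_pos.2 ((hG e he).det_pos hyN.2)
  exact (ENNReal.ofReal_pos.2 h3).ne' (hy hyN)

end Volume

/-! ### Integrals of functions supported in a compact part of an open set -/

section CompactSupport

variable {n : ℕ} {U K : Set (EuclideanSpace ℝ (Fin n))} {T : ℝ}

theorem integral_partialDeriv_eq_zero {ψ : EuclideanSpace ℝ (Fin n) → ℝ} (hψ : ContDiff ℝ ∞ ψ)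
    (hc : HasCompactSupport ψ) (k : Fin n) :
    Integrable (partialDeriv k ψ) ∧ ∫ y, partialDeriv k ψ y = 0 := by
  have hcont : Continuous (partialDeriv k ψ) :=
    (hψ.continuous_fderiv (by simp)).clm_apply continuous_const
  have hint : Integrable (partialDeriv k ψ) :=
    hcont.integrable_of_hasCompactSupport (hc.fderiv_apply ℝ _)
  refine ⟨hint, ?_⟩
  have h := integral_mul_fderiv_eq_neg_fderiv_mul_of_integrable (μ := volume)
    (f := fun _ : EuclideanSpace ℝ (Fin n) => (1 : ℝ)) (g := ψ) (v := EuclideanSpace.single k 1)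
    (by simp) (by simp only [one_mul]; exact hint)
    (by simpa using hψ.continuous.integrable_of_hasCompactSupport hc)
    (fun x _ => differentiableAt_const _) (fun x _ => hψ.differentiable (by simp) x)
  simpa [partialDeriv] using h

/-- The integral of a partial derivative of a function supported in a compact subset of `U`. -/
theorem setIntegral_partialDeriv_eq_zero (hU : IsOpen U) (hK : IsCompact K) (hKU : K ⊆ U)
    {ψ : EuclideanSpace ℝ (Fin n) → ℝ} (hψ : ContDiffOn ℝ ∞ ψ U)
    (h0 : ∀ y ∈ U, y ∉ K → ψ y = 0) (k : Fin n) :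
    IntegrableOn (partialDeriv k ψ) U ∧ ∫ y in U, partialDeriv k ψ y = 0 := by
  let Ψ : EuclideanSpace ℝ (Fin n) → ℝ := U.indicator ψ
  have hΨU : EqOn Ψ ψ U := fun y hy => indicator_of_mem hy _
  have hΨK : EqOn Ψ (fun _ => 0) Kᶜ := fun y hy => by
    by_cases hyU : y ∈ U
    · rw [hΨU hyU, h0 y hyU hy]
    · exact indicator_of_notMem hyU _
  have hsmooth : ContDiff ℝ ∞ Ψ := contDiff_iff_contDiffAt.2 fun y => by
    by_cases hy : y ∈ K
    · exact ((hψ.congr hΨU).contDiffAt (hU.mem_nhds (hKU hy)))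
    · exact (contDiffOn_const.congr hΨK).contDiffAt (hK.isClosed.isOpen_compl.mem_nhds hy)
  have hcs : HasCompactSupport Ψ := HasCompactSupport.intro hK fun y hy => hΨK hy
  obtain ⟨h1, h2⟩ := integral_partialDeriv_eq_zero hsmooth hcs k
  have h3 : ∀ y ∈ U, partialDeriv k Ψ y = partialDeriv k ψ y := fun y hy =>
    partialDeriv_congr hU hΨU hy k
  have h4 : ∀ y, y ∉ U → partialDeriv k Ψ y = 0 := fun y hy => by
    rw [partialDeriv_congr hK.isClosed.isOpen_compl hΨK (fun h => hy (hKU h))]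
    simp [partialDeriv]
  refine ⟨h1.integrableOn.congr_fun h3 hU.measurableSet, ?_⟩
  rw [← setIntegral_congr_fun hU.measurableSet h3,
    setIntegral_eq_integral_of_forall_compl_eq_zero h4,
    h2]

/-- Integration by parts against the Laplacian, in a coordinate chart. -/
theorem IsLocalMetric.setIntegral_gradPairCoord_add
    {G : EuclideanSpace ℝ (Fin n) → Matrix (Fin n) (Fin n) ℝ} (hG : IsLocalMetric U G)
    (hK : IsCompact K) (hKU : K ⊆ U) {f φ : EuclideanSpace ℝ (Fin n) → ℝ}
    (hf : ContDiffOn ℝ ∞ f U) (hφ : ContDiffOn ℝ ∞ φ U) (h0 : ∀ y ∈ U, y ∉ K → φ y = 0) :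
    ∫ y in U, (gradPairCoord G f φ y + φ y * laplacianCoord G f y) * √(G y).det = 0 := by
  let X : Fin n → EuclideanSpace ℝ (Fin n) → ℝ := fun k z =>
    ∑ i, (G z)⁻¹ k i * partialDeriv i f z
  have hX : ∀ k, ContDiffOn ℝ ∞ (X k) U := fun k => ContDiffOn.sum fun i _ =>
    (hG.smooth_inv k i).mul (hf.partialDeriv hG.isOpen i)
  have hψ : ∀ k, ContDiffOn ℝ ∞ (fun z => φ z * (X k z * √(G z).det)) U := fun k =>
    hφ.mul ((hX k).mul hG.smooth_sqrt_det)
  have h := fun k => setIntegral_partialDeriv_eq_zero hG.isOpen hK hKU (hψ k)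
    (fun y hy hyK => by rw [h0 y hy hyK, zero_mul]) k
  have key : ∀ y ∈ U, (gradPairCoord G f φ y + φ y * laplacianCoord G f y) * √(G y).det
      = ∑ k, partialDeriv k (fun z => φ z * (X k z * √(G z).det)) y := fun y hy => by
    have hφd := hφ.differentiableAt_infty hG.isOpen hy
    have hXd := fun k => (hX k).differentiableAt_infty hG.isOpen hy
    have hw := hG.smooth_sqrt_det.differentiableAt_infty hG.isOpen hy
    have e1 : ∀ k, partialDeriv k (fun z => φ z * (X k z * √(G z).det)) y
        = (X k y * partialDeriv k φ y) * √(G y).det + φ y * (partialDeriv k (X k) y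
          + (∑ l, christoffel G l k l y) * X k y) * √(G y).det := fun k => by
      rw [partialDeriv_mul hφd ((hXd k).fun_mul hw), partialDeriv_mul (hXd k) hw,
        hG.partialDeriv_sqrt_det hy]
      ring
    have e2 : gradPairCoord G f φ y = ∑ k, X k y * partialDeriv k φ y := by
      rw [hG.gradPairCoord_comm]
      simp only [gradPairCoord, X, Finset.sum_mul]
      exact Finset.sum_congr rfl fun i _ => Finset.sum_congr rfl fun j _ => by ring
    simp only [e1]
    rw [Finset.sum_add_distrib, ← Finset.sum_mul, ← Finset.sum_mul, ← Finset.mul_sum, ← e2,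
      ← hG.laplacianCoord_eq_div hf hy, add_mul]
  rw [setIntegral_congr_fun hG.isOpen.measurableSet key,
    integral_finsetSum _ fun k _ => (h k).1]
  exact Finset.sum_eq_zero fun k _ => (h k).2

/-- Differentiation under the integral sign over a compact set, on a closed time interval. -/
theorem hasDerivWithinAt_setIntegral_of_isCompact {E : Type*} [TopologicalSpace E]
    [MeasurableSpace E] [OpensMeasurableSpace E] [SecondCountableTopology E] [T2Space E]
    {μ : Measure E} [IsFiniteMeasureOnCompacts μ]
    {K : Set E} (hK : IsCompact K) {F F' : E → ℝ → ℝ}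
    (hF : ContinuousOn (fun p : E × ℝ => F p.1 p.2) (K ×ˢ Icc 0 T))
    (hF' : ContinuousOn (fun p : E × ℝ => F' p.1 p.2) (K ×ˢ Icc 0 T))
    (hd : ∀ y ∈ K, ∀ t ∈ Icc 0 T, HasDerivWithinAt (F y) (F' y t) (Icc 0 T) t)
    {t : ℝ} (ht : t ∈ Icc 0 T) :
    HasDerivWithinAt (fun s => ∫ y in K, F y s ∂μ) (∫ y in K, F' y t ∂μ) (Icc 0 T) t := by
  have hKm : MeasurableSet K := hK.measurableSet
  have hslice : ∀ {H : E → ℝ → ℝ}, ContinuousOn (fun p : E × ℝ => H p.1 p.2) (K ×ˢ Icc 0 T) →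
      ∀ s ∈ Icc 0 T, ContinuousOn (fun y => H y s) K := fun hH s hs =>
    hH.comp (continuousOn_id.prodMk continuousOn_const) fun y hy => ⟨hy, hs⟩
  have hint : ∀ s ∈ Icc 0 T, IntegrableOn (fun y => F y s) K μ := fun s hs =>
    (hslice hF s hs).integrableOn_compact hK
  obtain ⟨C, hC⟩ := (hK.prod isCompact_Icc).exists_bound_of_continuousOn hF'
  rw [hasDerivWithinAt_iff_tendsto_slope]
  have hslope : ∀ s ∈ Icc 0 T, slope (fun s => ∫ y in K, F y s ∂μ) t s
      = ∫ y in K, slope (F y) t s ∂μ := fun s hs => by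
    simp only [slope_def_field]
    rw [integral_div, integral_sub (hint s hs) (hint t ht)]
  refine Filter.Tendsto.congr' (f₁ := fun s => ∫ y in K, slope (F y) t s ∂μ) ?_ ?_
  · filter_upwards [self_mem_nhdsWithin] with s hs
    exact (hslope s hs.1).symm
  · refine tendsto_integral_filter_of_dominated_convergence (fun _ => C) ?_ ?_ ?_ ?_
    · filter_upwards [self_mem_nhdsWithin] with s hs
      have : ContinuousOn (fun y => slope (F y) t s) K := by
        simp only [slope_def_field]
        exact ((hslice hF s hs.1).sub (hslice hF t ht)).div_const _
      exact this.aestronglyMeasurable hKm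
    · filter_upwards [self_mem_nhdsWithin] with s hs
      filter_upwards [ae_restrict_mem hKm] with y hy
      have hb := (convex_Icc (0 : ℝ) T).norm_image_sub_le_of_norm_hasDerivWithin_le
        (fun r hr => hd y hy r hr) (fun r hr => hC (y, r) ⟨hy, hr⟩) ht hs.1
      have hne : s - t ≠ 0 := sub_ne_zero.2 hs.2
      rw [slope_def_field, norm_div, div_le_iff₀ (norm_pos_iff.2 hne)]
      exact hb
    · exact continuousOn_const.integrableOn_compact hK
    · filter_upwards [ae_restrict_mem hKm] with y hy
      exact hasDerivWithinAt_iff_tendsto_slope.1 (hd y hy t ht)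

/-- Differentiation under the integral sign for smooth functions of space and time supported in a
compact subset of `U`. -/
theorem hasDerivWithinAt_setIntegral_of_contDiffOn (hU : IsOpen U) (hT : 0 < T) (hK : IsCompact K)
    (hKU : K ⊆ U) {F : EuclideanSpace ℝ (Fin n) × ℝ → ℝ} (hF : ContDiffOn ℝ ∞ F (U ×ˢ Icc 0 T))
    (h0 : ∀ y ∈ U, y ∉ K → ∀ s ∈ Icc 0 T, F (y, s) = 0) {t : ℝ} (ht : t ∈ Icc 0 T) :
    HasDerivWithinAt (fun s => ∫ y in U, F (y, s)) (∫ y in U, timeDeriv T F (y, t))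
      (Icc 0 T) t := by
  have hsub : K ×ˢ Icc 0 T ⊆ U ×ˢ Icc 0 T := prod_mono hKU subset_rfl
  have h := hasDerivWithinAt_setIntegral_of_isCompact (μ := volume) hK
    (F := fun y s => F (y, s)) (F' := fun y s => timeDeriv T F (y, s))
    (hF.continuousOn.mono hsub) ((hF.timeDeriv hU hT).continuousOn.mono hsub)
    (fun y hy s hs => hasDerivWithinAt_timeDeriv hT hF (hKU hy) hs) ht
  have e1 : ∀ s ∈ Icc 0 T, ∫ y in U, F (y, s) = ∫ y in K, F (y, s) := fun s hs =>
    setIntegral_eq_of_subset_of_forall_sdiff_eq_zero hU.measurableSet hKU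
      fun y hy => h0 y hy.1 hy.2 s hs
  have e2 : ∫ y in U, timeDeriv T F (y, t) = ∫ y in K, timeDeriv T F (y, t) :=
    setIntegral_eq_of_subset_of_forall_sdiff_eq_zero hU.measurableSet hKU fun y hy => by
      have : HasDerivWithinAt (fun s => F (y, s)) 0 (Icc 0 T) t :=
        (hasDerivWithinAt_const t (Icc 0 T) (0 : ℝ)).congr (fun s hs => h0 y hy.1 hy.2 s hs)
          (h0 y hy.1 hy.2 t ht)
      exact this.derivWithin (uniqueDiffOn_Icc hT t ht)
  rw [e2]
  exact h.congr e1 (e1 t ht)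

end CompactSupport

/-! ### Smooth functions on the manifold and on space-time -/

section SmoothFunctions

variable {n : ℕ} {M : Type*} [TopologicalSpace M]
  [ChartedSpace (EuclideanSpace ℝ (Fin n)) M] {T t : ℝ}

/-- Smoothness of a function on `M`, expressed in the charts of the atlas. -/
def ChartSmooth (n : ℕ) {M : Type*} [TopologicalSpace M]
    [ChartedSpace (EuclideanSpace ℝ (Fin n)) M] (f : M → ℝ) : Prop :=
  ∀ e ∈ atlas (EuclideanSpace ℝ (Fin n)) M, ContDiffOn ℝ ∞ (fun y => f (e.symm y)) e.target

/-- Smoothness of a function on `M × [0, T]`, expressed in the charts of the atlas. -/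
def SpaceTimeSmooth (n : ℕ) {M : Type*} [TopologicalSpace M]
    [ChartedSpace (EuclideanSpace ℝ (Fin n)) M] (T : ℝ) (F : M → ℝ → ℝ) : Prop :=
  ∀ e ∈ atlas (EuclideanSpace ℝ (Fin n)) M,
    ContDiffOn ℝ ∞ (fun p : EuclideanSpace ℝ (Fin n) × ℝ => F (e.symm p.1) p.2)
      (e.target ×ˢ Icc 0 T)

/-- The time derivative of a function on `M × [0, T]`, one-sided at the ends. -/
noncomputable def timeDerivative (T : ℝ) (F : M → ℝ → ℝ) (x : M) (t : ℝ) : ℝ :=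
  derivWithin (F x) (Icc 0 T) t

theorem ChartSmooth.continuous {f : M → ℝ} (hf : ChartSmooth n f) : Continuous f := by
  refine continuous_iff_continuousAt.2 fun x => ?_
  set e := chartAt (EuclideanSpace ℝ (Fin n)) x
  have hx : x ∈ e.source := mem_chart_source _ x
  have h1 : ContinuousAt (fun y => f (e.symm y)) (e x) :=
    (hf e (chart_mem_atlas _ _)).continuousOn.continuousAt
      (e.open_target.mem_nhds (e.map_source hx))
  have h2 : ContinuousAt ((fun y => f (e.symm y)) ∘ e) x :=
    ContinuousAt.comp h1 (e.continuousAt hx)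
  refine h2.congr ?_
  filter_upwards [e.open_source.mem_nhds hx] with z hz
  simp [e.left_inv hz]

theorem ChartSmooth.mul {f h : M → ℝ} (hf : ChartSmooth n f) (hh : ChartSmooth n h) :
    ChartSmooth n (fun x => f x * h x) := fun e he => (hf e he).mul (hh e he)

namespace SpaceTimeSmooth

variable {F H : M → ℝ → ℝ}

theorem slice (hF : SpaceTimeSmooth n T F) (ht : t ∈ Icc 0 T) :
    ChartSmooth n (fun x => F x t) := fun e he => (hF e he).slice ht

theorem mul (hF : SpaceTimeSmooth n T F) (hH : SpaceTimeSmooth n T H) :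
    SpaceTimeSmooth n T (fun x t => F x t * H x t) := fun e he => (hF e he).mul (hH e he)

theorem add (hF : SpaceTimeSmooth n T F) (hH : SpaceTimeSmooth n T H) :
    SpaceTimeSmooth n T (fun x t => F x t + H x t) := fun e he => (hF e he).add (hH e he)

theorem sub (hF : SpaceTimeSmooth n T F) (hH : SpaceTimeSmooth n T H) :
    SpaceTimeSmooth n T (fun x t => F x t - H x t) := fun e he => (hF e he).sub (hH e he)

theorem const_mul (c : ℝ) (hF : SpaceTimeSmooth n T F) :
    SpaceTimeSmooth n T (fun x t => c * F x t) := fun e he => contDiffOn_const.mul (hF e he)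

theorem _root_.ChartSmooth.spaceTime {f : M → ℝ} (hf : ChartSmooth n f) :
    SpaceTimeSmooth n T (fun x _ => f x) :=
  fun e he => (hf e he).comp contDiffOn_fst fun _ hp => hp.1

theorem timeDerivative (hT : 0 < T) (hF : SpaceTimeSmooth n T F) :
    SpaceTimeSmooth n T (timeDerivative T F) :=
  fun e he => (hF e he).timeDeriv e.open_target hT

theorem hasDerivWithinAt (hT : 0 < T) (hF : SpaceTimeSmooth n T F) (ht : t ∈ Icc 0 T) (x : M) :
    HasDerivWithinAt (F x) (_root_.timeDerivative T F x t) (Icc 0 T) t := by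
  set e := chartAt (EuclideanSpace ℝ (Fin n)) x
  have hx : x ∈ e.source := mem_chart_source _ x
  have h := hasDerivWithinAt_timeDeriv hT (hF e (chart_mem_atlas _ _)) (e.map_source hx) ht
  simp only [timeDeriv, e.left_inv hx] at h
  exact h

end SpaceTimeSmooth

theorem chartSmooth_of_contMDiff [IsManifold (𝓡 n) ∞ M] {f : M → ℝ}
    (hf : ContMDiff (𝓡 n) 𝓘(ℝ, ℝ) ∞ f) : ChartSmooth n f := fun e he =>
  contMDiffOn_iff_contDiffOn.1
    (hf.comp_contMDiffOn (contMDiffOn_infty_symm_of_mem_atlas (e := e) he))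

theorem spaceTimeSmooth_of_contMDiffOn [IsManifold (𝓡 n) ∞ M] {F : M → ℝ → ℝ}
    (hF : ContMDiffOn ((𝓡 n).prod 𝓘(ℝ, ℝ)) 𝓘(ℝ, ℝ) ∞
      (fun p : M × ℝ => F p.1 p.2) (univ ×ˢ Icc 0 T)) : SpaceTimeSmooth n T F := fun e he => by
  have h1 : ContMDiffOn ((𝓡 n).prod 𝓘(ℝ, ℝ)) ((𝓡 n).prod 𝓘(ℝ, ℝ)) ∞
      (fun p : EuclideanSpace ℝ (Fin n) × ℝ => (e.symm p.1, p.2)) (e.target ×ˢ Icc 0 T) :=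
    ((contMDiffOn_infty_symm_of_mem_atlas he).comp contMDiffOn_fst fun p hp => hp.1).prodMk
      contMDiffOn_snd
  have h2 := hF.comp h1 fun p hp => ⟨mem_univ _, hp.2⟩
  rw [← modelWithCornersSelf_prod, chartedSpaceSelf_prod] at h2
  exact contMDiffOn_iff_contDiffOn.1 h2

end SmoothFunctions

/-! ### Gradients and curvature as functions on the manifold -/

section Invariants

variable {n : ℕ} {M : Type*} [TopologicalSpace M]
  [ChartedSpace (EuclideanSpace ℝ (Fin n)) M] [IsManifold (𝓡 n) ∞ M] {T t : ℝ}
  {e : OpenPartialHomeomorph M (EuclideanSpace ℝ (Fin n))} {y : EuclideanSpace ℝ (Fin n)}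

/-- The function `⟨∇f, ∇h⟩` on `M`, computed at each point in the preferred chart. -/
noncomputable def gradPair (g : SmoothMetric n M) (f h : M → ℝ) (x : M) : ℝ :=
  let c := chartAt (EuclideanSpace ℝ (Fin n)) x
  gradPairCoord (metricCoord g c) (fun z => f (c.symm z)) (fun z => h (c.symm z)) (c x)

/-- The scalar curvature as a function on `M`, computed at each point in the preferred chart. -/
noncomputable def scalarCurvature (g : SmoothMetric n M) (x : M) : ℝ :=
  let c := chartAt (EuclideanSpace ℝ (Fin n)) x
  scalarCoord (metricCoord g c) (c x)

/-- The function `|Ric|²` on `M`, computed at each point in the preferred chart. -/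
noncomputable def ricciSq (g : SmoothMetric n M) (x : M) : ℝ :=
  let c := chartAt (EuclideanSpace ℝ (Fin n)) x
  ricciNormSq (metricCoord g c) (c x)

theorem gradPair_symm_apply (g : SmoothMetric n M)
    (he : e ∈ atlas (EuclideanSpace ℝ (Fin n)) M) (hy : y ∈ e.target) {f h : M → ℝ}
    (hf : ChartSmooth n f) (hh : ChartSmooth n h) :
    gradPair g f h (e.symm y) =
      gradPairCoord (metricCoord g e) (fun z => f (e.symm z)) (fun z => h (e.symm z)) y := by
  have hx := e.map_target hy
  have hx' := mem_chart_source (EuclideanSpace ℝ (Fin n)) (e.symm y)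
  have hc := chart_mem_atlas (EuclideanSpace ℝ (Fin n)) (e.symm y)
  have hd : ∀ {k : M → ℝ}, ChartSmooth n k →
      DifferentiableAt ℝ (k ∘ e.symm) (e (e.symm y)) := fun hk => by
    rw [e.right_inv hy]
    exact (hk e he).differentiableAt_infty e.open_target hy
  have h1 := metricCoord_transition g he hc hx hx'
  have h2 := partialVec_transition he hc hx hx' (hd hf)
  have h3 := partialVec_transition he hc hx hx' (hd hh)
  have hJ := isUnit_det_chartJacobian g he hc hx hx'
  rw [e.right_inv hy] at h1 h2 h3
  exact gradPairCoord_transform hJ h1 h2 h3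

variable {g : ℝ → SmoothMetric n M}

theorem scalarCurvature_symm_apply (hg : IsRicciFlow T g) (hT : 0 < T) (ht : t ∈ Icc 0 T)
    (he : e ∈ atlas (EuclideanSpace ℝ (Fin n)) M) (hy : y ∈ e.target) :
    scalarCurvature (g t) (e.symm y) = scalarCoord (metricCoord (g t) e) y := by
  have hx := e.map_target hy
  have hx' := mem_chart_source (EuclideanSpace ℝ (Fin n)) (e.symm y)
  have hc := chart_mem_atlas (EuclideanSpace ℝ (Fin n)) (e.symm y)
  have h1 := metricCoord_transition (g t) he hc hx hx'
  have h2 := ricciMat_transition hg hT ht he hc hx hx'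
  have hJ := isUnit_det_chartJacobian (g t) he hc hx hx'
  rw [e.right_inv hy] at h1 h2
  exact scalarCoord_transform hJ h1 h2

theorem ricciSq_symm_apply (hg : IsRicciFlow T g) (hT : 0 < T) (ht : t ∈ Icc 0 T)
    (he : e ∈ atlas (EuclideanSpace ℝ (Fin n)) M) (hy : y ∈ e.target) :
    ricciSq (g t) (e.symm y) = ricciNormSq (metricCoord (g t) e) y := by
  have hx := e.map_target hy
  have hx' := mem_chart_source (EuclideanSpace ℝ (Fin n)) (e.symm y)
  have hc := chart_mem_atlas (EuclideanSpace ℝ (Fin n)) (e.symm y)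
  have h1 := metricCoord_transition (g t) he hc hx hx'
  have h2 := ricciMat_transition hg hT ht he hc hx hx'
  have hJ := isUnit_det_chartJacobian (g t) he hc hx hx'
  rw [e.right_inv hy] at h1 h2
  exact ricciNormSq_transform hJ h1 h2

theorem spaceTimeSmooth_scalarCurvature (hg : IsRicciFlow T g) (hT : 0 < T) :
    SpaceTimeSmooth n T (fun x t => scalarCurvature (g t) x) := fun _ he =>
  (hg.isLocalRicciFlow hT he).smooth_scalarCoord.congr
    fun _ hp => scalarCurvature_symm_apply hg hT hp.2 he hp.1

theorem IsLocalRicciFlow.smooth_ricciNormSq {U : Set (EuclideanSpace ℝ (Fin n))}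
    {G : ℝ → EuclideanSpace ℝ (Fin n) → Matrix (Fin n) (Fin n) ℝ}
    (hg : IsLocalRicciFlow U T G) :
    ContDiffOn ℝ ∞ (fun p : _ × ℝ => ricciNormSq (G p.2) p.1) (U ×ˢ Icc 0 T) :=
  ContDiffOn.sum fun i _ => ContDiffOn.sum fun j _ => (ContDiffOn.sum fun a _ =>
    ContDiffOn.sum fun b _ => ((hg.smooth_inv i a).mul (hg.smooth_ricciCoord a b)).mul
      (hg.smooth_inv b j)).mul (hg.smooth_ricciCoord i j)

theorem spaceTimeSmooth_ricciSq (hg : IsRicciFlow T g) (hT : 0 < T) :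
    SpaceTimeSmooth n T (fun x t => ricciSq (g t) x) := fun _ he =>
  (hg.isLocalRicciFlow hT he).smooth_ricciNormSq.congr
    fun _ hp => ricciSq_symm_apply hg hT hp.2 he hp.1

theorem SpaceTimeSmooth.gradPair (hg : IsRicciFlow T g) (hT : 0 < T) {F H : M → ℝ → ℝ}
    (hF : SpaceTimeSmooth n T F) (hH : SpaceTimeSmooth n T H) :
    SpaceTimeSmooth n T (fun x t => gradPair (g t) (fun z => F z t) (fun z => H z t) x) :=
  fun e he => by
  have hl := hg.isLocalRicciFlow hT he
  have h : ContDiffOn ℝ ∞ (fun p : EuclideanSpace ℝ (Fin n) × ℝ =>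
      gradPairCoord (metricCoord (g p.2) e) (fun z => F (e.symm z) p.2)
        (fun z => H (e.symm z) p.2) p.1) (e.target ×ˢ Icc 0 T) :=
    ContDiffOn.sum fun i _ => ContDiffOn.sum fun j _ => (hl.smooth_inv i j).mul
      (((hF e he).spaceDeriv e.open_target hT i).mul ((hH e he).spaceDeriv e.open_target hT j))
  exact h.congr fun p hp => gradPair_symm_apply (g p.2) he hp.1 (hF.slice hp.2) (hH.slice hp.2)

end Invariants

/-! ### Integration by parts and differentiation of integrals over the manifold -/

section Global

/-- A smooth partition of unity subordinate to finitely many chart domains. It reduces statements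
about integrals over `M` to functions supported in one chart. -/
theorem exists_finite_chart_partition (n : ℕ) (M : Type*) [TopologicalSpace M] [T2Space M]
    [CompactSpace M] [ChartedSpace (EuclideanSpace ℝ (Fin n)) M] [IsManifold (𝓡 n) ∞ M] :
    ∃ (s : Finset M) (ρ : s → M → ℝ), (∀ i, ChartSmooth n (ρ i)) ∧
      (∀ i, tsupport (ρ i) ⊆ (chartAt (EuclideanSpace ℝ (Fin n)) (i : M)).source) ∧
      ∀ x, ∑ i, ρ i x = 1 := by
  obtain ⟨s, hs⟩ := isCompact_univ.elim_finite_subcover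
    (fun x : M => (chartAt (EuclideanSpace ℝ (Fin n)) x).source)
    (fun x => (chartAt (EuclideanSpace ℝ (Fin n)) x).open_source)
    fun x _ => mem_iUnion_of_mem x (mem_chart_source _ x)
  obtain ⟨f, hf⟩ := SmoothPartitionOfUnity.exists_isSubordinate (𝓡 n) (M := M) isClosed_univ
    (fun i : s => (chartAt (EuclideanSpace ℝ (Fin n)) (i : M)).source)
    (fun i => (chartAt (EuclideanSpace ℝ (Fin n)) (i : M)).open_source)
    (hs.trans fun x hx => by
      simp only [mem_iUnion] at hx ⊢
      exact ⟨⟨hx.choose, hx.choose_spec.choose⟩, hx.choose_spec.choose_spec⟩)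
  refine ⟨s, fun i => f i, fun i => chartSmooth_of_contMDiff (f i).contMDiff, hf, fun x => ?_⟩
  rw [← f.sum_eq_one (mem_univ x), finsum_eq_sum_of_fintype]

/-- A function supported in the domain of a chart is, read in that chart, supported in a compact
subset of the target. -/
theorem isCompact_image_tsupport {n : ℕ} {M : Type*} [TopologicalSpace M] [CompactSpace M]
    {ρ : M → ℝ}
    {e : OpenPartialHomeomorph M (EuclideanSpace ℝ (Fin n))} (h : tsupport ρ ⊆ e.source) :
    IsCompact (e '' tsupport ρ) ∧ e '' tsupport ρ ⊆ e.target ∧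
      ∀ y ∈ e.target, y ∉ e '' tsupport ρ → ρ (e.symm y) = 0 := by
  refine ⟨(isClosed_tsupport ρ).isCompact.image_of_continuousOn (e.continuousOn.mono h), ?_, ?_⟩
  · rintro _ ⟨x, hx, rfl⟩
    exact e.map_source (h hx)
  · intro y hy hyn
    by_contra hne
    exact hyn ⟨e.symm y, subset_tsupport ρ hne, e.right_inv hy⟩

variable {n : ℕ} {M : Type*} [TopologicalSpace M] [ChartedSpace (EuclideanSpace ℝ (Fin n)) M]
  [IsManifold (𝓡 n) ∞ M]

theorem gradPair_sum_right (g : SmoothMetric n M) {ι : Type*} (s : Finset ι) {f : M → ℝ}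
    {h : ι → M → ℝ} (hh : ∀ i, ChartSmooth n (h i)) (x : M) :
    gradPair g f (fun z => ∑ i ∈ s, h i z) x = ∑ i ∈ s, gradPair g f (h i) x := by
  simp only [gradPair, gradPairCoord]
  have hd : ∀ k, partialDeriv k
      (fun z => ∑ i ∈ s, h i ((chartAt (EuclideanSpace ℝ (Fin n)) x).symm z))
      (chartAt (EuclideanSpace ℝ (Fin n)) x x) = ∑ i ∈ s, partialDeriv k
      (fun z => h i ((chartAt (EuclideanSpace ℝ (Fin n)) x).symm z))
      (chartAt (EuclideanSpace ℝ (Fin n)) x x) := fun k =>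
    partialDeriv_sum s (fun i _ => (hh i _ (chart_mem_atlas _ _)).differentiableAt_infty
      (chartAt (EuclideanSpace ℝ (Fin n)) x).open_target
      ((chartAt (EuclideanSpace ℝ (Fin n)) x).map_source (mem_chart_source _ x))) k
  simp only [hd, Finset.mul_sum]
  rw [Finset.sum_congr rfl fun i _ => Finset.sum_comm, Finset.sum_comm]

theorem gradPair_eq_zero_of_notMem_tsupport (g : SmoothMetric n M) (f : M → ℝ) {h : M → ℝ} {x : M}
    (hx : x ∉ tsupport h) : gradPair g f h x = 0 := by
  set e := chartAt (EuclideanSpace ℝ (Fin n)) x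
  have hxe : x ∈ e.source := mem_chart_source _ x
  have hO : IsOpen (e.target ∩ e.symm ⁻¹' (tsupport h)ᶜ) :=
    e.symm.isOpen_inter_preimage (isClosed_tsupport h).isOpen_compl
  have hmem : e x ∈ e.target ∩ e.symm ⁻¹' (tsupport h)ᶜ :=
    ⟨e.map_source hxe, by rwa [mem_preimage, e.left_inv hxe]⟩
  have h0 : ∀ j, partialDeriv j (fun z => h (e.symm z)) (e x) = 0 := fun j => by
    rw [partialDeriv_congr hO (h := fun _ => 0) (fun z hz => image_eq_zero_of_notMem_tsupport hz.2)
      hmem]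
    simp [partialDeriv]
  simp only [gradPair, gradPairCoord]
  exact Finset.sum_eq_zero fun i _ => Finset.sum_eq_zero fun j _ => by rw [h0 j]; ring

theorem continuous_gradPair {g : SmoothMetric n M}
    (hG : ∀ e ∈ atlas (EuclideanSpace ℝ (Fin n)) M, IsLocalMetric e.target (metricCoord g e))
    {f h : M → ℝ} (hf : ChartSmooth n f) (hh : ChartSmooth n h) :
    Continuous (gradPair g f h) := by
  refine ChartSmooth.continuous (n := n) fun e he => ?_
  have h1 : ContDiffOn ℝ ∞ (gradPairCoord (metricCoord g e) (fun z => f (e.symm z))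
      (fun z => h (e.symm z))) e.target :=
    ContDiffOn.sum fun i _ => ContDiffOn.sum fun j _ => ((hG e he).smooth_inv i j).mul
      (((hf e he).partialDeriv e.open_target i).mul ((hh e he).partialDeriv e.open_target j))
  exact h1.congr fun y hy => gradPair_symm_apply g he hy hf hh

variable [CompactSpace M] [MeasurableSpace M] [BorelSpace M]

theorem integrable_of_continuous_riemannianVolume {g : SmoothMetric n M}
    (hG : ∀ e ∈ atlas (EuclideanSpace ℝ (Fin n)) M, IsLocalMetric e.target (metricCoord g e))
    {f : M → ℝ} (hf : Continuous f) : Integrable f (riemannianVolume g) := by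
  have := isFiniteMeasure_riemannianVolume g hG
  obtain ⟨C, hC⟩ := isCompact_univ.exists_bound_of_continuousOn hf.continuousOn
  exact Integrable.of_bound hf.aestronglyMeasurable C (ae_of_all _ fun x => hC x (mem_univ x))

variable [T2Space M]

/-- Green's formula `∫ (⟨∇f, ∇h⟩ + h Δf) dμ = 0`. The function `L` is the Laplacian of `f`. -/
theorem integral_gradPair_add_mul (g : SmoothMetric n M)
    (hG : ∀ e ∈ atlas (EuclideanSpace ℝ (Fin n)) M, IsLocalMetric e.target (metricCoord g e))
    {f h L : M → ℝ} (hf : ChartSmooth n f) (hh : ChartSmooth n h) (hL : Continuous L)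
    (hLf : ∀ e ∈ atlas (EuclideanSpace ℝ (Fin n)) M, ∀ y ∈ e.target,
      L (e.symm y) = laplacianCoord (metricCoord g e) (fun z => f (e.symm z)) y) :
    ∫ x, (gradPair g f h x + h x * L x) ∂(riemannianVolume g) = 0 := by
  obtain ⟨s, ρ, hρ, hsupp, hsum⟩ := exists_finite_chart_partition n M
  have hρh : ∀ i, ChartSmooth n (fun x => ρ i x * h x) := fun i => (hρ i).mul hh
  have hts : ∀ i, tsupport (fun x => ρ i x * h x) ⊆ tsupport (ρ i) := fun i =>
    closure_mono fun x hx h0 => hx (by simp only [h0, zero_mul])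
  have hcont : ∀ i, Continuous fun x =>
      gradPair g f (fun x => ρ i x * h x) x + ρ i x * h x * L x := fun i =>
    (continuous_gradPair hG hf (hρh i)).add ((hρh i).continuous.mul hL)
  have hzero : ∀ i, ∫ x, (gradPair g f (fun x => ρ i x * h x) x + ρ i x * h x * L x)
      ∂(riemannianVolume g) = 0 := fun i => by
    set e := chartAt (EuclideanSpace ℝ (Fin n)) (i : M)
    have he : e ∈ atlas (EuclideanSpace ℝ (Fin n)) M := chart_mem_atlas _ _
    obtain ⟨hK, hKt, hK0⟩ := isCompact_image_tsupport (e := e) (hsupp i)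
    rw [integral_riemannianVolume_eq g he (hG e he) (hcont i) fun x hx => ?_]
    · rw [← (hG e he).setIntegral_gradPairCoord_add hK hKt (hf e he) (hρh i e he)
        fun y hy hyK => by simp only [hK0 y hy hyK, zero_mul]]
      refine setIntegral_congr_fun e.open_target.measurableSet fun y hy => ?_
      simp only [gradPair_symm_apply g he hy hf (hρh i), hLf e he y hy]
    · have hx' : x ∉ tsupport (ρ i) := fun hx' => hx (hsupp i hx')
      rw [gradPair_eq_zero_of_notMem_tsupport g f fun hx'' => hx' (hts i hx''),
        image_eq_zero_of_notMem_tsupport hx']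
      ring
  have hpt : ∀ x, gradPair g f h x + h x * L x
      = ∑ i, (gradPair g f (fun x => ρ i x * h x) x + ρ i x * h x * L x) := fun x => by
    rw [Finset.sum_add_distrib, ← gradPair_sum_right g _ hρh x]
    simp only [← Finset.sum_mul, hsum, one_mul]
  simp only [hpt]
  rw [integral_finsetSum _ fun i _ => integrable_of_continuous_riemannianVolume hG (hcont i)]
  exact Finset.sum_eq_zero fun i _ => hzero i

/-- The derivative of an integral along the Ricci flow: the measure contributes
`∂_t dμ = -R dμ`. -/
theorem hasDerivWithinAt_integral_riemannianVolume {T t : ℝ} {g : ℝ → SmoothMetric n M}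
    (hg : IsRicciFlow T g) (hT : 0 < T) {F : M → ℝ → ℝ} (hF : SpaceTimeSmooth n T F)
    (ht : t ∈ Icc 0 T) :
    HasDerivWithinAt (fun s => ∫ x, F x s ∂(riemannianVolume (g s)))
      (∫ x, (timeDerivative T F x t - scalarCurvature (g t) x * F x t) ∂(riemannianVolume (g t)))
      (Icc 0 T) t := by
  have hG : ∀ s ∈ Icc 0 T, ∀ e ∈ atlas (EuclideanSpace ℝ (Fin n)) M,
      IsLocalMetric e.target (metricCoord (g s) e) := fun s hs e he =>
    (hg.isLocalRicciFlow hT he).isLocalMetric hs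
  obtain ⟨s, ρ, hρ, hsupp, hsum⟩ := exists_finite_chart_partition n M
  have hρF : ∀ i, SpaceTimeSmooth n T (fun x t => ρ i x * F x t) := fun i =>
    (hρ i).spaceTime.mul hF
  have hF' : SpaceTimeSmooth n T
      (fun x t => timeDerivative T F x t - scalarCurvature (g t) x * F x t) :=
    (hF.timeDerivative hT).sub ((spaceTimeSmooth_scalarCurvature hg hT).mul hF)
  have hρF' : ∀ i, SpaceTimeSmooth n T
      (fun x t => ρ i x * (timeDerivative T F x t - scalarCurvature (g t) x * F x t)) := fun i =>
    (hρ i).spaceTime.mul hF'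
  have hsplit : ∀ {H : M → ℝ → ℝ}, (∀ i, SpaceTimeSmooth n T (fun x t => ρ i x * H x t)) →
      ∀ r ∈ Icc 0 T, ∫ x, H x r ∂(riemannianVolume (g r))
        = ∑ i, ∫ x, ρ i x * H x r ∂(riemannianVolume (g r)) := fun {H} hH r hr => by
    rw [← integral_finsetSum _ fun i _ => integrable_of_continuous_riemannianVolume (hG r hr)
      ((hH i).slice hr).continuous]
    simp only [← Finset.sum_mul, hsum, one_mul]
  have hpiece : ∀ i, HasDerivWithinAt (fun r => ∫ x, ρ i x * F x r ∂(riemannianVolume (g r)))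
      (∫ x, ρ i x * (timeDerivative T F x t - scalarCurvature (g t) x * F x t)
        ∂(riemannianVolume (g t))) (Icc 0 T) t := fun i => by
    set e := chartAt (EuclideanSpace ℝ (Fin n)) (i : M)
    have he : e ∈ atlas (EuclideanSpace ℝ (Fin n)) M := chart_mem_atlas _ _
    have hl := hg.isLocalRicciFlow hT he
    obtain ⟨hK, hKt, hK0⟩ := isCompact_image_tsupport (e := e) (hsupp i)
    have hoff : ∀ x ∉ e.source, ρ i x = 0 := fun x hx =>
      image_eq_zero_of_notMem_tsupport fun hx' => hx (hsupp i hx')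
    have hΦ : ContDiffOn ℝ ∞ (fun p : EuclideanSpace ℝ (Fin n) × ℝ =>
        ρ i (e.symm p.1) * F (e.symm p.1) p.2 * √(metricCoord (g p.2) e p.1).det)
        (e.target ×ˢ Icc 0 T) :=
      (hρF i e he).mul (hl.smooth.det.sqrt fun p hp => ((hl.posDef p.2 hp.2 p.1 hp.1).det_pos).ne')
    have h1 := hasDerivWithinAt_setIntegral_of_contDiffOn e.open_target hT hK hKt hΦ
      (fun y hy hyK r _ => by simp only [hK0 y hy hyK, zero_mul]) ht
    have h2 : ∫ x, ρ i x * (timeDerivative T F x t - scalarCurvature (g t) x * F x t)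
        ∂(riemannianVolume (g t)) = ∫ y in e.target, timeDeriv T
          (fun p : EuclideanSpace ℝ (Fin n) × ℝ =>
            ρ i (e.symm p.1) * F (e.symm p.1) p.2 * √(metricCoord (g p.2) e p.1).det) (y, t) := by
      rw [integral_riemannianVolume_eq (g t) he (hG t ht e he) ((hρF' i).slice ht).continuous
        fun x hx => by rw [hoff x hx, zero_mul]]
      refine setIntegral_congr_fun e.open_target.measurableSet fun y hy => ?_
      have h3 := (((hF.hasDerivWithinAt hT ht (e.symm y)).const_mul (ρ i (e.symm y))).mul
        (hl.hasDerivWithinAt_sqrt_det hy ht)).derivWithin (uniqueDiffOn_Icc hT t ht)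
      refine Eq.trans ?_ h3.symm
      simp only [scalarCurvature_symm_apply hg hT ht he hy]
      ring
    rw [h2]
    refine h1.congr (fun r hr => ?_) ?_
    · exact integral_riemannianVolume_eq (g r) he (hG r hr e he) ((hρF i).slice hr).continuous
        fun x hx => by rw [hoff x hx, zero_mul]
    · exact integral_riemannianVolume_eq (g t) he (hG t ht e he) ((hρF i).slice ht).continuous
        fun x hx => by rw [hoff x hx, zero_mul]
  rw [hsplit hρF' t ht]
  exact (HasDerivWithinAt.fun_sum fun i _ => hpiece i).congr (hsplit hρF) (hsplit hρF t ht)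

end Global

/-! ### Log-convexity of functions on an interval -/

section LogConvex

variable {a b : ℝ} {I I' I'' : ℝ → ℝ}

/-- If `I'² ≤ I I''` and `I` is positive somewhere, then `I` is positive everywhere: for every
`ε > 0` the function `log (I + ε)` is convex, hence lies above its tangent at a point where `I` is
positive, and the slope of that tangent is bounded independently of `ε`. -/
theorem pos_of_sq_le_mul (h1 : ∀ t ∈ Icc a b, HasDerivWithinAt I (I' t) (Icc a b) t)
    (h2 : ∀ t ∈ Icc a b, HasDerivWithinAt I' (I'' t) (Icc a b) t)
    (hI : ∀ t ∈ Icc a b, 0 ≤ I t) (hI'' : ∀ t ∈ Icc a b, 0 ≤ I'' t)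
    (hsq : ∀ t ∈ Icc a b, I' t ^ 2 ≤ I t * I'' t) {s : ℝ} (hs : s ∈ Icc a b) (hpos : 0 < I s)
    {t : ℝ} (ht : t ∈ Icc a b) : 0 < I t := by
  set C := |I' s| / I s * |t - s| with hC
  suffices h : I s * Real.exp (-C) ≤ I t from lt_of_lt_of_le (by positivity) h
  refine le_of_forall_pos_le_add fun ε hε => ?_
  have hp : ∀ r ∈ Icc a b, 0 < I r + ε := fun r hr => add_pos_of_nonneg_of_pos (hI r hr) hε
  have hd1 : ∀ r ∈ Icc a b, HasDerivWithinAt (fun r => Real.log (I r + ε)) (I' r / (I r + ε))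
      (Icc a b) r := fun r hr => ((h1 r hr).add_const ε).log (hp r hr).ne'
  have hd2 : ∀ r ∈ Icc a b, HasDerivWithinAt (fun r => I' r / (I r + ε))
      ((I'' r * (I r + ε) - I' r * I' r) / (I r + ε) ^ 2) (Icc a b) r := fun r hr =>
    (h2 r hr).div ((h1 r hr).add_const ε) (hp r hr).ne'
  have hconv : ConvexOn ℝ (Icc a b) (fun r => Real.log (I r + ε)) :=
    convexOn_of_hasDerivWithinAt2_nonneg (convex_Icc a b)
      (fun r hr => (hd1 r hr).continuousWithinAt)
      (fun r hr => (hd1 r (interior_subset hr)).mono interior_subset)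
      (fun r hr => (hd2 r (interior_subset hr)).mono interior_subset)
      fun r hr => div_nonneg (by
        have hr' := interior_subset hr
        nlinarith [hsq r hr', mul_nonneg (hI'' r hr') hε.le]) (sq_nonneg _)
  have htan : Real.log (I s + ε) + I' s / (I s + ε) * (t - s) ≤ Real.log (I t + ε) := by
    rcases lt_trichotomy s t with hst | rfl | hst
    · have h := hconv.le_slope_of_hasDerivWithinAt hs ht hst (hd1 s hs)
      rw [slope_def_field, le_div_iff₀ (sub_pos.2 hst)] at h
      linarith
    · simp
    · have h := hconv.slope_le_of_hasDerivWithinAt ht hs hst (hd1 s hs)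
      rw [slope_def_field, div_le_iff₀ (sub_pos.2 hst)] at h
      linarith
  have hslope : -C ≤ I' s / (I s + ε) * (t - s) := by
    refine neg_le_of_abs_le ?_
    rw [abs_mul, abs_div, abs_of_pos (hp s hs)]
    exact mul_le_mul_of_nonneg_right
      (div_le_div_of_nonneg_left (abs_nonneg _) hpos (by linarith)) (abs_nonneg _)
  calc I s * Real.exp (-C) ≤ (I s + ε) * Real.exp (-C) :=
        mul_le_mul_of_nonneg_right (by linarith) (Real.exp_nonneg _)
    _ = Real.exp (Real.log (I s + ε) + -C) := by rw [Real.exp_add, Real.exp_log (hp s hs)]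
    _ ≤ Real.exp (Real.log (I t + ε)) := Real.exp_le_exp.2 (by linarith)
    _ = I t + ε := Real.exp_log (hp t ht)

theorem contDiffOn_log_and_iteratedDerivWithin_nonneg (hab : a < b)
    (h1 : ∀ t ∈ Icc a b, HasDerivWithinAt I (I' t) (Icc a b) t)
    (h2 : ∀ t ∈ Icc a b, HasDerivWithinAt I' (I'' t) (Icc a b) t)
    (hc : ContinuousOn I'' (Icc a b)) (hI : ∀ t ∈ Icc a b, 0 < I t)
    (hsq : ∀ t ∈ Icc a b, I' t ^ 2 ≤ I t * I'' t) :
    ContDiffOn ℝ 2 (fun t => Real.log (I t)) (Icc a b) ∧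
      ∀ t ∈ Icc a b, 0 ≤ iteratedDerivWithin 2 (fun s => Real.log (I s)) (Icc a b) t := by
  have hu := uniqueDiffOn_Icc hab
  have hd1 : ∀ r ∈ Icc a b, HasDerivWithinAt (fun r => Real.log (I r)) (I' r / I r)
      (Icc a b) r := fun r hr => (h1 r hr).log (hI r hr).ne'
  have hd2 : ∀ r ∈ Icc a b, HasDerivWithinAt (fun r => I' r / I r)
      ((I'' r * I r - I' r * I' r) / I r ^ 2) (Icc a b) r := fun r hr =>
    (h2 r hr).div (h1 r hr) (hI r hr).ne'
  have e1 : EqOn (derivWithin (fun r => Real.log (I r)) (Icc a b)) (fun r => I' r / I r)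
      (Icc a b) := fun r hr => (hd1 r hr).derivWithin (hu r hr)
  have e2 : EqOn (derivWithin (fun r => I' r / I r) (Icc a b))
      (fun r => (I'' r * I r - I' r * I' r) / I r ^ 2) (Icc a b) := fun r hr =>
    (hd2 r hr).derivWithin (hu r hr)
  have c0 : ContinuousOn I (Icc a b) := fun r hr => (h1 r hr).continuousWithinAt
  have c1 : ContinuousOn I' (Icc a b) := fun r hr => (h2 r hr).continuousWithinAt
  refine ⟨?_, fun t ht => ?_⟩
  · rw [show (2 : WithTop ℕ∞) = 1 + 1 from one_add_one_eq_two.symm,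
      contDiffOn_succ_iff_derivWithin hu]
    refine ⟨fun r hr => (hd1 r hr).differentiableWithinAt, by simp, ?_⟩
    refine ContDiffOn.congr ?_ e1
    rw [show (1 : WithTop ℕ∞) = 0 + 1 from (zero_add _).symm, contDiffOn_succ_iff_derivWithin hu]
    refine ⟨fun r hr => (hd2 r hr).differentiableWithinAt, by simp, contDiffOn_zero.2 ?_⟩
    exact (((hc.mul c0).sub (c1.mul c1)).div (c0.pow 2)
      fun r hr => pow_ne_zero 2 (hI r hr).ne').congr e2
  · rw [iteratedDerivWithin_succ, iteratedDerivWithin_one, derivWithin_congr e1 (e1 ht), e2 ht]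
    exact div_nonneg (by nlinarith [hsq t ht]) (sq_nonneg _)

end LogConvex

/-- The Cauchy–Schwarz inequality for `f` and `h` in `L²(μ)`. -/
theorem sq_integral_mul_le {X : Type*} [MeasurableSpace X] {μ : Measure X} {f h : X → ℝ}
    (hf : Integrable (fun x => f x ^ 2) μ) (hfh : Integrable (fun x => f x * h x) μ)
    (hh : Integrable (fun x => h x ^ 2) μ) :
    (∫ x, f x * h x ∂μ) ^ 2 ≤ (∫ x, f x ^ 2 ∂μ) * ∫ x, h x ^ 2 ∂μ := by
  have key : ∀ c : ℝ, 0 ≤ (∫ x, h x ^ 2 ∂μ) * (c * c) + (2 * ∫ x, f x * h x ∂μ) * c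
      + ∫ x, f x ^ 2 ∂μ := fun c => by
    have h0 : 0 ≤ ∫ x, (h x ^ 2 * (c * c) + f x * h x * (2 * c) + f x ^ 2) ∂μ :=
      integral_nonneg fun x => by
        change 0 ≤ h x ^ 2 * (c * c) + f x * h x * (2 * c) + f x ^ 2
        nlinarith [sq_nonneg (f x + c * h x)]
    have hs : Integrable (fun x => h x ^ 2 * (c * c) + f x * h x * (2 * c)) μ :=
      (hh.mul_const _).add (hfh.mul_const _)
    rw [integral_add hs hf, integral_add (hh.mul_const _) (hfh.mul_const _), integral_mul_const,
      integral_mul_const] at h0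
    linarith
  have := discrim_le_zero key
  rw [discrim] at this
  linarith

/-! ### The energy along the Ricci flow -/

section GradPair

variable {n : ℕ} {M : Type*} [TopologicalSpace M] [ChartedSpace (EuclideanSpace ℝ (Fin n)) M]
  [IsManifold (𝓡 n) ∞ M]

theorem gradPair_comm {g : SmoothMetric n M}
    (hG : ∀ e ∈ atlas (EuclideanSpace ℝ (Fin n)) M, IsLocalMetric e.target (metricCoord g e))
    (f h : M → ℝ) (x : M) : gradPair g f h x = gradPair g h f x :=
  (hG _ (chart_mem_atlas _ x)).gradPairCoord_comm _ _ _

theorem gradPair_mul_right (g : SmoothMetric n M) (f : M → ℝ) {h k : M → ℝ}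
    (hh : ChartSmooth n h) (hk : ChartSmooth n k) (x : M) :
    gradPair g f (fun z => h z * k z) x = h x * gradPair g f k x + k x * gradPair g f h x := by
  set c := chartAt (EuclideanSpace ℝ (Fin n)) x
  have hc := chart_mem_atlas (EuclideanSpace ℝ (Fin n)) x
  have hx := c.map_source (mem_chart_source _ x)
  have hd := fun j => partialDeriv_mul ((hh c hc).differentiableAt_infty c.open_target hx)
    ((hk c hc).differentiableAt_infty c.open_target hx) j
  simp only [gradPair, gradPairCoord]
  simp only [Finset.mul_sum, ← Finset.sum_add_distrib]
  refine Finset.sum_congr rfl fun i _ => Finset.sum_congr rfl fun j _ => ?_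
  rw [hd j, c.left_inv (mem_chart_source _ x)]
  ring

end GradPair

section Flow

variable {n : ℕ} {M : Type*} [TopologicalSpace M] [ChartedSpace (EuclideanSpace ℝ (Fin n)) M]
  [IsManifold (𝓡 n) ∞ M] {T t : ℝ} {g : ℝ → SmoothMetric n M} {u : M → ℝ → ℝ}

theorem IsRicciFlow.isLocalMetric (hg : IsRicciFlow T g) (hT : 0 < T) (ht : t ∈ Icc 0 T) :
    ∀ e ∈ atlas (EuclideanSpace ℝ (Fin n)) M, IsLocalMetric e.target (metricCoord (g t) e) :=
  fun _ he => (hg.isLocalRicciFlow hT he).isLocalMetric ht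

theorem IsRicciFlow.posSemidef_ricciMat (hg : IsRicciFlow T g) (hT : 0 < T) (ht : t ∈ Icc 0 T)
    (hRic : RicciNonneg (g t)) {e : OpenPartialHomeomorph M (EuclideanSpace ℝ (Fin n))}
    (he : e ∈ atlas (EuclideanSpace ℝ (Fin n)) M) {y : EuclideanSpace ℝ (Fin n)}
    (hy : y ∈ e.target) : (ricciMat (metricCoord (g t) e) y).PosSemidef :=
  _root_.posSemidef_ricciMat
    (fun i j => (hg.isLocalRicciFlow hT he).ricciCoord_symm ht hy i j) (hRic e he y hy)

theorem ricciSq_nonneg (hg : IsRicciFlow T g) (hT : 0 < T) (ht : t ∈ Icc 0 T)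
    (hRic : RicciNonneg (g t)) (x : M) : 0 ≤ ricciSq (g t) x :=
  have he := chart_mem_atlas (EuclideanSpace ℝ (Fin n)) x
  have hy := (chartAt (EuclideanSpace ℝ (Fin n)) x).map_source (mem_chart_source _ x)
  ricciNormSq_nonneg (hg.isLocalMetric hT ht _ he) hy (hg.posSemidef_ricciMat hT ht hRic he hy)

/-- Along a Ricci flow with nonnegative Ricci curvature, `∂_t |∇F|² ≥ 2 ⟨∇F, ∇F_t⟩`: the difference
is `2 Ric(∇F, ∇F)`. -/
theorem two_mul_gradPair_le_timeDerivative (hg : IsRicciFlow T g) (hT : 0 < T) (ht : t ∈ Icc 0 T)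
    (hRic : RicciNonneg (g t)) {F : M → ℝ → ℝ} (hF : SpaceTimeSmooth n T F) (x : M) :
    2 * gradPair (g t) (fun z => F z t) (fun z => timeDerivative T F z t) x ≤
      timeDerivative T (fun x t => gradPair (g t) (fun z => F z t) (fun z => F z t) x) x t := by
  have he := chart_mem_atlas (EuclideanSpace ℝ (Fin n)) x
  have hy := (chartAt (EuclideanSpace ℝ (Fin n)) x).map_source (mem_chart_source _ x)
  have h := ((hg.isLocalRicciFlow hT he).hasDerivWithinAt_gradPairCoord (hF _ he) hy
    ht).derivWithin (uniqueDiffOn_Icc hT t ht)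
  refine le_of_le_of_eq ?_ h.symm
  exact le_add_of_nonneg_left (mul_nonneg zero_le_two
    (ricciGradCoord_nonneg (hg.isLocalMetric hT ht _ he) hy
      (hg.posSemidef_ricciMat hT ht hRic he hy) _))

/-- The evolution equation of the scalar curvature, read as a formula for its Laplacian. -/
theorem laplacianCoord_scalarCurvature (hg : IsRicciFlow T g) (hT : 0 < T) (ht : t ∈ Icc 0 T)
    {e : OpenPartialHomeomorph M (EuclideanSpace ℝ (Fin n))}
    (he : e ∈ atlas (EuclideanSpace ℝ (Fin n)) M) {y : EuclideanSpace ℝ (Fin n)}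
    (hy : y ∈ e.target) :
    timeDerivative T (fun x t => scalarCurvature (g t) x) (e.symm y) t
        - 2 * ricciSq (g t) (e.symm y) =
      laplacianCoord (metricCoord (g t) e) (fun z => scalarCurvature (g t) (e.symm z)) y := by
  have hl := hg.isLocalRicciFlow hT he
  have hR : ∀ s ∈ Icc 0 T, EqOn (fun z => scalarCurvature (g s) (e.symm z))
      (scalarCoord (metricCoord (g s) e)) e.target := fun s hs z hz =>
    scalarCurvature_symm_apply hg hT hs he hz
  have h1 : timeDerivative T (fun x t => scalarCurvature (g t) x) (e.symm y) t =
      laplacianCoord (metricCoord (g t) e) (scalarCoord (metricCoord (g t) e)) y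
        + 2 * ricciNormSq (metricCoord (g t) e) y :=
    ((hl.hasDerivWithinAt_scalarCoord hy ht).congr (fun s hs => hR s hs hy)
      (hR t ht hy)).derivWithin (uniqueDiffOn_Icc hT t ht)
  have h2 : laplacianCoord (metricCoord (g t) e) (fun z => scalarCurvature (g t) (e.symm z)) y =
      laplacianCoord (metricCoord (g t) e) (scalarCoord (metricCoord (g t) e)) y := by
    have hp : ∀ j, EqOn (partialDeriv j fun z => scalarCurvature (g t) (e.symm z))
        (partialDeriv j (scalarCoord (metricCoord (g t) e))) e.target := fun j z hz =>
      partialDeriv_congr e.open_target (hR t ht) hz j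
    simp only [laplacianCoord, partialDeriv_congr e.open_target (hp _) hy, hp _ hy]
  rw [h1, h2, ricciSq_symm_apply hg hT ht he hy]
  ring

/-- The function `2 |∇u|² + R u²`, whose integral is the derivative of the energy. -/
noncomputable def energyRate (g : ℝ → SmoothMetric n M) (u : M → ℝ → ℝ) (x : M) (t : ℝ) : ℝ :=
  2 * gradPair (g t) (fun z => u z t) (fun z => u z t) x
    + scalarCurvature (g t) x * (u x t * u x t)

theorem spaceTimeSmooth_energyRate (hg : IsRicciFlow T g) (hT : 0 < T)
    (hu : SpaceTimeSmooth n T u) : SpaceTimeSmooth n T (energyRate g u) :=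
  ((hu.gradPair hg hT hu).const_mul 2).add
    ((spaceTimeSmooth_scalarCurvature hg hT).mul (hu.mul hu))

theorem IsConjugateHeatSolution.laplacianCoord_eq (hg : IsRicciFlow T g)
    (hu : IsConjugateHeatSolution T g u) (hT : 0 < T) (ht : t ∈ Icc 0 T)
    {e : OpenPartialHomeomorph M (EuclideanSpace ℝ (Fin n))}
    (he : e ∈ atlas (EuclideanSpace ℝ (Fin n)) M) {y : EuclideanSpace ℝ (Fin n)}
    (hy : y ∈ e.target) :
    scalarCurvature (g t) (e.symm y) * u (e.symm y) t - timeDerivative T u (e.symm y) t =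
      laplacianCoord (metricCoord (g t) e) (fun z => u (e.symm z) t) y := by
  rw [scalarCurvature_symm_apply hg hT ht he hy, ← hu.equation e he y hy t ht]
  exact add_sub_cancel_left _ _

variable [T2Space M] [CompactSpace M] [MeasurableSpace M] [BorelSpace M]

/-- Green's formula `∫ (⟨∇u, ∇h⟩ + h Δu) dμ = 0`, where `Δu = R u - u_t`. -/
theorem IsConjugateHeatSolution.integral_gradPair_add_mul (hg : IsRicciFlow T g)
    (hu : IsConjugateHeatSolution T g u) (hT : 0 < T) (ht : t ∈ Icc 0 T) {h : M → ℝ}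
    (hh : ChartSmooth n h) :
    ∫ x, (gradPair (g t) (fun z => u z t) h x
      + h x * (scalarCurvature (g t) x * u x t - timeDerivative T u x t))
        ∂(riemannianVolume (g t)) = 0 := by
  have hus := spaceTimeSmooth_of_contMDiffOn hu.smooth
  exact _root_.integral_gradPair_add_mul (g t) (hg.isLocalMetric hT ht) (hus.slice ht) hh
    ((((spaceTimeSmooth_scalarCurvature hg hT).mul hus).sub
      (hus.timeDerivative hT)).slice ht).continuous
    fun e he y hy => hu.laplacianCoord_eq hg hT ht he hy

/-- The derivative of the energy, `∫ (2 |∇u|² + R u²) dμ`, is also the `L²` product `⟨u, A u⟩` with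
`A u = 2 u_t - R u`, which equals `-2 Δu + R u`. -/
theorem integral_energyRate_eq (hg : IsRicciFlow T g) (hu : IsConjugateHeatSolution T g u)
    (hT : 0 < T) (ht : t ∈ Icc 0 T) :
    ∫ x, energyRate g u x t ∂(riemannianVolume (g t)) =
      ∫ x, u x t * (2 * timeDerivative T u x t - scalarCurvature (g t) x * u x t)
        ∂(riemannianVolume (g t)) := by
  have hus := spaceTimeSmooth_of_contMDiffOn hu.smooth
  have hR := spaceTimeSmooth_scalarCurvature hg hT
  have hut := hus.timeDerivative hT
  have hint : ∀ {F : M → ℝ → ℝ}, SpaceTimeSmooth n T F →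
      Integrable (fun x => F x t) (riemannianVolume (g t)) := fun hF =>
    integrable_of_continuous_riemannianVolume (hg.isLocalMetric hT ht) (hF.slice ht).continuous
  have h0 := hu.integral_gradPair_add_mul hg hT ht (hus.slice ht)
  rw [← add_zero (∫ x, u x t * _ ∂_), ← mul_zero (2 : ℝ), ← h0, ← integral_const_mul,
    ← integral_add (hint (hus.mul ((hut.const_mul 2).sub (hR.mul hus))))
      ((hint ((hus.gradPair hg hT hus).add (hus.mul ((hR.mul hus).sub hut)))).const_mul 2)]
  refine integral_congr_ae (ae_of_all _ fun x => ?_)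
  simp only [energyRate]
  ring

theorem hasDerivWithinAt_energy (hg : IsRicciFlow T g) (hu : IsConjugateHeatSolution T g u)
    (hT : 0 < T) (ht : t ∈ Icc 0 T) :
    HasDerivWithinAt (energy g u) (∫ x, energyRate g u x t ∂(riemannianVolume (g t)))
      (Icc 0 T) t := by
  have hus := spaceTimeSmooth_of_contMDiffOn hu.smooth
  have h := hasDerivWithinAt_integral_riemannianVolume hg hT (hus.mul hus) ht
  simp only [← sq] at h
  refine h.congr_deriv ?_
  rw [integral_energyRate_eq hg hu hT ht]
  refine integral_congr_ae (ae_of_all _ fun x => ?_)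
  have hd : timeDerivative T (fun x t => u x t ^ 2) x t = 2 * u x t * timeDerivative T u x t := by
    have h1 := ((hus.hasDerivWithinAt hT ht x).pow 2).derivWithin (uniqueDiffOn_Icc hT t ht)
    refine h1.trans ?_
    simp
  simp only [hd]
  ring

/-- The second derivative of the energy is at least `‖A u‖² = ∫ (2 u_t - R u)² dμ`; the difference
is `∫ (2 |Ric|² u² + 4 Ric(∇u, ∇u)) dμ`. -/
theorem integral_sq_le_integral_timeDerivative_energyRate (hg : IsRicciFlow T g)
    (hu : IsConjugateHeatSolution T g u) (hT : 0 < T) (ht : t ∈ Icc 0 T)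
    (hRic : RicciNonneg (g t)) :
    ∫ x, (2 * timeDerivative T u x t - scalarCurvature (g t) x * u x t) ^ 2
        ∂(riemannianVolume (g t)) ≤
      ∫ x, (timeDerivative T (energyRate g u) x t - scalarCurvature (g t) x * energyRate g u x t)
        ∂(riemannianVolume (g t)) := by
  have hG := hg.isLocalMetric hT ht
  have hus := spaceTimeSmooth_of_contMDiffOn hu.smooth
  have hR := spaceTimeSmooth_scalarCurvature hg hT
  have hS := spaceTimeSmooth_ricciSq hg hT
  have hut := hus.timeDerivative hT
  have hRt := hR.timeDerivative hT
  have hB := hus.gradPair hg hT hus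
  have hE := spaceTimeSmooth_energyRate hg hT hus
  have hL := (hR.mul hus).sub hut
  have hA := (hut.const_mul 2).sub (hR.mul hus)
  have hint : ∀ {F : M → ℝ → ℝ}, SpaceTimeSmooth n T F →
      Integrable (fun x => F x t) (riemannianVolume (g t)) := fun hF =>
    integrable_of_continuous_riemannianVolume hG (hF.slice ht).continuous
  have h1 := hu.integral_gradPair_add_mul hg hT ht (hut.slice ht)
  have h2 := hu.integral_gradPair_add_mul hg hT ht ((hR.mul hus).slice ht)
  have h3 := integral_gradPair_add_mul (g t) hG (hR.slice ht) ((hus.mul hus).slice ht)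
    ((hRt.sub (hS.const_mul 2)).slice ht).continuous
    fun e he y hy => laplacianCoord_scalarCurvature hg hT ht he hy
  -- The coefficients `4`, `-2`, `1` of the three Green identities are chosen so that adding them to
  -- `(2 u_t - R u)²` leaves, pointwise, only `2 |Ric|² u² + 4 Ric(∇u, ∇u)` to compare with.
  have i1 := (hint ((hus.gradPair hg hT hut).add (hut.mul hL))).const_mul 4
  have i2 := (hint ((hus.gradPair hg hT (hR.mul hus)).add ((hR.mul hus).mul hL))).const_mul (-2)
  have i3 := hint ((hR.gradPair hg hT (hus.mul hus)).add
    ((hus.mul hus).mul (hRt.sub (hS.const_mul 2))))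
  have i0 := hint (hA.mul hA)
  have i12 := i1.add i2
  have i123 := i12.add i3
  have key := integral_mono (i0.add i123)
    (hint ((hE.timeDerivative hT).sub (hR.mul hE))) fun x => ?_
  · rw [integral_add' i0 i123, integral_add' i12 i3, integral_add' i1 i2, integral_const_mul,
      integral_const_mul, h1, h2, h3] at key
    simpa only [mul_zero, add_zero, sq] using key
  · have hEt : timeDerivative T (energyRate g u) x t =
        2 * timeDerivative T (fun x t => gradPair (g t) (fun z => u z t) (fun z => u z t) x) x t
          + (timeDerivative T (fun x t => scalarCurvature (g t) x) x t * (u x t * u x t)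
            + scalarCurvature (g t) x
              * (timeDerivative T u x t * u x t + u x t * timeDerivative T u x t)) :=
      (((hB.hasDerivWithinAt hT ht x).const_mul 2).add ((hR.hasDerivWithinAt hT ht x).mul
        ((hus.hasDerivWithinAt hT ht x).mul (hus.hasDerivWithinAt hT ht x)))).derivWithin
        (uniqueDiffOn_Icc hT t ht)
    have hK := two_mul_gradPair_le_timeDerivative hg hT ht hRic hus x
    have hSu := mul_nonneg (ricciSq_nonneg hg hT ht hRic x) (mul_self_nonneg (u x t))
    have hp1 := gradPair_mul_right (g t) (fun z => u z t) (hR.slice ht) (hus.slice ht) x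
    have hp2 := gradPair_mul_right (g t) (fun z => scalarCurvature (g t) z) (hus.slice ht)
      (hus.slice ht) x
    rw [gradPair_comm hG (fun z => u z t) (fun z => scalarCurvature (g t) z)] at hp1
    simp only [Pi.add_apply, hEt, hp1, hp2, energyRate]
    nlinarith only [hK, hSu]

end Flow

/-! ### Log-convexity of the energy -/

theorem mainTheorem12 {n : ℕ} {M : Type*} [TopologicalSpace M] [T2Space M] [CompactSpace M]
    [ChartedSpace (EuclideanSpace ℝ (Fin n)) M] [IsManifold (𝓡 n) ∞ M]
    [MeasurableSpace M] [BorelSpace M]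
    {T : ℝ} (hT : 0 < T) (g : ℝ → SmoothMetric n M) (hg : IsRicciFlow T g)
    (hRic : ∀ t ∈ Icc 0 T, RicciNonneg (g t))
    (u : M → ℝ → ℝ) (hu : IsConjugateHeatSolution T g u)
    (hu0 : ∃ t ∈ Icc 0 T, ∃ x, u x t ≠ 0) :
    (∀ t ∈ Icc 0 T, Integrable (fun x => (u x t) ^ 2) (riemannianVolume (g t))) ∧
    (∀ t ∈ Icc 0 T, 0 < energy g u t) ∧
    ContDiffOn ℝ 2 (fun t => Real.log (energy g u t)) (Icc 0 T) ∧
    ∀ t ∈ Icc 0 T,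
      0 ≤ iteratedDerivWithin 2 (fun s => Real.log (energy g u s)) (Icc 0 T) t := by
  have hus := spaceTimeSmooth_of_contMDiffOn hu.smooth
  have hR := spaceTimeSmooth_scalarCurvature hg hT
  have hut := hus.timeDerivative hT
  have hE := spaceTimeSmooth_energyRate hg hT hus
  have hE' := (hE.timeDerivative hT).sub (hR.mul hE)
  have hint : ∀ {F : M → ℝ → ℝ}, SpaceTimeSmooth n T F → ∀ t ∈ Icc 0 T,
      Integrable (fun x => F x t) (riemannianVolume (g t)) := fun hF t ht =>
    integrable_of_continuous_riemannianVolume (hg.isLocalMetric hT ht) (hF.slice ht).continuous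
  have hsq : ∀ t ∈ Icc 0 T, Integrable (fun x => u x t ^ 2) (riemannianVolume (g t)) :=
    fun t ht => by simpa only [sq] using hint (hus.mul hus) t ht
  have h1 := fun t ht => hasDerivWithinAt_energy hg hu hT (t := t) ht
  have h2 := fun t ht => hasDerivWithinAt_integral_riemannianVolume hg hT hE (t := t) ht
  have h3 := fun t ht => hasDerivWithinAt_integral_riemannianVolume hg hT hE' (t := t) ht
  have hle := fun t ht =>
    integral_sq_le_integral_timeDerivative_energyRate hg hu hT ht (hRic t ht)
  have hnonneg : ∀ t ∈ Icc 0 T, 0 ≤ energy g u t := fun t _ => integral_nonneg fun x => sq_nonneg _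
  have hA := (hut.const_mul 2).sub (hR.mul hus)
  have hcs : ∀ t ∈ Icc 0 T, (∫ x, energyRate g u x t ∂(riemannianVolume (g t))) ^ 2 ≤
      energy g u t * ∫ x, (timeDerivative T (energyRate g u) x t
        - scalarCurvature (g t) x * energyRate g u x t) ∂(riemannianVolume (g t)) :=
    fun t ht => by
    -- the Cauchy–Schwarz inequality `⟨u, A u⟩² ≤ ‖u‖² ‖A u‖²`, where `A u = 2 u_t - R u`
    rw [integral_energyRate_eq hg hu hT ht]
    exact (sq_integral_mul_le (hsq t ht) (hint (hus.mul hA) t ht)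
      (by simpa only [sq] using hint (hA.mul hA) t ht)).trans
      (mul_le_mul_of_nonneg_left (hle t ht) (hnonneg t ht))
  have hpos : ∀ t ∈ Icc 0 T, 0 < energy g u t := fun t ht => by
    obtain ⟨s, hs, x, hx⟩ := hu0
    have hfin := isFiniteMeasure_riemannianVolume (g s) (hg.isLocalMetric hT hs)
    have hopen := isOpenPosMeasure_riemannianVolume (g s) (hg.isLocalMetric hT hs)
    have hs0 : 0 < energy g u s :=
      ((hus.slice hs).continuous.pow 2).integral_pos_of_hasCompactSupport_nonneg_nonzero
        (HasCompactSupport.of_compactSpace _) (fun x => sq_nonneg _) (pow_ne_zero 2 hx)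
    exact pos_of_sq_le_mul h1 h2 hnonneg
      (fun t ht => (integral_nonneg fun x => sq_nonneg _).trans (hle t ht)) hcs hs hs0 ht
  exact ⟨hsq, hpos, contDiffOn_log_and_iteratedDerivWithin_nonneg hT h1 h2
    (fun t ht => (h3 t ht).continuousWithinAt) hpos hcs⟩
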